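/- **Setting.** Let $\mathbb T^2$ be identified with $[0,1)\times[0,1)\ni(q,p)$, and let $C^\infty(\mathbb T^2)$ be the smooth complex-valued $\mathbb Z^2$-periodic functions on $\mathbb R^2$, with $\|f\|_{C^0}=\sup|f|$ and $\|f\|_{C^j}=\sum_{\gamma_1+\gamma_2\le j}\|\partial_q^{\gamma_1}\partial_p^{\gamma_2}f\|_{C^0}$. The baker's map is the bijection $B(q,p)=(2q,p/2)$ if $q<1/2$, $B(q,p)=(2q-1,(p+1)/2)$ if $q\ge1/2$. For even $N\ge2$ let $\mathcal H_N=\mathbb C^N$ with its Hermitian inner product and orthonormal position basis $\mathbf q_0,\dots,\mathbf q_{N-1}$ (indices modulo $N$), and let $\|\cdot\|$ be the operator norm on $\mathcal H_N$. For $k\in\mathbb Z^2$ put $T(k)\mathbf q_j=e^{i\pi k_1k_2/N}e^{2\pi i k_2 j/N}\mathbf q_{j+k_1}$ (the quantum translation by $k/N$), and for $f\in C^\infty(\mathbb T^2)$ define the Weyl quantisation $\mathrm{Op}^W_N(f)=\sum_{k\in\mathbb Z^2}\tilde f(k)\,T(k)$, where $f(q,p)=\sum_k\tilde f(k)e^{2\pi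 i(qk_2-pk_1)}$. The quantised baker's map is the unitary matrix $\hat B_N=F_N^{-1}\begin{pmatrix}F_{N/2}&0\\0&F_{N/2}\end{pmatrix}$, with $(F_M)_{kj}=M^{-1/2}e^{-2\pi i kj/M}$, $0\le k,j<M$. Let $T_E=T_E(N)=\log N/\log 2$. For $0<\delta<1/4$ and $K>0$, a *cutoff of width $\delta$ with constant $K$* is a smooth $\mathbb Z$-periodic function $\tilde\chi_\delta:\mathbb R\to\mathbb R$ that vanishes on $[-\delta,\delta]$ modulo $\mathbb Z$, equals $1$ on $[2\delta,1-2\delta]$ modulo $\mathbb Z$, and satisfies $|\tilde\chi_\delta^{(j)}|\le K\delta^{-j}$ for $0\le j\le4$. For $n\ge0$ put $\chi_{\delta,n}(q,p)=\tilde\chi_\delta(2^nq)\,\tilde\chi_\delta(p)$ and $\chi_{\delta,-n}(q,p)=\tilde\chi_\delta(2^np)\,\tilde\chi_\delta(q)$; the *good part* of $a\in C^\infty(\mathbb T^2)$ is $a_n=a\,\chi_{\delta,n}$, $n\in\mathbb Z$. **Theorem.** For every $\varepsilon>0$ there is $N(\varepsilon)$, depending only on $\varepsilon$, and for every $K>0$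 there is a constant $C>0$, depending only on $K$ (in particular independent of $a$ and $\varepsilon$), such that the following holds. Let $\varepsilon>0$, $a\in C^\infty(\mathbb T^2)$, let $N\ge N(\varepsilon)$ be a positive even integer, let $\min(N^{-\varepsilon/4},1/10)\le\delta<1/4$, and let $\tilde\chi_\delta$ be a cutoff of width $\delta$ with constant $K$ ($\delta$ and $\tilde\chi_\delta$ may depend on $N$). Then for every $n\in\mathbb Z$ with $|n|\le(1-\varepsilon)T_E(N)$, the function $a_n\circ B^{-n}$ belongs to $C^\infty(\mathbb T^2)$ and $$\big\|\hat B_N^{n}\,\mathrm{Op}^W_N(a_n)\,\hat B_N^{-n}-\mathrm{Op}^W_N(a_n\circ B^{-n})\big\|\le C\Big(\|a\|_{C^0}\,N^{3/2}\,e^{-\pi N^{\varepsilon/2}}+\frac{\|a\|_{C^4}}{N^{\varepsilon/2}}\Big).$$ -/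

import Mathlib

open scoped ContDiff

noncomputable section

namespace QBaker

/-! ### The classical baker's map on the torus, identified with `[0,1) × [0,1)` -/

/-- The torus `𝕋²`, identified with the square `[0,1) × [0,1)`; points are `(q, p)`. -/
abbrev Square : Type := Set.Ico (0 : ℝ) 1 × Set.Ico (0 : ℝ) 1

/-- The baker's map: `(q, p) ↦ (2q, p/2)` for `q < 1/2` and `(2q - 1, (p+1)/2)` for `q ≥ 1/2`. -/
def bakerFun (x : Square) : Square :=
  if h : (x.1 : ℝ) < 1 / 2 then
    (⟨2 * x.1, by have := x.1.2.1; constructor <;> linarith⟩,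
     ⟨x.2 / 2, by have := x.2.2.1; have := x.2.2.2; constructor <;> linarith⟩)
  else
    (⟨2 * x.1 - 1, by have := x.1.2.2; push Not at h; constructor <;> linarith⟩,
     ⟨(x.2 + 1) / 2, by have := x.2.2.1; have := x.2.2.2; constructor <;> linarith⟩)

/-- The inverse map: `(q, p) ↦ (q/2, 2p)` for `p < 1/2` and `((q+1)/2, 2p - 1)` for `p ≥ 1/2`. -/
def bakerInv (x : Square) : Square :=
  if h : (x.2 : ℝ) < 1 / 2 then
    (⟨x.1 / 2, by have := x.1.2.1; have := x.1.2.2; constructor <;> linarith⟩,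
     ⟨2 * x.2, by have := x.2.2.1; constructor <;> linarith⟩)
  else
    (⟨(x.1 + 1) / 2, by have := x.1.2.1; have := x.1.2.2; constructor <;> linarith⟩,
     ⟨2 * x.2 - 1, by have := x.2.2.2; push Not at h; constructor <;> linarith⟩)

/-- The baker's map `B` as a bijection of the torus, so that `B ^ n` makes sense for `n : ℤ`. -/
def baker : Equiv.Perm Square where
  toFun := bakerFun
  invFun := bakerInv
  left_inv := by
    rintro ⟨⟨q, hq0, hq1⟩, ⟨p, hp0, hp1⟩⟩
    by_cases h : q < 1 / 2
    · have h2 : p / 2 < 1 / 2 := by linarith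
      simp only [bakerFun, h, dif_pos, bakerInv, h2]
      exact Prod.ext (Subtype.ext (by dsimp only; ring)) (Subtype.ext (by dsimp only; ring))
    · have h2 : ¬ (p + 1) / 2 < 1 / 2 := by linarith
      simp only [bakerFun, h, dif_neg, not_false_eq_true, bakerInv, h2]
      exact Prod.ext (Subtype.ext (by dsimp only; ring)) (Subtype.ext (by dsimp only; ring))
  right_inv := by
    rintro ⟨⟨q, hq0, hq1⟩, ⟨p, hp0, hp1⟩⟩
    by_cases h : p < 1 / 2
    · have h2 : q / 2 < 1 / 2 := by linarith
      simp only [bakerFun, h, dif_pos, bakerInv, h2]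
      exact Prod.ext (Subtype.ext (by dsimp only; ring)) (Subtype.ext (by dsimp only; ring))
    · have h2 : ¬ (q + 1) / 2 < 1 / 2 := by linarith
      simp only [bakerFun, h, dif_neg, not_false_eq_true, bakerInv, h2]
      exact Prod.ext (Subtype.ext (by dsimp only; ring)) (Subtype.ext (by dsimp only; ring))

/-- The representative in `[0,1) × [0,1)` of the class of `x ∈ ℝ²` modulo `ℤ²`. -/
def toSquare (x : ℝ × ℝ) : Square :=
  (⟨Int.fract x.1, Int.fract_nonneg _, Int.fract_lt_one _⟩,
   ⟨Int.fract x.2, Int.fract_nonneg _, Int.fract_lt_one _⟩)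

/-- The function `f ∘ B^m` on the torus, as a `ℤ²`-periodic function on `ℝ²`. -/
def compBaker (f : ℝ × ℝ → ℂ) (m : ℤ) (x : ℝ × ℝ) : ℂ :=
  let y : Square := (baker ^ m) (toSquare x)
  f ((y.1 : ℝ), (y.2 : ℝ))

/-! ### Observables -/

/-- `f ∈ C^∞(𝕋²)`: smooth functions on the torus are smooth `ℤ²`-periodic functions on `ℝ²`. -/
structure IsObservable (f : ℝ × ℝ → ℂ) : Prop where
  smooth : ContDiff ℝ ∞ f
  periodic_q : ∀ q p : ℝ, f (q + 1, p) = f (q, p)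
  periodic_p : ∀ q p : ℝ, f (q, p + 1) = f (q, p)

/-- `∂f/∂q`. -/
def dq (f : ℝ × ℝ → ℂ) (x : ℝ × ℝ) : ℂ := deriv (fun t : ℝ => f (t, x.2)) x.1

/-- `∂f/∂p`. -/
def dp (f : ℝ × ℝ → ℂ) (x : ℝ × ℝ) : ℂ := deriv (fun t : ℝ => f (x.1, t)) x.2

/-- The sup-norm `‖f‖_{C^0}`. -/
def supNorm (f : ℝ × ℝ → ℂ) : ℝ := ⨆ x : ℝ × ℝ, ‖f x‖

/-- `‖f‖_{C^j} = ∑_{γ₁ + γ₂ ≤ j} ‖∂_q^{γ₁} ∂_p^{γ₂} f‖_{C^0}`. -/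
def cNorm (j : ℕ) (f : ℝ × ℝ → ℂ) : ℝ :=
  ∑ m ∈ Finset.range (j + 1), ∑ γ ∈ Finset.HasAntidiagonal.antidiagonal m, supNorm (dq^[γ.1] (dp^[γ.2] f))

/-! ### Cutoffs and the good part of an observable -/

/-- `χ` is a cutoff of width `δ`: smooth, `ℤ`-periodic, equal to `0` on `[-δ, δ]` and to `1` on
`[2δ, 1 - 2δ]` (modulo `ℤ`), varying on the scale `δ`: `|χ^{(j)}| ≤ K δ^{-j}` for `j ≤ 4`. -/
structure IsCutoff (K δ : ℝ) (χ : ℝ → ℝ) : Prop where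
  smooth : ContDiff ℝ ∞ χ
  periodic : Function.Periodic χ 1
  eq_zero : ∀ x ∈ Set.Icc (-δ) δ, χ x = 0
  eq_one : ∀ x ∈ Set.Icc (2 * δ) (1 - 2 * δ), χ x = 1
  deriv_le : ∀ j ≤ 4, ∀ x, |iteratedDeriv j χ x| ≤ K / δ ^ j

/-- `χ_{δ,n}(q,p) = χ(2^n q) χ(p)` and `χ_{δ,-n}(q,p) = χ(2^n p) χ(q)` for `n ≥ 0`. -/
def torusCutoff (χ : ℝ → ℝ) (n : ℤ) (x : ℝ × ℝ) : ℝ :=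
  if 0 ≤ n then χ (2 ^ n.natAbs * x.1) * χ x.2 else χ (2 ^ n.natAbs * x.2) * χ x.1

/-- The good part `a_n = a χ_{δ,n}`. -/
def goodPart (χ : ℝ → ℝ) (a : ℝ × ℝ → ℂ) (n : ℤ) (x : ℝ × ℝ) : ℂ := a x * (torusCutoff χ n x : ℂ)

/-! ### Quantum mechanics on the torus

The Hilbert space is `ℂ^N` with its orthonormal position basis `q_0, …, q_{N-1}`; operators are
given by their matrices in that basis. -/

/-- The Fourier coefficient `f̃(k) = ∫_{[0,1)²} f(q,p) e^{-2πi(q k₂ - p k₁)} dq dp`. -/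
def fourierCoeff₂ (f : ℝ × ℝ → ℂ) (k : ℤ × ℤ) : ℂ :=
  ∫ x in Set.Ico (0 : ℝ) 1 ×ˢ Set.Ico (0 : ℝ) 1,
    f x * Complex.exp (-(2 * Real.pi * Complex.I * (x.1 * k.2 - x.2 * k.1)))

/-- The translation `T(k) = exp(2πi(k₂ q̂ - k₁ p̂))`, i.e. the phase-space translation by `k / N`
(with `2πħ = 1 / N`). It acts on functions or distributions of `q` by
`(T(k)ψ)(q) = e^{-iπ k₁k₂/N} e^{2πi k₂ q} ψ(q - k₁/N)`, hence, on the position basis (periodised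
delta functions at `j / N`), by `T(k) q_j = e^{iπ k₁k₂/N} e^{2πi k₂ j/N} q_{j + k₁ mod N}`. -/
def translation (N : ℕ) (k : ℤ × ℤ) : Matrix (Fin N) (Fin N) ℂ :=
  Matrix.of fun m j =>
    if (m : ℤ) ≡ (j : ℤ) + k.1 [ZMOD N] then
      Complex.exp (Real.pi * Complex.I * (k.1 * k.2) / N)
        * Complex.exp (2 * Real.pi * Complex.I * (k.2 * (j : ℕ)) / N)
    else 0

/-- The Weyl quantisation `Op^W_N(f) = ∑_{k ∈ ℤ²} f̃(k) T(k)`. -/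
def weyl (N : ℕ) (f : ℝ × ℝ → ℂ) : Matrix (Fin N) (Fin N) ℂ :=
  ∑' k : ℤ × ℤ, fourierCoeff₂ f k • translation N k

/-- `N^{-1/2} e^{-2πi kj/N}`. -/
def dftEntry (N k j : ℕ) : ℂ :=
  ((1 / Real.sqrt N : ℝ) : ℂ) * Complex.exp (-(2 * Real.pi * Complex.I * (k * j) / N))

/-- The discrete Fourier transform `F_N`. -/
def dft (N : ℕ) : Matrix (Fin N) (Fin N) ℂ := Matrix.of fun k j => dftEntry N k j

/-- The block-diagonal matrix `diag(F_{N/2}, F_{N/2})` (for even `N`). -/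
def bakerMix (N : ℕ) : Matrix (Fin N) (Fin N) ℂ :=
  Matrix.of fun k j =>
    if (k : ℕ) < N / 2 ∧ (j : ℕ) < N / 2 then dftEntry (N / 2) k j
    else if N / 2 ≤ (k : ℕ) ∧ N / 2 ≤ (j : ℕ) then dftEntry (N / 2) (k - N / 2) (j - N / 2)
    else 0

/-- The Balazs–Voros quantised baker's map `B_N = F_N⁻¹ diag(F_{N/2}, F_{N/2})` (for even `N`). -/
def quantumBaker (N : ℕ) : Matrix (Fin N) (Fin N) ℂ := (dft N)⁻¹ * bakerMix N

/-- The operator norm on `ℂ^N` with its Hermitian norm. -/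
def opNorm {N : ℕ} (A : Matrix (Fin N) (Fin N) ℂ) : ℝ :=
  ‖Matrix.toEuclideanCLM (n := Fin N) (𝕜 := ℂ) A‖

/-- The Ehrenfest time `T_E(N) = log N / log 2`. -/
def ehrenfestTime (N : ℕ) : ℝ := Real.log N / Real.log 2

end QBaker

end

noncomputable section

namespace QBaker


/-- The character `e^{2πix}` of the real line. -/
def expi (x : ℝ) : ℂ := Complex.exp (2 * Real.pi * Complex.I * x)

theorem expi_add (x y : ℝ) : expi (x + y) = expi x * expi y := by
  rw [expi, expi, expi, ← Complex.exp_add]; push_cast; ring_nf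

theorem norm_expi (x : ℝ) : ‖expi x‖ = 1 := by
  rw [expi, show 2 * (Real.pi : ℂ) * Complex.I * x = ((2 * Real.pi * x : ℝ) : ℂ) * Complex.I by
    push_cast; ring, Complex.norm_exp_ofReal_mul_I]

theorem expi_int (n : ℤ) : expi n = 1 := by
  rw [expi, Complex.exp_eq_one_iff]; exact ⟨n, by push_cast; ring⟩

theorem expi_zero : expi 0 = 1 := by simp [expi]

theorem expi_add_int (x : ℝ) (n : ℤ) : expi (x + n) = expi x := by
  rw [expi_add, expi_int, mul_one]

theorem conj_expi (x : ℝ) : (starRingEnd ℂ) (expi x) = expi (-x) := by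
  rw [expi, expi, ← Complex.exp_conj]; simp [Complex.conj_ofNat]

theorem expi_eq_of_sub_int {x y : ℝ} (n : ℤ) (h : x = y + n) : expi x = expi y := by
  rw [h, expi_add_int]

theorem continuous_expi : Continuous expi := by unfold expi; fun_prop

section L2
open scoped Matrix.Norms.L2Operator

theorem opNorm_eq {N : ℕ} (A : Matrix (Fin N) (Fin N) ℂ) : opNorm A = ‖A‖ := rfl

theorem exists_fin_modEq {N : ℕ} (hN : 0 < N) (x : ℤ) : ∃ m : Fin N, (m : ℤ) ≡ x [ZMOD N] := by
  have hN' : (0 : ℤ) < N := by exact_mod_cast hN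
  refine ⟨⟨(x % N).toNat, ?_⟩, ?_⟩
  · have := Int.emod_lt_of_pos x hN'
    have := Int.emod_nonneg x hN'.ne'
    omega
  · have := Int.emod_nonneg x hN'.ne'
    simp only [Int.toNat_of_nonneg this]
    exact Int.mod_modEq x N

theorem fin_eq_of_modEq {N : ℕ} {i j : Fin N} (h : (i : ℤ) ≡ j [ZMOD N]) : i = j := by
  have h1 : ((i : ℕ) : ℤ) % N = (j : ℕ) % N := h
  rw [Int.emod_eq_of_lt (by omega) (by exact_mod_cast i.2),
    Int.emod_eq_of_lt (by omega) (by exact_mod_cast j.2)] at h1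
  exact Fin.ext (by exact_mod_cast h1)

theorem norm_shift_le {N : ℕ} (k : ℤ) (d : Fin N → ℂ) {b : ℝ} (hb : 0 ≤ b)
    (hd : ∀ j, ‖d j‖ ≤ b) :
    ‖(Matrix.of fun m j => if (m : ℤ) ≡ (j : ℤ) + k [ZMOD N] then d j else 0 :
      Matrix (Fin N) (Fin N) ℂ)‖ ≤ b := by
  set M : Matrix (Fin N) (Fin N) ℂ :=
    Matrix.of fun m j => if (m : ℤ) ≡ (j : ℤ) + k [ZMOD N] then d j else 0 with hM
  have key : M.conjTranspose * M = Matrix.diagonal fun j => ((‖d j‖ ^ 2 : ℝ) : ℂ) := by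
    ext i j
    rw [Matrix.mul_apply, Matrix.diagonal_apply]
    obtain ⟨m, hm⟩ := exists_fin_modEq (i.pos) ((j : ℤ) + k)
    rw [Finset.sum_eq_single m]
    · simp only [hM, Matrix.conjTranspose_apply, Matrix.of_apply, if_pos hm]
      by_cases hij : i = j
      · subst hij
        rw [if_pos hm, if_pos rfl]
        have := Complex.conj_mul' (d i)
        simpa using this
      · rw [if_neg hij, if_neg]
        · simp
        · intro h
          exact hij (fin_eq_of_modEq (Int.ModEq.add_right_cancel' k (h.symm.trans hm)))
    · intro l _ hl
      simp only [hM, Matrix.conjTranspose_apply, Matrix.of_apply]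
      rw [if_neg (c := (l : ℤ) ≡ (j : ℤ) + k [ZMOD N]), mul_zero]
      intro h
      exact hl (fin_eq_of_modEq (h.trans hm.symm))
    · simp
  have h2 : ‖M‖ * ‖M‖ ≤ b * b := by
    rw [← Matrix.l2_opNorm_conjTranspose_mul_self, key, Matrix.l2_opNorm_diagonal,
      pi_norm_le_iff_of_nonneg (by positivity)]
    intro j
    rw [Complex.norm_real, Real.norm_eq_abs, abs_of_nonneg (by positivity), sq]
    exact mul_self_le_mul_self (norm_nonneg _) (hd j)
  nlinarith [norm_nonneg M]

theorem translation_apply (N : ℕ) (k : ℤ × ℤ) (m j : Fin N) :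
    translation N k m j = if (m : ℤ) ≡ (j : ℤ) + k.1 [ZMOD N] then
      expi (k.2 * (((j : ℕ) + k.1 / 2) / N)) else 0 := by
  simp only [translation, Matrix.of_apply]
  split_ifs
  · rw [expi, ← Complex.exp_add]; push_cast; ring_nf
  · rfl

theorem translation_eq (N : ℕ) (k : ℤ × ℤ) :
    translation N k = Matrix.of fun m j : Fin N => if (m : ℤ) ≡ (j : ℤ) + k.1 [ZMOD N] then
      expi (k.2 * (((j : ℕ) + k.1 / 2) / N)) else 0 := by
  ext m j; rw [translation_apply]; rfl

theorem norm_translation_le (N : ℕ) (k : ℤ × ℤ) : ‖translation N k‖ ≤ 1 := by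
  rw [translation_eq]
  exact norm_shift_le _ _ zero_le_one fun j => (norm_expi _).le

/-- The operator `∑ c(k) T(k)`. -/
def transSum (N : ℕ) (c : ℤ × ℤ → ℂ) : Matrix (Fin N) (Fin N) ℂ := ∑' k, c k • translation N k

theorem weyl_eq_transSum (N : ℕ) (f : ℝ × ℝ → ℂ) : weyl N f = transSum N (fourierCoeff₂ f) := rfl

theorem summable_trans (N : ℕ) {c : ℤ × ℤ → ℂ} (hc : Summable fun k => ‖c k‖) :
    Summable fun k => c k • translation N k := by
  refine Summable.of_norm_bounded hc fun k => ?_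
  rw [norm_smul]
  exact mul_le_of_le_one_right (norm_nonneg _) (norm_translation_le N k)

theorem transRow_apply (N : ℕ) {c : ℤ × ℤ → ℂ} (hc : Summable fun k => ‖c k‖) (k₁ : ℤ) :
    (∑' k₂ : ℤ, c (k₁, k₂) • translation N (k₁, k₂)) = Matrix.of fun m j : Fin N =>
      if (m : ℤ) ≡ (j : ℤ) + k₁ [ZMOD N] then
        ∑' k₂ : ℤ, c (k₁, k₂) * expi (k₂ * (((j : ℕ) + k₁ / 2) / N)) else 0 := by
  have hsk : Summable fun k₂ : ℤ => c (k₁, k₂) • translation N (k₁, k₂) :=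
    (summable_trans N hc).prod_factor k₁
  ext m j
  have h1 : (∑' k₂ : ℤ, c (k₁, k₂) • translation N (k₁, k₂)) m j
      = ∑' k₂ : ℤ, (c (k₁, k₂) • translation N (k₁, k₂)) m j :=
    (Pi.hasSum.mp (Pi.hasSum.mp hsk.hasSum m) j).tsum_eq.symm
  rw [h1]
  simp only [Matrix.smul_apply, translation_apply, Matrix.of_apply, smul_eq_mul]
  split_ifs <;> simp

theorem transSum_apply (N : ℕ) {c : ℤ × ℤ → ℂ} (hc : Summable fun k => ‖c k‖) (m j : Fin N) :
    transSum N c m j = ∑' k₁ : ℤ, if (m : ℤ) ≡ (j : ℤ) + k₁ [ZMOD N] then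
      ∑' k₂ : ℤ, c (k₁, k₂) * expi (k₂ * (((j : ℕ) + k₁ / 2) / N)) else 0 := by
  have hs := summable_trans N hc
  rw [transSum, hs.tsum_prod]
  have h1 := Pi.hasSum.mp (Pi.hasSum.mp hs.prod.hasSum m) j
  rw [← h1.tsum_eq]
  simp only [transRow_apply N hc, Matrix.of_apply]

theorem norm_transSum_le (N : ℕ) {c : ℤ × ℤ → ℂ} (hc : Summable fun k => ‖c k‖) {b : ℤ → ℝ}
    (hb : Summable b) (hcb : ∀ k₁ : ℤ, ∀ q : ℝ, ‖∑' k₂ : ℤ, c (k₁, k₂) * expi (k₂ * q)‖ ≤ b k₁) :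
    ‖transSum N c‖ ≤ ∑' k, b k := by
  rw [transSum, (summable_trans N hc).tsum_prod]
  refine tsum_of_norm_bounded hb.hasSum fun k₁ => ?_
  rw [transRow_apply N hc]
  exact norm_shift_le _ _ ((norm_nonneg _).trans (hcb k₁ 0)) fun j => hcb _ _

end L2


/-! ### Calculus of observables -/

theorem IsObservable.hasDerivAt_dq {f : ℝ × ℝ → ℂ} (hf : IsObservable f) (q p : ℝ) :
    HasDerivAt (fun t => f (t, p)) (dq f (q, p)) q := by
  have : Differentiable ℝ fun t : ℝ => f (t, p) :=
    (hf.smooth.differentiable (by simp)).comp (by fun_prop)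
  exact (this q).hasDerivAt

theorem IsObservable.hasDerivAt_dp {f : ℝ × ℝ → ℂ} (hf : IsObservable f) (q p : ℝ) :
    HasDerivAt (fun t => f (q, t)) (dp f (q, p)) p := by
  have : Differentiable ℝ fun t : ℝ => f (q, t) :=
    (hf.smooth.differentiable (by simp)).comp (by fun_prop)
  exact (this p).hasDerivAt

theorem dq_eq_fderiv {f : ℝ × ℝ → ℂ} (hf : ContDiff ℝ ∞ f) :
    dq f = fun x => fderiv ℝ f x (1, 0) := by
  ext ⟨q, p⟩
  have h1 : HasDerivAt (fun t : ℝ => (t, p)) ((1 : ℝ), (0 : ℝ)) q :=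
    (hasDerivAt_id q).prodMk (hasDerivAt_const q p)
  have h2 : HasFDerivAt f (fderiv ℝ f (q, p)) (q, p) :=
    (hf.differentiable (by simp) (q, p)).hasFDerivAt
  exact (h2.comp_hasDerivAt q h1).deriv

theorem dp_eq_fderiv {f : ℝ × ℝ → ℂ} (hf : ContDiff ℝ ∞ f) :
    dp f = fun x => fderiv ℝ f x (0, 1) := by
  ext ⟨q, p⟩
  have h1 : HasDerivAt (fun t : ℝ => (q, t)) ((0 : ℝ), (1 : ℝ)) p :=
    (hasDerivAt_const p q).prodMk (hasDerivAt_id p)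
  have h2 : HasFDerivAt f (fderiv ℝ f (q, p)) (q, p) :=
    (hf.differentiable (by simp) (q, p)).hasFDerivAt
  exact (h2.comp_hasDerivAt p h1).deriv

theorem contDiff_fderiv_apply {f : ℝ × ℝ → ℂ} (hf : ContDiff ℝ ∞ f) (v : ℝ × ℝ) :
    ContDiff ℝ ∞ fun x => fderiv ℝ f x v :=
  (hf.fderiv_right (m := ∞) (by simp)).clm_apply contDiff_const

theorem IsObservable.dq {f : ℝ × ℝ → ℂ} (hf : IsObservable f) : IsObservable (dq f) where
  smooth := by rw [dq_eq_fderiv hf.smooth]; exact contDiff_fderiv_apply hf.smooth _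
  periodic_q q p := by
    have : (fun t => f (t, p)) = fun t => f (t + 1, p) := by ext t; rw [hf.periodic_q]
    simp only [QBaker.dq]
    conv_rhs => rw [this]
    rw [deriv_comp_add_const (f := fun t => f (t, p))]
  periodic_p q p := by simp only [QBaker.dq, hf.periodic_p]

theorem IsObservable.dp {f : ℝ × ℝ → ℂ} (hf : IsObservable f) : IsObservable (dp f) where
  smooth := by rw [dp_eq_fderiv hf.smooth]; exact contDiff_fderiv_apply hf.smooth _
  periodic_q q p := by simp only [QBaker.dp, hf.periodic_q]
  periodic_p q p := by
    have : (fun t => f (q, t)) = fun t => f (q, t + 1) := by ext t; rw [hf.periodic_p]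
    simp only [QBaker.dp]
    conv_rhs => rw [this]
    rw [deriv_comp_add_const (f := fun t => f (q, t))]

theorem IsObservable.iterate_dq {f : ℝ × ℝ → ℂ} (hf : IsObservable f) (i : ℕ) :
    IsObservable (QBaker.dq^[i] f) := by
  induction i with
  | zero => exact hf
  | succ i ih => rw [Function.iterate_succ_apply']; exact ih.dq

theorem IsObservable.iterate_dp {f : ℝ × ℝ → ℂ} (hf : IsObservable f) (i : ℕ) :
    IsObservable (QBaker.dp^[i] f) := by
  induction i with
  | zero => exact hf
  | succ i ih => rw [Function.iterate_succ_apply']; exact ih.dp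

theorem dq_dp_comm {f : ℝ × ℝ → ℂ} (hf : IsObservable f) : dq (dp f) = dp (dq f) := by
  rw [dq_eq_fderiv hf.dp.smooth, dp_eq_fderiv hf.dq.smooth, dp_eq_fderiv hf.smooth,
    dq_eq_fderiv hf.smooth]
  ext x
  have hd : DifferentiableAt ℝ (fderiv ℝ f) x :=
    (hf.smooth.fderiv_right (m := ∞) (by simp)).differentiable (by simp) x
  have hsymm := (hf.smooth.contDiffAt (x := x)).isSymmSndFDerivAt (by
    simp only [minSmoothness_of_isRCLikeNormedField]
    exact WithTop.coe_le_coe.mpr le_top)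
  have h (v w : ℝ × ℝ) : fderiv ℝ (fun y => fderiv ℝ f y v) x w = fderiv ℝ (fderiv ℝ f) x w v := by
    rw [fderiv_clm_apply hd (by fun_prop)]; simp
  rw [h, h]
  exact hsymm _ _

theorem dq_iterate_dp {f : ℝ × ℝ → ℂ} (hf : IsObservable f) (j : ℕ) :
    dq (dp^[j] f) = dp^[j] (dq f) := by
  induction j with
  | zero => rfl
  | succ j ih =>
    rw [Function.iterate_succ_apply', Function.iterate_succ_apply', dq_dp_comm (hf.iterate_dp j), ih]

theorem iterate_dq_iterate_dp {f : ℝ × ℝ → ℂ} (hf : IsObservable f) (i j : ℕ) :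
    dq^[i] (dp^[j] f) = dp^[j] (dq^[i] f) := by
  induction i with
  | zero => rfl
  | succ i ih =>
    rw [Function.iterate_succ_apply', Function.iterate_succ_apply', ih,
      dq_iterate_dp (hf.iterate_dq i)]

theorem IsObservable.periodic_fract {f : ℝ × ℝ → ℂ} (hf : IsObservable f) (q p : ℝ) :
    f (Int.fract q, Int.fract p) = f (q, p) := by
  have h1 : Function.Periodic (fun t => f (t, Int.fract p)) 1 := fun t => hf.periodic_q _ _
  have h2 : Function.Periodic (fun t => f (q, t)) 1 := fun t => hf.periodic_p _ _
  have e1 : f (Int.fract q, Int.fract p) = f (q, Int.fract p) := by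
    have h3 := h1.sub_int_mul_eq (x := q) ⌊q⌋
    rwa [mul_one] at h3
  have e2 : f (q, Int.fract p) = f (q, p) := by
    have h3 := h2.sub_int_mul_eq (x := p) ⌊p⌋
    rwa [mul_one] at h3
  rw [e1, e2]

theorem IsObservable.exists_bound {f : ℝ × ℝ → ℂ} (hf : IsObservable f) :
    ∃ M, 0 ≤ M ∧ ∀ x, ‖f x‖ ≤ M := by
  have hK : IsCompact (Set.Icc (0 : ℝ) 1 ×ˢ Set.Icc (0 : ℝ) 1) := isCompact_Icc.prod isCompact_Icc
  obtain ⟨M, hM⟩ := hK.exists_bound_of_continuousOn hf.smooth.continuous.continuousOn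
  have key (x : ℝ × ℝ) : ‖f x‖ ≤ M := by
    rw [← hf.periodic_fract x.1 x.2]
    exact hM _ ⟨⟨Int.fract_nonneg _, (Int.fract_lt_one _).le⟩,
      ⟨Int.fract_nonneg _, (Int.fract_lt_one _).le⟩⟩
  exact ⟨M, (norm_nonneg _).trans (key 0), key⟩

theorem IsObservable.norm_le_supNorm {f : ℝ × ℝ → ℂ} (hf : IsObservable f) (x : ℝ × ℝ) :
    ‖f x‖ ≤ supNorm f := by
  obtain ⟨M, -, hM⟩ := hf.exists_bound
  exact le_ciSup (f := fun x => ‖f x‖) ⟨M, by rintro _ ⟨y, rfl⟩; exact hM y⟩ x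

theorem supNorm_nonneg (f : ℝ × ℝ → ℂ) : 0 ≤ supNorm f := Real.iSup_nonneg fun _ => norm_nonneg _

theorem IsObservable.norm_deriv_le_cNorm {f : ℝ × ℝ → ℂ} (hf : IsObservable f) {n i j : ℕ}
    (hij : i + j ≤ n) (x : ℝ × ℝ) : ‖QBaker.dq^[i] (QBaker.dp^[j] f) x‖ ≤ cNorm n f := by
  refine (((hf.iterate_dp j).iterate_dq i).norm_le_supNorm x).trans ?_
  have h0 (m : ℕ) : 0 ≤ ∑ γ ∈ Finset.HasAntidiagonal.antidiagonal m,
      supNorm (QBaker.dq^[γ.1] (QBaker.dp^[γ.2] f)) :=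
    Finset.sum_nonneg fun _ _ => supNorm_nonneg _
  refine le_trans ?_ (Finset.single_le_sum (fun m _ => h0 m)
    (Finset.mem_range.mpr (Nat.lt_succ_of_le hij)))
  exact Finset.single_le_sum (f := fun γ : ℕ × ℕ => supNorm (QBaker.dq^[γ.1] (QBaker.dp^[γ.2] f)))
    (fun _ _ => supNorm_nonneg _) (a := (i, j)) (Finset.HasAntidiagonal.mem_antidiagonal.mpr rfl)

theorem cNorm_nonneg (n : ℕ) (f : ℝ × ℝ → ℂ) : 0 ≤ cNorm n f :=
  Finset.sum_nonneg fun _ _ => Finset.sum_nonneg fun _ _ => supNorm_nonneg _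

/-! ### Fourier coefficients -/

theorem integral_swap_of_continuous {g : ℝ → ℝ → ℂ} (hg : Continuous (Function.uncurry g)) :
    ∫ x in (0 : ℝ)..1, ∫ y in (0 : ℝ)..1, g x y = ∫ y in (0 : ℝ)..1, ∫ x in (0 : ℝ)..1, g x y := by
  simp_rw [intervalIntegral.integral_of_le (zero_le_one (α := ℝ))]
  refine MeasureTheory.integral_integral_swap ?_
  rw [MeasureTheory.Measure.prod_restrict, ← MeasureTheory.IntegrableOn]
  exact (hg.continuousOn.integrableOn_compact (isCompact_Icc.prod isCompact_Icc)).mono_set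
    (Set.prod_mono Set.Ioc_subset_Icc_self Set.Ioc_subset_Icc_self)

/-- The partial Fourier coefficient `∫ f(q,p) e^{2πikp} dp`. -/
def rowCoeff (f : ℝ × ℝ → ℂ) (k : ℤ) (q : ℝ) : ℂ := ∫ p in (0 : ℝ)..1, f (q, p) * expi (k * p)

theorem integral_square {E : Type*} [NormedAddCommGroup E] [NormedSpace ℝ E] {g : ℝ × ℝ → E}
    (hg : Continuous g) :
    ∫ x in Set.Ico (0 : ℝ) 1 ×ˢ Set.Ico (0 : ℝ) 1, g x
      = ∫ q in (0 : ℝ)..1, ∫ p in (0 : ℝ)..1, g (q, p) := by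
  rw [MeasureTheory.Measure.volume_eq_prod, MeasureTheory.setIntegral_prod]
  · rw [intervalIntegral.integral_of_le zero_le_one, ← MeasureTheory.integral_Ico_eq_integral_Ioc]
    simp_rw [intervalIntegral.integral_of_le (zero_le_one (α := ℝ)),
      ← MeasureTheory.integral_Ico_eq_integral_Ioc]
  · have hK : IsCompact (Set.Icc (0 : ℝ) 1 ×ˢ Set.Icc (0 : ℝ) 1) := isCompact_Icc.prod isCompact_Icc
    have := hg.continuousOn.integrableOn_compact (μ := MeasureTheory.volume) hK
    exact this.mono_set (Set.prod_mono Set.Ico_subset_Icc_self Set.Ico_subset_Icc_self)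

theorem fourierCoeff₂_eq {f : ℝ × ℝ → ℂ} (hf : Continuous f) (k : ℤ × ℤ) :
    fourierCoeff₂ f k = ∫ q in (0 : ℝ)..1, rowCoeff f k.1 q * expi (-(k.2 * q)) := by
  have h (x : ℝ × ℝ) : f x * Complex.exp (-(2 * Real.pi * Complex.I * (x.1 * k.2 - x.2 * k.1)))
      = f x * expi (k.1 * x.2) * expi (-(k.2 * x.1)) := by
    rw [mul_assoc (f x), ← expi_add, expi]; push_cast; ring_nf
  rw [fourierCoeff₂]
  simp_rw [h]
  have hc := continuous_expi
  rw [integral_square (by fun_prop)]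
  simp only [rowCoeff, intervalIntegral.integral_mul_const]

theorem continuous_rowCoeff {f : ℝ × ℝ → ℂ} (hf : Continuous f) (k : ℤ) :
    Continuous (rowCoeff f k) := by
  have hc := continuous_expi
  exact intervalIntegral.continuous_parametric_intervalIntegral_of_continuous' (by fun_prop) 0 1

theorem norm_rowCoeff_le {f : ℝ × ℝ → ℂ} {M : ℝ} (hM : ∀ x, ‖f x‖ ≤ M) (k : ℤ) (q : ℝ) :
    ‖rowCoeff f k q‖ ≤ M := by
  have := intervalIntegral.norm_integral_le_of_norm_le_const (a := 0) (b := 1) (C := M)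
    (f := fun p => f (q, p) * expi (k * p)) fun p _ => by rw [norm_mul, norm_expi, mul_one]; exact hM _
  simpa [rowCoeff] using this

theorem norm_fourierCoeff₂_le {f : ℝ × ℝ → ℂ} (hf : Continuous f) {M : ℝ} (hM : ∀ x, ‖f x‖ ≤ M)
    (k : ℤ × ℤ) : ‖fourierCoeff₂ f k‖ ≤ M := by
  rw [fourierCoeff₂_eq hf]
  have := intervalIntegral.norm_integral_le_of_norm_le_const (a := 0) (b := 1) (C := M)
    (f := fun q => rowCoeff f k.1 q * expi (-(k.2 * q))) fun p _ => by
      rw [norm_mul, norm_expi, mul_one]; exact norm_rowCoeff_le hM _ _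
  simpa using this

theorem hasDerivAt_expi (c x : ℝ) : HasDerivAt (fun t : ℝ => expi (c * t))
    (2 * Real.pi * Complex.I * c * expi (c * x)) x := by
  have h : HasDerivAt (fun t : ℝ => 2 * (Real.pi : ℂ) * Complex.I * ((c * t : ℝ) : ℂ))
      (2 * Real.pi * Complex.I * c) x := by
    have h0 := ((hasDerivAt_id x).const_mul c).ofReal_comp.const_mul (2 * (Real.pi : ℂ) * Complex.I)
    simpa using h0
  have := h.cexp
  simp only [expi]
  convert this using 1
  ring

theorem integral_deriv_mul_expi {h h' : ℝ → ℂ} (hh : ∀ x, HasDerivAt h (h' x) x)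
    (hc : Continuous h') (hper : h 1 = h 0) (k : ℤ) :
    ∫ t in (0 : ℝ)..1, h' t * expi (k * t)
      = -(2 * Real.pi * Complex.I * k) * ∫ t in (0 : ℝ)..1, h t * expi (k * t) := by
  have he := continuous_expi
  have := intervalIntegral.integral_mul_deriv_eq_deriv_mul (a := 0) (b := 1)
    (u := fun t : ℝ => expi (k * t)) (v := h)
    (u' := fun t : ℝ => 2 * Real.pi * Complex.I * (k : ℝ) * expi (k * t)) (v' := h')
    (fun x _ => hasDerivAt_expi k x) (fun x _ => hh x)
    (Continuous.intervalIntegrable (by fun_prop) _ _) (hc.intervalIntegrable _ _)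
  have e1 : expi ((k : ℝ) * 1) = 1 := by rw [mul_one, expi_int]
  have e0 : expi ((k : ℝ) * 0) = 1 := by rw [mul_zero, expi_zero]
  rw [e1, e0, hper, sub_self, zero_sub, ← intervalIntegral.integral_neg] at this
  rw [← intervalIntegral.integral_const_mul]
  calc _ = ∫ t in (0 : ℝ)..1, expi (k * t) * h' t := by simp_rw [mul_comm]
    _ = _ := by
      rw [this]; congr 1; ext t; push_cast; ring

theorem rowCoeff_dp {f : ℝ × ℝ → ℂ} (hf : IsObservable f) (k : ℤ) (q : ℝ) :
    rowCoeff (dp f) k q = -(2 * Real.pi * Complex.I * k) * rowCoeff f k q := by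
  refine integral_deriv_mul_expi (h := fun p => f (q, p)) (fun p => hf.hasDerivAt_dp q p) ?_ ?_ k
  · exact hf.dp.smooth.continuous.comp (by fun_prop)
  · have := hf.periodic_p q 0; simpa using this

theorem fourierCoeff₂_dp {f : ℝ × ℝ → ℂ} (hf : IsObservable f) (k : ℤ × ℤ) :
    fourierCoeff₂ (dp f) k = -(2 * Real.pi * Complex.I * k.1) * fourierCoeff₂ f k := by
  rw [fourierCoeff₂_eq hf.smooth.continuous, fourierCoeff₂_eq hf.dp.smooth.continuous,
    ← intervalIntegral.integral_const_mul]
  simp_rw [rowCoeff_dp hf, mul_assoc]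

theorem fourierCoeff₂_eq' {f : ℝ × ℝ → ℂ} (hf : Continuous f) (k : ℤ × ℤ) :
    fourierCoeff₂ f k
      = ∫ p in (0 : ℝ)..1, (∫ q in (0 : ℝ)..1, f (q, p) * expi ((-k.2 : ℤ) * q)) * expi (k.1 * p) := by
  have hc := continuous_expi
  rw [fourierCoeff₂_eq hf]
  simp only [rowCoeff, ← intervalIntegral.integral_mul_const]
  rw [integral_swap_of_continuous (g := fun q p => f (q, p) * expi (k.1 * p) * expi (-(k.2 * q)))
    (by fun_prop)]
  congr 1; ext p; congr 1; ext q
  push_cast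
  rw [neg_mul]; ring

theorem fourierCoeff₂_dq {f : ℝ × ℝ → ℂ} (hf : IsObservable f) (k : ℤ × ℤ) :
    fourierCoeff₂ (dq f) k = (2 * Real.pi * Complex.I * k.2) * fourierCoeff₂ f k := by
  rw [fourierCoeff₂_eq' hf.smooth.continuous, fourierCoeff₂_eq' hf.dq.smooth.continuous,
    ← intervalIntegral.integral_const_mul]
  congr 1; ext p
  rw [integral_deriv_mul_expi (h := fun q => f (q, p)) (fun q => hf.hasDerivAt_dq q p)
    (hf.dq.smooth.continuous.comp (by fun_prop)) (by simpa using hf.periodic_q 0 p)]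
  push_cast; ring

theorem fourierCoeff₂_iterate {f : ℝ × ℝ → ℂ} (hf : IsObservable f) (i j : ℕ) (k : ℤ × ℤ) :
    fourierCoeff₂ (dq^[i] (dp^[j] f)) k
      = (2 * Real.pi * Complex.I * k.2) ^ i * (-(2 * Real.pi * Complex.I * k.1)) ^ j
        * fourierCoeff₂ f k := by
  have h1 : fourierCoeff₂ (dp^[j] f) k
      = (-(2 * Real.pi * Complex.I * k.1)) ^ j * fourierCoeff₂ f k := by
    induction j with
    | zero => simp
    | succ j ih =>
      rw [Function.iterate_succ_apply', fourierCoeff₂_dp (hf.iterate_dp j), ih]; ring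
  induction i with
  | zero => simp [h1]
  | succ i ih =>
    rw [Function.iterate_succ_apply', fourierCoeff₂_dq ((hf.iterate_dp j).iterate_dq i), ih]; ring

theorem summable_one_div_one_add_sq : Summable fun k : ℤ => 1 / (1 + (k : ℝ) ^ 2) := by
  have h : Summable fun k : ℤ => 1 / (k : ℝ) ^ 2 := Real.summable_one_div_int_pow.mpr one_lt_two
  refine Summable.of_norm_bounded_eventually h ?_
  have : ∀ᶠ k : ℤ in Filter.cofinite, k ≠ 0 := (Set.finite_singleton (0 : ℤ)).eventually_cofinite_notMem
  filter_upwards [this] with k hk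
  have hk' : (0 : ℝ) < (k : ℝ) ^ 2 := by positivity
  rw [Real.norm_of_nonneg (by positivity)]
  exact one_div_le_one_div_of_le hk' (by linarith)

theorem summable_fourierCoeff₂ {f : ℝ × ℝ → ℂ} (hf : IsObservable f) :
    Summable fun k => ‖fourierCoeff₂ f k‖ := by
  have hobs (i j : ℕ) := (hf.iterate_dp j).iterate_dq i
  choose M hM0 hM using fun i j => (hobs i j).exists_bound
  have hb (i j : ℕ) (k : ℤ × ℤ) :
      (k.2 : ℝ) ^ (2 * i) * (k.1 : ℝ) ^ (2 * j) * ‖fourierCoeff₂ f k‖ ≤ M (2 * i) (2 * j) := by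
    have h1 := norm_fourierCoeff₂_le (hobs (2 * i) (2 * j)).smooth.continuous
      (hM (2 * i) (2 * j)) k
    rw [fourierCoeff₂_iterate hf, norm_mul, norm_mul, norm_pow, norm_pow, norm_neg] at h1
    refine le_trans ?_ h1
    have e (x : ℤ) : |(x : ℝ)| ≤ ‖(2 * (Real.pi : ℂ) * Complex.I * x)‖ := by
      simp only [norm_mul, Complex.norm_I, Complex.norm_real, Complex.norm_intCast,
        Real.norm_eq_abs, abs_of_pos Real.pi_pos, Complex.norm_ofNat, mul_one]
      exact le_mul_of_one_le_left (abs_nonneg _) (by nlinarith [Real.pi_gt_three])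
    have e2 (x : ℤ) (m : ℕ) :
        (x : ℝ) ^ (2 * m) ≤ ‖(2 * (Real.pi : ℂ) * Complex.I * x)‖ ^ (2 * m) := by
      rw [← (even_two_mul m).pow_abs (x : ℝ)]
      exact pow_le_pow_left₀ (abs_nonneg _) (e _) _
    exact mul_le_mul_of_nonneg_right (mul_le_mul (e2 _ _) (e2 _ _) ((even_two_mul j).pow_nonneg _)
      (by positivity)) (norm_nonneg _)
  have hs := summable_one_div_one_add_sq
  have hs2 := (hs.mul_of_nonneg hs (fun k => by positivity) (fun k => by positivity)).mul_left
    (M 0 0 + M 2 0 + M 0 2 + M 2 2)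
  refine Summable.of_nonneg_of_le (fun _ => norm_nonneg _) (fun k => ?_) hs2
  have e00 := hb 0 0 k
  have e10 := hb 1 0 k
  have e01 := hb 0 1 k
  have e11 := hb 1 1 k
  simp only [mul_zero, pow_zero, one_mul, mul_one] at e00 e10 e01 e11
  rw [one_div_mul_one_div, mul_one_div, le_div_iff₀ (by positivity)]
  linarith

theorem hasSum_fourier_of_periodic {h : ℝ → ℂ} (hc : Continuous h) (hp : Function.Periodic h 1)
    {c : ℤ → ℂ} (hcoef : ∀ k, c k = ∫ x in (0 : ℝ)..1, h x * expi (-(k * x)))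
    (hs : Summable c) (x : ℝ) : HasSum (fun k => c k * expi (k * x)) (h x) := by
  have hlc : Continuous (hp.lift : UnitAddCircle → ℂ) := by
    rw [continuous_coinduced_dom]; exact hc
  let F : C(UnitAddCircle, ℂ) := ⟨hp.lift, hlc⟩
  have hF : fourierCoeff F = c := by
    ext k
    rw [fourierCoeff_eq_intervalIntegral _ _ 0, hcoef, zero_add]
    simp only [div_one, one_smul]
    congr 1; ext x
    rw [fourier_coe_apply, smul_eq_mul, mul_comm]
    congr 1
    simp only [expi]; push_cast; ring_nf
  have := has_pointwise_sum_fourier_series_of_summable (f := F) (hF ▸ hs) (x : UnitAddCircle)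
  rw [hF] at this
  convert this using 2 with k
  · rw [fourier_coe_apply, smul_eq_mul]
    congr 1
    simp only [expi]; push_cast; ring_nf
  · rfl

theorem hasSum_rowCoeff {f : ℝ × ℝ → ℂ} (hf : IsObservable f) (k : ℤ) (q : ℝ) :
    HasSum (fun l : ℤ => fourierCoeff₂ f (k, l) * expi (l * q)) (rowCoeff f k q) := by
  refine hasSum_fourier_of_periodic (continuous_rowCoeff hf.smooth.continuous k) ?_
    (fun l => fourierCoeff₂_eq hf.smooth.continuous (k, l)) ?_ q
  · intro q; simp only [rowCoeff, hf.periodic_q]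
  · exact (summable_fourierCoeff₂ hf).of_norm.prod_factor k


/-! ### Gaussian multipliers -/

theorem norm_tsum_heat_le {d : ℤ → ℂ} (hd : Summable fun k => ‖d k‖) {S : ℝ}
    (hS : ∀ q : ℝ, ‖∑' k : ℤ, d k * expi (k * q)‖ ≤ S) {α : ℝ} (hα : 0 ≤ α) (q : ℝ) :
    ‖∑' k : ℤ, (Real.exp (-(α * k ^ 2)) : ℂ) * d k * expi (k * q)‖ ≤ S := by
  rcases hα.eq_or_lt with rfl | hα
  · simpa using hS q
  set b : ℝ := Real.pi ^ 2 / α with hb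
  have hbpos : 0 < b := by positivity
  have hbre : 0 < (b : ℂ).re := by simpa
  set G : ℂ := (Real.pi / (b : ℂ)) ^ (1 / 2 : ℂ) with hG
  have hgauss (k : ℤ) : ∫ x : ℝ, expi (k * x) * (Real.exp (-b * x ^ 2) : ℂ)
      = G * (Real.exp (-(α * k ^ 2)) : ℂ) := by
    have := fourierIntegral_gaussian hbre (2 * Real.pi * k)
    rw [← hG] at this
    convert this using 2
    · ext x
      simp only [expi]
      push_cast
      congr 2
      ring
    · push_cast
      congr 1
      have h1 : (Real.pi : ℂ) ≠ 0 := by exact_mod_cast Real.pi_ne_zero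
      have h2 : (α : ℂ) ≠ 0 := by exact_mod_cast hα.ne'
      rw [hb]; push_cast; field_simp; ring
  have hint : MeasureTheory.Integrable fun x : ℝ => Real.exp (-b * x ^ 2) :=
    integrable_exp_neg_mul_sq hbpos
  have hI0 : 0 < ∫ x : ℝ, Real.exp (-b * x ^ 2) := by
    rw [integral_gaussian]; positivity
  have hGI : G = ((∫ x : ℝ, Real.exp (-b * x ^ 2) : ℝ) : ℂ) := by
    have := hgauss 0
    simp only [Int.cast_zero, zero_mul, expi_zero, one_mul, ne_eq, OfNat.ofNat_ne_zero,
      not_false_eq_true, zero_pow, mul_zero, neg_zero, Real.exp_zero, Complex.ofReal_one,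
      mul_one] at this
    rw [← this, integral_complex_ofReal]
  have hce := continuous_expi
  let F : ℤ → ℝ → ℂ := fun k x => d k * expi (k * (q + x)) * (Real.exp (-b * x ^ 2) : ℂ)
  have hFn (k : ℤ) (x : ℝ) : ‖F k x‖ = ‖d k‖ * Real.exp (-b * x ^ 2) := by
    simp only [F, norm_mul, norm_expi, mul_one, Complex.norm_real, Real.norm_eq_abs, Real.abs_exp]
  have hFi (k : ℤ) : MeasureTheory.Integrable (F k) := by
    refine (hint.const_mul ‖d k‖).mono' (Continuous.aestronglyMeasurable (by fun_prop)) ?_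
    exact Filter.Eventually.of_forall fun x => (hFn k x).le
  have hsum := MeasureTheory.hasSum_integral_of_summable_integral_norm hFi (by
    simp_rw [hFn, MeasureTheory.integral_const_mul]
    exact hd.mul_right _)
  have hFint (k : ℤ) : ∫ x, F k x = G * ((Real.exp (-(α * k ^ 2)) : ℂ) * d k * expi (k * q)) := by
    calc ∫ x, F k x = ∫ x : ℝ, (d k * expi (k * q)) * (expi (k * x) * (Real.exp (-b * x ^ 2) : ℂ)) := by
          congr 1; ext x; simp only [F]; rw [mul_add, expi_add]; ring
      _ = _ := by rw [MeasureTheory.integral_const_mul, hgauss]; ring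
  simp_rw [hFint] at hsum
  have h1 : G * ∑' k : ℤ, (Real.exp (-(α * k ^ 2)) : ℂ) * d k * expi (k * q)
      = ∫ x, ∑' k, F k x := by rw [← tsum_mul_left, hsum.tsum_eq]
  have h2 : ‖∫ x, ∑' k, F k x‖ ≤ S * ∫ x : ℝ, Real.exp (-b * x ^ 2) := by
    rw [← MeasureTheory.integral_const_mul]
    refine MeasureTheory.norm_integral_le_of_norm_le (hint.const_mul S)
      (Filter.Eventually.of_forall fun x => ?_)
    simp only [F, tsum_mul_right, norm_mul, Complex.norm_real, Real.norm_eq_abs, Real.abs_exp]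
    exact mul_le_mul_of_nonneg_right (hS _) (Real.exp_pos _).le
  rw [← h1, norm_mul, hGI, Complex.norm_real, Real.norm_of_nonneg hI0.le, mul_comm] at h2
  exact le_of_mul_le_mul_right h2 hI0

theorem integral_mul_sq_mul_exp (x : ℝ) :
    ∫ t in (0 : ℝ)..1, t * x ^ 2 * Real.exp (-(t * x)) = 1 - Real.exp (-x) * (1 + x) := by
  have h (t : ℝ) : HasDerivAt (fun t : ℝ => -(1 + t * x) * Real.exp (-(t * x)))
      (t * x ^ 2 * Real.exp (-(t * x))) t := by
    have h1 : HasDerivAt (fun t : ℝ => t * x) x t := by simpa using (hasDerivAt_id t).mul_const x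
    refine ((h1.const_add 1).neg.mul h1.neg.exp).congr_deriv ?_
    simp only [Pi.neg_apply]
    ring
  rw [intervalIntegral.integral_eq_sub_of_hasDerivAt (fun t _ => h t)
    (Continuous.intervalIntegrable (by fun_prop) _ _)]
  simp; ring

section Row

variable {c : ℤ → ℂ} {A B S : ℝ}

/-- Sums damped by `e^{-tQ}`, where `Q(k) = A + B k²`. -/
theorem norm_tsum_exp_neg_le (hA : 0 ≤ A) (hB : 0 ≤ B) (hc : Summable fun k => ‖c k‖)
    (hS : ∀ q : ℝ, ‖∑' k : ℤ, c k * expi (k * q)‖ ≤ S) {t : ℝ} (ht : 0 ≤ t) (q : ℝ) :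
    ‖∑' k : ℤ, (Real.exp (-(t * (A + B * k ^ 2))) : ℂ) * c k * expi (k * q)‖ ≤ S := by
  have h0 : 0 ≤ S := (norm_nonneg _).trans (hS 0)
  have h := norm_tsum_heat_le hc hS (mul_nonneg ht hB) q
  have e (k : ℤ) : (Real.exp (-(t * (A + B * k ^ 2))) : ℂ) * c k * expi (k * q)
      = (Real.exp (-(t * A)) : ℂ) * ((Real.exp (-(t * B * k ^ 2)) : ℂ) * c k * expi (k * q)) := by
    rw [show -(t * (A + B * (k : ℝ) ^ 2)) = -(t * A) + -(t * B * k ^ 2) by ring, Real.exp_add]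
    push_cast; ring
  simp_rw [e]
  rw [tsum_mul_left, norm_mul, Complex.norm_real, Real.norm_eq_abs, Real.abs_exp]
  refine (mul_le_of_le_one_left (norm_nonneg _) ?_).trans h
  exact Real.exp_le_one_iff.mpr (by nlinarith [mul_nonneg ht hA])

theorem norm_tsum_remainder_le_sq (hA : 0 ≤ A) (hB : 0 ≤ B)
    (hc : Summable fun k : ℤ => ‖((A + B * k ^ 2 : ℝ) : ℂ) ^ 2 * c k‖)
    (hS : ∀ q : ℝ, ‖∑' k : ℤ, ((A + B * k ^ 2 : ℝ) : ℂ) ^ 2 * c k * expi (k * q)‖ ≤ S) (q : ℝ) :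
    ‖∑' k : ℤ, ((1 - Real.exp (-(A + B * k ^ 2)) * (1 + (A + B * k ^ 2)) : ℝ) : ℂ) * c k
      * expi (k * q)‖ ≤ S := by
  have h0 : 0 ≤ S := (norm_nonneg _).trans (hS 0)
  let F : ℤ → ℝ → ℂ := fun k t =>
    (t : ℂ) * ((Real.exp (-(t * (A + B * k ^ 2))) : ℂ) * (((A + B * k ^ 2 : ℝ) : ℂ) ^ 2 * c k)
      * expi (k * q))
  have hQ (k : ℤ) : 0 ≤ A + B * (k : ℝ) ^ 2 := by positivity
  have hFc (k : ℤ) : Continuous (F k) := by fun_prop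
  have hFn (k : ℤ) {t : ℝ} (ht : t ∈ Set.Ioc (0 : ℝ) 1) :
      ‖F k t‖ ≤ ‖((A + B * k ^ 2 : ℝ) : ℂ) ^ 2 * c k‖ := by
    simp only [F]
    rw [norm_mul, norm_mul, norm_expi, mul_one, norm_mul (Complex.ofReal (Real.exp _)),
      Complex.norm_real, Complex.norm_real,
      Real.norm_of_nonneg ht.1.le, Real.norm_of_nonneg (Real.exp_pos _).le, ← mul_assoc]
    refine mul_le_of_le_one_left (norm_nonneg _) (mul_le_one₀ ht.2 (Real.exp_pos _).le ?_)
    exact Real.exp_le_one_iff.mpr (by nlinarith [mul_nonneg ht.1.le (hQ k)])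
  have hFint (k : ℤ) : ∫ t in (0 : ℝ)..1, F k t
      = ((1 - Real.exp (-(A + B * k ^ 2)) * (1 + (A + B * k ^ 2)) : ℝ) : ℂ) * c k * expi (k * q) := by
    rw [← integral_mul_sq_mul_exp, ← intervalIntegral.integral_ofReal, mul_assoc,
      ← intervalIntegral.integral_mul_const]
    congr 1; ext t; simp only [F]; push_cast; ring
  have hmeas (k : ℤ) : MeasureTheory.IntegrableOn (F k) (Set.Ioc 0 1) :=
    ((hFc k).continuousOn.integrableOn_compact isCompact_Icc).mono_set Set.Ioc_subset_Icc_self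
  have hsum := MeasureTheory.hasSum_integral_of_summable_integral_norm hmeas (by
    refine Summable.of_nonneg_of_le (fun k => MeasureTheory.integral_nonneg fun t => norm_nonneg _)
      (fun k => ?_) hc
    have := MeasureTheory.setIntegral_mono_on (hmeas k).norm
      (MeasureTheory.integrableOn_const (s := Set.Ioc (0 : ℝ) 1) (by simp))
      measurableSet_Ioc fun t ht => hFn k ht
    simpa using this)
  simp_rw [← intervalIntegral.integral_of_le (zero_le_one (α := ℝ)), hFint] at hsum
  rw [hsum.tsum_eq]
  have := intervalIntegral.norm_integral_le_of_norm_le_const (a := 0) (b := 1) (C := S)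
    (f := fun t => ∑' k, F k t) fun t ht => by
      rw [Set.uIoc_of_le zero_le_one] at ht
      simp only [F]
      rw [tsum_mul_left, norm_mul, Complex.norm_real, Real.norm_of_nonneg ht.1.le]
      exact (mul_le_of_le_one_left (norm_nonneg _) ht.2).trans
        (norm_tsum_exp_neg_le hA hB hc hS ht.1.le q)
  simpa using this

theorem norm_tsum_remainder_le (hA : 0 ≤ A) (hB : 0 ≤ B) (hc : Summable fun k : ℤ => ‖c k‖)
    (hQc : Summable fun k : ℤ => ‖((A + B * k ^ 2 : ℝ) : ℂ) * c k‖) {S' : ℝ}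
    (hS : ∀ q : ℝ, ‖∑' k : ℤ, c k * expi (k * q)‖ ≤ S)
    (hS' : ∀ q : ℝ, ‖∑' k : ℤ, ((A + B * k ^ 2 : ℝ) : ℂ) * c k * expi (k * q)‖ ≤ S') (q : ℝ) :
    ‖∑' k : ℤ, ((1 - Real.exp (-(A + B * k ^ 2)) * (1 + (A + B * k ^ 2)) : ℝ) : ℂ) * c k
      * expi (k * q)‖ ≤ 2 * S + S' := by
  have hQ (k : ℤ) : 0 ≤ A + B * (k : ℝ) ^ 2 := by positivity
  have hle (k : ℤ) : Real.exp (-(1 * (A + B * (k : ℝ) ^ 2))) ≤ 1 :=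
    Real.exp_le_one_iff.mpr (by nlinarith [hQ k])
  have s1 : Summable fun k : ℤ => c k * expi (k * q) :=
    Summable.of_norm (by simpa [norm_expi] using hc)
  have s2 : Summable fun k : ℤ => (Real.exp (-(1 * (A + B * k ^ 2))) : ℂ) * c k * expi (k * q) := by
    refine Summable.of_norm_bounded hc fun k => ?_
    rw [norm_mul, norm_expi, mul_one, norm_mul, Complex.norm_real, Real.norm_of_nonneg (Real.exp_pos _).le]
    exact mul_le_of_le_one_left (norm_nonneg _) (hle k)
  have s3 : Summable fun k : ℤ => (Real.exp (-(1 * (A + B * k ^ 2))) : ℂ)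
      * (((A + B * k ^ 2 : ℝ) : ℂ) * c k) * expi (k * q) := by
    refine Summable.of_norm_bounded hQc fun k => ?_
    rw [norm_mul, norm_expi, mul_one, norm_mul (Complex.ofReal (Real.exp _)), Complex.norm_real,
      Real.norm_of_nonneg (Real.exp_pos _).le]
    exact mul_le_of_le_one_left (norm_nonneg _) (hle k)
  have e : (∑' k : ℤ, ((1 - Real.exp (-(A + B * k ^ 2)) * (1 + (A + B * k ^ 2)) : ℝ) : ℂ) * c k
      * expi (k * q)) = (∑' k : ℤ, c k * expi (k * q))
        - (∑' k : ℤ, (Real.exp (-(1 * (A + B * k ^ 2))) : ℂ) * c k * expi (k * q))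
        - ∑' k : ℤ, (Real.exp (-(1 * (A + B * k ^ 2))) : ℂ)
          * (((A + B * k ^ 2 : ℝ) : ℂ) * c k) * expi (k * q) := by
    rw [← s1.tsum_sub s2, ← (s1.sub s2).tsum_sub s3]
    congr 1; ext k; push_cast; rw [one_mul]; ring
  rw [e]
  have b1 := hS q
  have b2 := norm_tsum_exp_neg_le hA hB hc hS zero_le_one q
  have b3 := norm_tsum_exp_neg_le hA hB hQc hS' zero_le_one q
  have t1 := norm_sub_le (∑' k : ℤ, c k * expi (k * q))
    (∑' k : ℤ, (Real.exp (-(1 * (A + B * k ^ 2))) : ℂ) * c k * expi (k * q))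
  refine (norm_sub_le _ _).trans ?_
  linarith

end Row

theorem summable_lorentz (h : ℝ) (hh : 0 < h) (h1 : h ≤ 1) :
    (Summable fun k : ℤ => h ^ 2 / (1 + h ^ 2 * k ^ 2)) ∧
      ∑' k : ℤ, h ^ 2 / (1 + h ^ 2 * (k : ℝ) ^ 2) ≤ 5 * h := by
  set f : ℤ → ℝ := fun k => h ^ 2 / (1 + h ^ 2 * (k : ℝ) ^ 2) with hf
  have f0 (k : ℤ) : 0 ≤ f k := by positivity
  have hstep (n : ℕ) : f (n + 1) ≤ 2 * h * (1 / (1 + h * n) - 1 / (1 + h * (n + 1 : ℕ))) := by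
    simp only [hf]
    push_cast
    have hn : (0 : ℝ) ≤ n := n.cast_nonneg
    rw [div_sub_div _ _ (by positivity) (by positivity), mul_div_assoc', div_le_div_iff₀
      (by positivity) (by positivity)]
    have : 0 ≤ h * n := by positivity
    nlinarith [sq_nonneg (1 - h * (n + 1)), sq_nonneg (h * n), mul_pos hh hh,
      mul_nonneg (mul_pos hh hh).le (sq_nonneg (1 - h * (n + 1))),
      mul_nonneg (mul_pos hh hh).le this, mul_nonneg (mul_pos hh hh).le hh.le]
  have htel (n : ℕ) : ∑ i ∈ Finset.range n, f ((i : ℤ) + 1) ≤ 2 * h := by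
    refine (Finset.sum_le_sum fun i _ => hstep i).trans ?_
    rw [← Finset.mul_sum, Finset.sum_range_sub' (fun i : ℕ => 1 / (1 + h * (i : ℝ)))]
    have : 0 ≤ 1 / (1 + h * (n : ℝ)) := by positivity
    simp only [Nat.cast_zero, mul_zero, add_zero, div_one]
    nlinarith
  have hsucc : Summable fun n : ℕ => f ((n : ℤ) + 1) :=
    summable_of_sum_range_le (fun _ => f0 _) htel
  have hsucc_le : ∑' n : ℕ, f ((n : ℤ) + 1) ≤ 2 * h :=
    Real.tsum_le_of_sum_range_le (fun _ => f0 _) htel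
  have hneg (n : ℕ) : f (-((n : ℤ) + 1)) = f ((n : ℤ) + 1) := by simp only [hf]; push_cast; ring_nf
  have hnat : Summable fun n : ℕ => f n :=
    (summable_nat_add_iff 1).mp (by exact_mod_cast hsucc)
  have hneg_s : Summable fun n : ℕ => f (-((n : ℤ) + 1)) := by simpa only [hneg] using hsucc
  refine ⟨Summable.of_nat_of_neg_add_one hnat hneg_s, ?_⟩
  rw [tsum_of_nat_of_neg_add_one hnat hneg_s, hnat.tsum_eq_zero_add]
  simp only [hneg]
  have e0 : f ((0 : ℕ) : ℤ) = h ^ 2 := by simp [hf]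
  push_cast at hsucc_le ⊢
  have e0' : f 0 = h ^ 2 := by simp [hf]
  rw [e0']
  nlinarith

/-! ### The remainder of the corrected Gaussian smoothing -/

/-- The quadratic form `(π/2N)(k₂²/s + s k₁²)` of a coherent state of squeezing `s`. -/
def qform (N : ℕ) (s : ℝ) (k : ℤ × ℤ) : ℝ :=
  Real.pi / (2 * N) * ((k.2 : ℝ) ^ 2 / s + s * (k.1 : ℝ) ^ 2)

theorem qform_nonneg (N : ℕ) {s : ℝ} (hs : 0 < s) (k : ℤ × ℤ) : 0 ≤ qform N s k := by
  have := Real.pi_pos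
  unfold qform; positivity

theorem qform_mk (N : ℕ) (s : ℝ) (k l : ℤ) :
    qform N s (k, l) = Real.pi / (2 * N) * (s * k ^ 2) + Real.pi / (2 * N * s) * l ^ 2 := by
  simp only [qform]; ring

/-- The coefficients of `f` damped and corrected to second order. -/
def remCoeff (N : ℕ) (s : ℝ) (f : ℝ × ℝ → ℂ) (k : ℤ × ℤ) : ℂ :=
  ((1 - Real.exp (-qform N s k) * (1 + qform N s k) : ℝ) : ℂ) * fourierCoeff₂ f k

theorem norm_tsum_fourierCoeff₂_le {f : ℝ × ℝ → ℂ} (hf : IsObservable f) {M : ℝ}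
    (hM : ∀ x, ‖f x‖ ≤ M) (k : ℤ) (q : ℝ) :
    ‖∑' l : ℤ, fourierCoeff₂ f (k, l) * expi (l * q)‖ ≤ M := by
  rw [(hasSum_rowCoeff hf k q).tsum_eq]
  exact norm_rowCoeff_le hM k q

theorem summable_row {f : ℝ × ℝ → ℂ} (hf : IsObservable f) (k : ℤ) :
    Summable fun l : ℤ => ‖fourierCoeff₂ f (k, l)‖ := (summable_fourierCoeff₂ hf).prod_factor k

/-- `∑ c(l) e^{2πilq}` is an absolutely convergent series bounded by `S`. -/
def RowBound (c : ℤ → ℂ) (S : ℝ) : Prop :=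
  (Summable fun l => ‖c l‖) ∧ ∀ q : ℝ, ‖∑' l : ℤ, c l * expi (l * q)‖ ≤ S

theorem RowBound.summable_mul {c : ℤ → ℂ} {S : ℝ} (h : RowBound c S) (q : ℝ) :
    Summable fun l : ℤ => c l * expi (l * q) :=
  Summable.of_norm (by simpa [norm_expi] using h.1)

theorem RowBound.add {c d : ℤ → ℂ} {S R : ℝ} (hc : RowBound c S) (hd : RowBound d R) :
    RowBound (fun l => c l + d l) (S + R) := by
  refine ⟨Summable.of_nonneg_of_le (fun _ => norm_nonneg _) (fun _ => norm_add_le _ _)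
    (hc.1.add hd.1), fun q => ?_⟩
  simp_rw [add_mul]
  rw [(hc.summable_mul q).tsum_add (hd.summable_mul q)]
  exact (norm_add_le _ _).trans (add_le_add (hc.2 q) (hd.2 q))

theorem RowBound.const_mul {c : ℤ → ℂ} {S : ℝ} (hc : RowBound c S) {a : ℝ} (ha : 0 ≤ a) :
    RowBound (fun l => (a : ℂ) * c l) (a * S) := by
  refine ⟨by simpa using hc.1.mul_left _, fun q => ?_⟩
  simp_rw [mul_assoc]
  rw [tsum_mul_left, norm_mul, Complex.norm_real, Real.norm_of_nonneg ha]
  exact mul_le_mul_of_nonneg_left (hc.2 q) ha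

theorem RowBound.mono {c : ℤ → ℂ} {S R : ℝ} (hc : RowBound c S) (h : S ≤ R) : RowBound c R :=
  ⟨hc.1, fun q => (hc.2 q).trans h⟩

theorem rowBound_fourierCoeff₂ {f : ℝ × ℝ → ℂ} (hf : IsObservable f) {M : ℝ}
    (hM : ∀ x, ‖f x‖ ≤ M) (k : ℤ) : RowBound (fun l => fourierCoeff₂ f (k, l)) M :=
  ⟨summable_row hf k, norm_tsum_fourierCoeff₂_le hf hM k⟩

theorem one_sub_exp_mem {x : ℝ} (hx : 0 ≤ x) :
    0 ≤ 1 - Real.exp (-x) * (1 + x) ∧ 1 - Real.exp (-x) * (1 + x) ≤ 1 := by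
  constructor
  · have h := Real.add_one_le_exp x
    have : Real.exp (-x) * (1 + x) ≤ Real.exp (-x) * Real.exp x := by gcongr; linarith
    rw [← Real.exp_add, neg_add_cancel, Real.exp_zero] at this
    linarith
  · have := mul_nonneg (Real.exp_pos (-x)).le (show 0 ≤ 1 + x by linarith)
    linarith

theorem summable_remCoeff {f : ℝ × ℝ → ℂ} (hf : IsObservable f) (N : ℕ) {s : ℝ} (hs : 0 < s) :
    Summable fun k => ‖remCoeff N s f k‖ := by
  refine Summable.of_nonneg_of_le (fun _ => norm_nonneg _) (fun k => ?_) (summable_fourierCoeff₂ hf)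
  obtain ⟨h0, h1⟩ := one_sub_exp_mem (qform_nonneg N hs k)
  rw [remCoeff, norm_mul, Complex.norm_real, Real.norm_of_nonneg h0]
  exact mul_le_of_le_one_left (norm_nonneg _) h1

section Remainder
open scoped Matrix.Norms.L2Operator

theorem norm_remainder_le {f : ℝ × ℝ → ℂ} (hf : IsObservable f) {N : ℕ} (hN : 0 < N)
    {s ρ h M : ℝ} (hs : 0 < s) (hh : 0 < h) (h1 : h ≤ 1) (hM : 0 ≤ M) (hρ : ρ ^ 2 ≤ 1 / h)
    (hsρ : s * ρ ^ 2 ≤ h * N)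
    (h40 : ∀ x, ‖dq^[4] f x‖ ≤ M * (s * ρ) ^ 4)
    (h22 : ∀ x, ‖dq^[2] (dp^[2] f) x‖ ≤ M * (s * ρ) ^ 2 * ρ ^ 2)
    (h04 : ∀ x, ‖dp^[4] f x‖ ≤ M * ρ ^ 4) :
    ‖transSum N (remCoeff N s f)‖ ≤ 30 * M * h := by
  have hNr : (0 : ℝ) < N := by exact_mod_cast hN
  have hπ := Real.pi_pos
  have hπ3 := Real.pi_gt_three
  obtain ⟨hls, hle⟩ := summable_lorentz h hh h1
  have o40 := hf.iterate_dq 4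
  have o22 := (hf.iterate_dp 2).iterate_dq 2
  have o04 := hf.iterate_dp 4
  set A : ℤ → ℝ := fun k => Real.pi / (2 * N) * (s * k ^ 2) with hA
  set B : ℝ := Real.pi / (2 * N * s) with hB
  have hA0 (k : ℤ) : 0 ≤ A k := by positivity
  have hB0 : 0 ≤ B := by positivity
  have hI2 : Complex.I ^ 2 = -1 := Complex.I_sq
  have hI4 : Complex.I ^ 4 = 1 := Complex.I_pow_four
  have c40 (k l : ℤ) : fourierCoeff₂ (dq^[4] f) (k, l)
      = 16 * Real.pi ^ 4 * l ^ 4 * fourierCoeff₂ f (k, l) := by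
    have := fourierCoeff₂_iterate hf 4 0 (k, l)
    simp only [Function.iterate_zero, id, pow_zero, mul_pow, hI4] at this
    rw [this]; ring
  have c22 (k l : ℤ) : fourierCoeff₂ (dq^[2] (dp^[2] f)) (k, l)
      = 16 * Real.pi ^ 4 * (l ^ 2 * k ^ 2) * fourierCoeff₂ f (k, l) := by
    have := fourierCoeff₂_iterate hf 2 2 (k, l)
    simp only [mul_pow, hI2, neg_sq] at this
    rw [this]; ring
  have c04 (k l : ℤ) : fourierCoeff₂ (dp^[4] f) (k, l)
      = 16 * Real.pi ^ 4 * k ^ 4 * fourierCoeff₂ f (k, l) := by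
    have := fourierCoeff₂_iterate hf 0 4 (k, l)
    simp only [Function.iterate_zero, id, pow_zero] at this
    rw [this, (show Even 4 by decide).neg_pow]; simp only [mul_pow, hI4]; ring
  have hπc : (Real.pi : ℂ) ≠ 0 := by exact_mod_cast hπ.ne'
  have hNc : (N : ℂ) ≠ 0 := by exact_mod_cast hN.ne'
  have hsc : (s : ℂ) ≠ 0 := by exact_mod_cast hs.ne'
  have hsρ0 : 0 ≤ s * ρ ^ 2 := by positivity
  have hsq : (s * ρ ^ 2) ^ 2 ≤ h ^ 2 * N ^ 2 := by
    rw [← mul_pow]; exact pow_le_pow_left₀ hsρ0 hsρ 2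
  have hπ2 : 1 ≤ Real.pi ^ 2 := by nlinarith
  have hπp3 : 1 ≤ Real.pi ^ 3 := one_le_pow₀ (by linarith)
  have hπp4 : 1 ≤ Real.pi ^ 4 := one_le_pow₀ (by linarith)
  have hρ4 : ρ ^ 4 ≤ 1 / h ^ 2 := by
    have := pow_le_pow_left₀ (sq_nonneg ρ) hρ 2
    rw [div_pow, one_pow, ← pow_mul] at this
    exact this
  have bQ2 (k : ℤ) :
      RowBound (fun l => ((A k + B * l ^ 2 : ℝ) : ℂ) ^ 2 * fourierCoeff₂ f (k, l)) (M * h ^ 2) := by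
    have e (l : ℤ) : ((A k + B * l ^ 2 : ℝ) : ℂ) ^ 2 * fourierCoeff₂ f (k, l)
        = ((1 / (64 * Real.pi ^ 2 * N ^ 2) / s ^ 2 : ℝ) : ℂ) * fourierCoeff₂ (dq^[4] f) (k, l)
          + ((1 / (32 * Real.pi ^ 2 * N ^ 2) : ℝ) : ℂ) * fourierCoeff₂ (dq^[2] (dp^[2] f)) (k, l)
          + ((s ^ 2 / (64 * Real.pi ^ 2 * N ^ 2) : ℝ) : ℂ) * fourierCoeff₂ (dp^[4] f) (k, l) := by
      rw [c40, c22, c04, hA, hB]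
      push_cast
      field_simp
      ring
    simp_rw [e]
    refine ((((rowBound_fourierCoeff₂ o40 h40 k).const_mul (by positivity)).add
      ((rowBound_fourierCoeff₂ o22 h22 k).const_mul (by positivity))).add
      ((rowBound_fourierCoeff₂ o04 h04 k).const_mul (by positivity))).mono ?_
    have : (1 / (64 * Real.pi ^ 2 * N ^ 2) / s ^ 2) * (M * (s * ρ) ^ 4)
        + (1 / (32 * Real.pi ^ 2 * N ^ 2)) * (M * (s * ρ) ^ 2 * ρ ^ 2)
        + (s ^ 2 / (64 * Real.pi ^ 2 * N ^ 2)) * (M * ρ ^ 4)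
        = M * (s * ρ ^ 2) ^ 2 / (16 * Real.pi ^ 2 * N ^ 2) := by
      field_simp; ring
    rw [this, div_le_iff₀ (by positivity)]
    have h3 : M * (s * ρ ^ 2) ^ 2 ≤ M * (h ^ 2 * N ^ 2) := mul_le_mul_of_nonneg_left hsq hM
    have h4 : 0 ≤ M * (h ^ 2 * N ^ 2) := by positivity
    nlinarith
  have bQ (k : ℤ) : RowBound (fun l => ((A k + B * l ^ 2 : ℝ) : ℂ)
      * ((k : ℂ) ^ 2 * fourierCoeff₂ f (k, l))) M := by
    have e (l : ℤ) : ((A k + B * l ^ 2 : ℝ) : ℂ) * ((k : ℂ) ^ 2 * fourierCoeff₂ f (k, l))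
        = ((1 / (32 * Real.pi ^ 3 * N) / s : ℝ) : ℂ) * fourierCoeff₂ (dq^[2] (dp^[2] f)) (k, l)
          + ((s / (32 * Real.pi ^ 3 * N) : ℝ) : ℂ) * fourierCoeff₂ (dp^[4] f) (k, l) := by
      rw [c22, c04, hA, hB]
      push_cast
      field_simp
      ring
    simp_rw [e]
    refine (((rowBound_fourierCoeff₂ o22 h22 k).const_mul (by positivity)).add
      ((rowBound_fourierCoeff₂ o04 h04 k).const_mul (by positivity))).mono ?_
    have : (1 / (32 * Real.pi ^ 3 * N) / s) * (M * (s * ρ) ^ 2 * ρ ^ 2)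
        + (s / (32 * Real.pi ^ 3 * N)) * (M * ρ ^ 4)
        = M * ((s * ρ ^ 2) * ρ ^ 2) / (16 * Real.pi ^ 3 * N) := by
      field_simp; ring
    rw [this, div_le_iff₀ (by positivity)]
    have h3 : (s * ρ ^ 2) * ρ ^ 2 ≤ (h * N) * (1 / h) :=
      mul_le_mul hsρ hρ (sq_nonneg _) (by positivity)
    rw [show h * N * (1 / h) = N by field_simp] at h3
    have h4 : M * ((s * ρ ^ 2) * ρ ^ 2) ≤ M * N := mul_le_mul_of_nonneg_left h3 hM
    have h5 : 0 ≤ M * N := by positivity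
    nlinarith
  have b4 (k : ℤ) : RowBound (fun l => (k : ℂ) ^ 4 * fourierCoeff₂ f (k, l)) (M / h ^ 2) := by
    have e (l : ℤ) : (k : ℂ) ^ 4 * fourierCoeff₂ f (k, l)
        = ((1 / (16 * Real.pi ^ 4) : ℝ) : ℂ) * fourierCoeff₂ (dp^[4] f) (k, l) := by
      rw [c04]; push_cast; field_simp
    simp_rw [e]
    refine ((rowBound_fourierCoeff₂ o04 h04 k).const_mul (by positivity)).mono ?_
    have h3 : M * ρ ^ 4 ≤ M * (1 / h ^ 2) := mul_le_mul_of_nonneg_left hρ4 hM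
    rw [one_div, inv_mul_le_iff₀ (by positivity), div_eq_mul_one_div]
    have h5 : 0 ≤ M * (1 / h ^ 2) := by positivity
    nlinarith
  have hrem (k l : ℤ) : remCoeff N s f (k, l) = ((1 - Real.exp (-(A k + B * l ^ 2))
      * (1 + (A k + B * l ^ 2)) : ℝ) : ℂ) * fourierCoeff₂ f (k, l) := by
    rw [remCoeff, qform_mk]
  have main (k : ℤ) (q : ℝ) : ‖∑' l : ℤ, remCoeff N s f (k, l) * expi (l * q)‖
      ≤ 6 * M * (h ^ 2 / (1 + h ^ 2 * k ^ 2)) := by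
    simp_rw [hrem]
    by_cases hk : h ^ 2 * (k : ℝ) ^ 2 ≤ 1
    · refine (norm_tsum_remainder_le_sq (hA0 k) hB0 (bQ2 k).1 (bQ2 k).2 q).trans ?_
      rw [mul_div_assoc', le_div_iff₀ (by positivity)]
      have : 0 ≤ M * h ^ 2 := by positivity
      nlinarith
    · push Not at hk
      have hk0 : (k : ℝ) ≠ 0 := by rintro h0; rw [h0] at hk; norm_num at hk
      have hk2 : 0 < (k : ℝ) ^ 2 := by positivity
      have hkc : (k : ℂ) ≠ 0 := by exact_mod_cast hk0
      have b4' : RowBound (fun l => fourierCoeff₂ f (k, l)) (1 / (k : ℝ) ^ 4 * (M / h ^ 2)) := by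
        have := (b4 k).const_mul (a := 1 / (k : ℝ) ^ 4) (by positivity)
        refine cast (congrArg (RowBound · _) ?_) this
        ext l; push_cast; field_simp
      have bQ' : RowBound (fun l => ((A k + B * l ^ 2 : ℝ) : ℂ) * fourierCoeff₂ f (k, l))
          (1 / (k : ℝ) ^ 2 * M) := by
        have := (bQ k).const_mul (a := 1 / (k : ℝ) ^ 2) (by positivity)
        refine cast (congrArg (RowBound · _) ?_) this
        ext l; push_cast; field_simp
      refine (norm_tsum_remainder_le (hA0 k) hB0 b4'.1 bQ'.1 b4'.2 bQ'.2 q).trans ?_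
      have e1 : 1 / (k : ℝ) ^ 4 * (M / h ^ 2) ≤ M / (k : ℝ) ^ 2 := by
        rw [div_mul_div_comm, one_mul, div_le_div_iff₀ (by positivity) hk2]
        have : 0 ≤ M * (k : ℝ) ^ 2 := by positivity
        nlinarith
      have e2 : M / (k : ℝ) ^ 2 ≤ 2 * M * (h ^ 2 / (1 + h ^ 2 * k ^ 2)) := by
        rw [mul_div_assoc', div_le_div_iff₀ hk2 (by positivity)]
        nlinarith
      have e3 : 1 / (k : ℝ) ^ 2 * M = M / (k : ℝ) ^ 2 := by ring
      linarith
  refine (norm_transSum_le N (summable_remCoeff hf N hs) (hls.mul_left (6 * M)) main).trans ?_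
  rw [tsum_mul_left]
  nlinarith

end Remainder


/-! ### The discrete Fourier transform -/

theorem dftEntry_eq (N k j : ℕ) :
    dftEntry N k j = ((1 / Real.sqrt N : ℝ) : ℂ) * expi (-(k * j / N)) := by
  rw [dftEntry, expi]; push_cast; ring_nf

theorem expi_pow (x : ℝ) (n : ℕ) : expi x ^ n = expi (n * x) := by
  rw [expi, expi, ← Complex.exp_nat_mul]; push_cast; ring_nf

theorem expi_eq_one_iff (x : ℝ) : expi x = 1 ↔ ∃ n : ℤ, x = n := by
  constructor
  · intro h
    rw [expi, Complex.exp_eq_one_iff] at h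
    obtain ⟨n, hn⟩ := h
    refine ⟨n, ?_⟩
    have h2 : (2 * Real.pi * Complex.I : ℂ) ≠ 0 := Complex.two_pi_I_ne_zero
    have : (x : ℂ) = n := mul_left_cancel₀ h2 (by rw [hn]; ring)
    exact_mod_cast this
  · rintro ⟨n, rfl⟩; exact expi_int n

theorem sum_expi {N : ℕ} (hN : 0 < N) (x : ℤ) :
    ∑ l : Fin N, expi ((l : ℕ) * (x / N)) = if (N : ℤ) ∣ x then (N : ℂ) else 0 := by
  have hNr : (N : ℝ) ≠ 0 := by exact_mod_cast hN.ne'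
  rw [Fin.sum_univ_eq_sum_range (fun l => expi ((l : ℕ) * (x / N))) N]
  simp_rw [← expi_pow]
  split_ifs with h
  · obtain ⟨t, rfl⟩ := h
    have : expi (((N * t : ℤ) : ℝ) / N) = 1 := by
      rw [expi_eq_one_iff]; exact ⟨t, by push_cast; field_simp⟩
    simp only [this, one_pow, Finset.sum_const, Finset.card_range, nsmul_eq_mul, mul_one]
  · have h1 : expi (x / N) ≠ 1 := by
      rw [Ne, expi_eq_one_iff]
      rintro ⟨t, ht⟩
      refine h ⟨t, ?_⟩
      rw [div_eq_iff hNr] at ht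
      have : x = t * N := by exact_mod_cast ht
      rw [this, mul_comm]
    rw [geom_sum_eq h1, expi_pow]
    have : expi (N * (x / N)) = 1 := by
      rw [expi_eq_one_iff]; exact ⟨x, by field_simp⟩
    rw [this, sub_self, zero_div]

theorem dft_apply (N : ℕ) (k j : Fin N) :
    dft N k j = ((1 / Real.sqrt N : ℝ) : ℂ) * expi (-((k : ℕ) * (j : ℕ) / N)) := by
  rw [dft, Matrix.of_apply, dftEntry_eq]

theorem sum_conj_dftEntry_mul {N : ℕ} (hN : 0 < N) (i j : Fin N) :
    ∑ k : Fin N, (starRingEnd ℂ) (dftEntry N k i) * dftEntry N k j = if i = j then 1 else 0 := by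
  have hNr : (0 : ℝ) < N := by exact_mod_cast hN
  have hNc : (N : ℂ) ≠ 0 := by exact_mod_cast hN.ne'
  have e (k : Fin N) : (starRingEnd ℂ) (dftEntry N k i) * dftEntry N k j
      = (1 / N : ℂ) * expi ((k : ℕ) * (((i : ℤ) - (j : ℤ) : ℤ) / N)) := by
    rw [dftEntry_eq, dftEntry_eq, map_mul, Complex.conj_ofReal, conj_expi, mul_mul_mul_comm,
      ← expi_add, ← Complex.ofReal_mul, div_mul_div_comm, one_mul, Real.mul_self_sqrt hNr.le]
    push_cast
    congr 2
    ring
  simp_rw [e]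
  rw [← Finset.mul_sum, sum_expi hN]
  by_cases hij : i = j
  · simp [hij, hNc]
  · rw [if_neg hij, if_neg, mul_zero]
    rintro h
    exact hij (fin_eq_of_modEq ((Int.modEq_iff_dvd.mpr h).symm))

theorem dft_mem_unitary {N : ℕ} (hN : 0 < N) : dft N ∈ unitary (Matrix (Fin N) (Fin N) ℂ) := by
  rw [Matrix.mem_unitaryGroup_iff']
  ext i j
  rw [Matrix.mul_apply, Matrix.one_apply, ← sum_conj_dftEntry_mul hN]
  rfl

theorem dft_mul_translation {N : ℕ} (hN : 0 < N) (k : ℤ × ℤ) :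
    dft N * translation N k = translation N (k.2, -k.1) * dft N := by
  have hNr : (N : ℝ) ≠ 0 := by exact_mod_cast hN.ne'
  ext l j
  rw [Matrix.mul_apply, Matrix.mul_apply]
  obtain ⟨m, hm⟩ := exists_fin_modEq hN ((j : ℤ) + k.1)
  obtain ⟨n, hn⟩ := exists_fin_modEq hN ((l : ℤ) - k.2)
  have hn' : (l : ℤ) ≡ (n : ℤ) + k.2 [ZMOD N] := by
    have := (hn.add_right k.2).symm
    rwa [sub_add_cancel] at this
  rw [Finset.sum_eq_single m, Finset.sum_eq_single n]
  · simp only [translation_apply]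
    rw [if_pos hm, if_pos hn', dft_apply, dft_apply, mul_assoc, ← expi_add, mul_left_comm,
      ← expi_add]
    congr 1
    obtain ⟨t, ht⟩ := hm.symm.dvd
    obtain ⟨u, hu⟩ := hn'.symm.dvd
    have ht' : ((m : ℕ) : ℝ) = (j : ℕ) + k.1 + N * t := by
      have : ((m : ℕ) : ℤ) = (j : ℕ) + k.1 + N * t := by linarith
      exact_mod_cast this
    have hu' : ((n : ℕ) : ℝ) = (l : ℕ) - k.2 - N * u := by
      have : ((n : ℕ) : ℤ) = (l : ℕ) - k.2 - N * u := by linarith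
      have h2 : (((n : ℕ) : ℤ) : ℝ) = (((l : ℕ) - k.2 - N * u : ℤ) : ℝ) := by rw [this]
      push_cast at h2; exact h2
    refine expi_eq_of_sub_int (-(l : ℕ) * t - k.1 * u - (j : ℕ) * u) ?_
    rw [ht', hu']
    push_cast
    field_simp
    ring
  · intro b _ hb
    rw [translation_apply, if_neg, zero_mul]
    intro h
    exact hb (fin_eq_of_modEq (Int.ModEq.add_right_cancel' k.2 (h.symm.trans hn')))
  · simp
  · intro b _ hb
    rw [translation_apply, if_neg, mul_zero]
    intro h
    exact hb (fin_eq_of_modEq (h.trans hm.symm))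
  · simp

section Rotation
open scoped Matrix.Norms.L2Operator

/-- The lattice rotation implemented by the discrete Fourier transform. -/
def latticeRot : ℤ × ℤ ≃ ℤ × ℤ where
  toFun k := (k.2, -k.1)
  invFun k := (-k.2, k.1)
  left_inv k := by simp
  right_inv k := by simp

theorem dft_mul_transSum {N : ℕ} (hN : 0 < N) {c c' : ℤ × ℤ → ℂ} (hc : Summable fun k => ‖c k‖)
    (h : ∀ k, c' (latticeRot k) = c k) : dft N * transSum N c = transSum N c' * dft N := by
  have hc' : Summable fun k => ‖c' k‖ := by
    rw [← latticeRot.summable_iff]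
    simpa [Function.comp_def, h] using hc
  have e : transSum N c' = ∑' k, c' (latticeRot k) • translation N (latticeRot k) :=
    (latticeRot.tsum_eq fun k => c' k • translation N k).symm
  have hs : Summable fun k => c' (latticeRot k) • translation N (latticeRot k) :=
    (latticeRot.summable_iff (f := fun k => c' k • translation N k)).mpr (summable_trans N hc')
  rw [e, transSum, ← (summable_trans N hc).tsum_mul_left, ← hs.tsum_mul_right]
  congr 1; ext1 k
  rw [h, Matrix.mul_smul, Matrix.smul_mul, dft_mul_translation hN]
  rfl

theorem norm_transSum_rot {N : ℕ} (hN : 0 < N) {c c' : ℤ × ℤ → ℂ} (hc : Summable fun k => ‖c k‖)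
    (h : ∀ k, c' (latticeRot k) = c k) : ‖transSum N c‖ = ‖transSum N c'‖ := by
  have hU := dft_mem_unitary hN
  rw [← CStarRing.norm_mem_unitary_mul (transSum N c) hU, dft_mul_transSum hN hc h,
    CStarRing.norm_mul_mem_unitary _ hU]

/-- Rotation of an observable by a quarter turn. -/
def rot (f : ℝ × ℝ → ℂ) (x : ℝ × ℝ) : ℂ := f (-x.2, x.1)

theorem dq_rot (f : ℝ × ℝ → ℂ) : dq (rot f) = rot (dp f) := rfl

theorem dp_rot (f : ℝ × ℝ → ℂ) : dp (rot f) = -rot (dq f) := by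
  ext x
  simp only [dp, rot, dq, Pi.neg_apply]
  rw [deriv_comp_neg (f := fun t => f (t, x.1))]

theorem dp_neg (f : ℝ × ℝ → ℂ) : dp (-f) = -dp f := by
  ext x; simp only [dp, Pi.neg_apply, deriv.fun_neg]

theorem dp_dp_rot (f : ℝ × ℝ → ℂ) : dp (dp (rot f)) = rot (dq (dq f)) := by
  rw [dp_rot, dp_neg, dp_rot, neg_neg]

theorem IsObservable.rot {f : ℝ × ℝ → ℂ} (hf : IsObservable f) : IsObservable (rot f) where
  smooth := hf.smooth.comp (by fun_prop : ContDiff ℝ ∞ fun x : ℝ × ℝ => (-x.2, x.1))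
  periodic_q q p := hf.periodic_p _ _
  periodic_p q p := by
    have := hf.periodic_q (-(p + 1)) q
    simp only [QBaker.rot]
    rw [← this]; ring_nf

theorem fourierCoeff₂_rot {f : ℝ × ℝ → ℂ} (hf : IsObservable f) (k : ℤ × ℤ) :
    fourierCoeff₂ (rot f) (latticeRot k) = fourierCoeff₂ f k := by
  rw [fourierCoeff₂_eq' hf.rot.smooth.continuous, fourierCoeff₂_eq hf.smooth.continuous]
  have hper : Function.Periodic (fun q => rowCoeff f k.1 q * expi (-(k.2 * q))) 1 := by
    intro q
    simp only [rowCoeff, hf.periodic_q]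
    rw [expi_eq_of_sub_int (-k.2)]; push_cast; ring
  have e1 := hper.intervalIntegral_add_eq (-1) 0
  rw [zero_add, neg_add_cancel] at e1
  rw [← e1]
  have e2 := intervalIntegral.integral_comp_neg (a := 0) (b := 1)
    (fun q => rowCoeff f k.1 q * expi (-(k.2 * q)))
  rw [neg_zero] at e2
  rw [← e2]
  congr 1; ext p
  simp [latticeRot, rowCoeff, rot]

theorem norm_remainder_rot_le {f : ℝ × ℝ → ℂ} (hf : IsObservable f) {N : ℕ} (hN : 0 < N)
    {s ρ h M : ℝ} (hs : 0 < s) (hh : 0 < h) (h1 : h ≤ 1) (hM : 0 ≤ M) (hρ : ρ ^ 2 ≤ 1 / h)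
    (hsρ : s * ρ ^ 2 ≤ h * N)
    (h04 : ∀ x, ‖dp^[4] f x‖ ≤ M * (s * ρ) ^ 4)
    (h22 : ∀ x, ‖dq^[2] (dp^[2] f) x‖ ≤ M * (s * ρ) ^ 2 * ρ ^ 2)
    (h40 : ∀ x, ‖dq^[4] f x‖ ≤ M * ρ ^ 4) :
    ‖transSum N (remCoeff N (1 / s) f)‖ ≤ 30 * M * h := by
  rw [norm_transSum_rot hN (summable_remCoeff hf N (by positivity)) (c' := remCoeff N s (rot f))]
  · refine norm_remainder_le hf.rot hN hs hh h1 hM hρ hsρ (fun x => h04 (-x.2, x.1)) (fun x => ?_)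
      (fun x => ?_)
    · have : dq^[2] (dp^[2] (rot f)) = rot (dq^[2] (dp^[2] f)) := by
        rw [iterate_dq_iterate_dp hf]
        simp only [Function.iterate_succ, Function.iterate_zero, Function.comp, id, dp_dp_rot, dq_rot]
      rw [this]; exact h22 _
    · have : dp^[4] (rot f) = rot (dq^[4] f) := by
        simp only [Function.iterate_succ, Function.iterate_zero, Function.comp, id, dp_dp_rot]
      rw [this]; exact h40 _
  · intro k
    simp only [remCoeff, fourierCoeff₂_rot hf]
    have : qform N s (latticeRot k) = qform N (1 / s) k := by
      simp only [qform, latticeRot, Equiv.coe_fn_mk]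
      push_cast
      field_simp
      ring
    rw [this]

end Rotation

/-! ### The quantised baker's map -/

theorem bakerMix_mem_unitary {N : ℕ} (hN : 0 < N) (hev : Even N) :
    bakerMix N ∈ unitary (Matrix (Fin N) (Fin N) ℂ) := by
  obtain ⟨m, rfl⟩ := hev
  have hm : 0 < m := by omega
  have hdiv : (m + m) / 2 = m := by omega
  rw [Matrix.mem_unitaryGroup_iff']
  ext i j
  rw [Matrix.mul_apply, Matrix.one_apply, Fin.sum_univ_add]
  simp only [Matrix.star_apply, bakerMix, Matrix.of_apply, hdiv, Fin.val_castAdd, Fin.val_natAdd,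
    RCLike.star_def]
  have hc1 (x : Fin m) : ((x : ℕ) < m) = True := by simp
  have hc2 (x : Fin m) : (m ≤ (x : ℕ)) = False := by simp
  have hc3 (x : Fin m) : (m + (x : ℕ) < m) = False := by simp
  have hc4 (x : Fin m) : (m ≤ m + (x : ℕ)) = True := by simp
  simp only [hc1, hc2, hc3, hc4, true_and, false_and, if_false, Nat.add_sub_cancel_left]
  by_cases hi : (i : ℕ) < m <;> by_cases hj : (j : ℕ) < m
  · have h := sum_conj_dftEntry_mul hm ⟨i, hi⟩ ⟨j, hj⟩
    simp only [Fin.mk.injEq] at h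
    simpa [hi, hj, not_le.mpr hi, not_le.mpr hj, Fin.ext_iff] using h
  · have : i ≠ j := by rintro rfl; exact hj hi
    simp [hi, hj, not_le.mpr hi, this]
  · have : i ≠ j := by rintro rfl; exact hi hj
    simp [hi, hj, not_le.mpr hj, this]
  · have h := sum_conj_dftEntry_mul hm ⟨i - m, by omega⟩ ⟨j - m, by omega⟩
    simp only [Fin.mk.injEq] at h
    have e : ((i : ℕ) - m = j - m) = ((i : ℕ) = j) := by
      apply propext; omega
    simp only [e] at h
    simpa [hi, hj, not_lt.mp hi, not_lt.mp hj, Fin.ext_iff] using h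

theorem dft_inv {N : ℕ} (hN : 0 < N) : (dft N)⁻¹ = star (dft N) :=
  Matrix.inv_eq_left_inv (Unitary.star_mul_self_of_mem (dft_mem_unitary hN))

theorem quantumBaker_mem_unitary {N : ℕ} (hN : 0 < N) (hev : Even N) :
    quantumBaker N ∈ unitary (Matrix (Fin N) (Fin N) ℂ) := by
  rw [quantumBaker, dft_inv hN]
  exact mul_mem (Unitary.star_mem (dft_mem_unitary hN)) (bakerMix_mem_unitary hN hev)

theorem dft_mul_quantumBaker {N : ℕ} (hN : 0 < N) : dft N * quantumBaker N = bakerMix N := by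
  rw [quantumBaker, dft_inv hN, ← mul_assoc, Unitary.mul_star_self_of_mem (dft_mem_unitary hN),
    one_mul]


/-! ### Gaussian sums -/

theorem summable_gauss {β : ℝ} (hβ : 0 < β) (y : ℝ) :
    Summable fun n : ℤ => Real.exp (-(β * (n + y) ^ 2)) := by
  have hs := (summable_one_div_one_add_sq.mul_left (Real.exp (β * y ^ 2) * (1 + 2 / β)))
  refine Summable.of_nonneg_of_le (fun _ => (Real.exp_pos _).le) (fun n => ?_) hs
  have h1 : -(β * ((n : ℝ) + y) ^ 2) ≤ β * y ^ 2 - β / 2 * n ^ 2 := by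
    nlinarith [mul_nonneg hβ.le (sq_nonneg ((n : ℝ) + 2 * y))]
  have h2 : Real.exp (-(β / 2 * (n : ℝ) ^ 2)) ≤ (1 + 2 / β) * (1 / (1 + (n : ℝ) ^ 2)) := by
    rw [Real.exp_neg, mul_one_div, ← one_div, div_le_div_iff₀ (Real.exp_pos _) (by positivity)]
    have h3 := Real.add_one_le_exp (β / 2 * (n : ℝ) ^ 2)
    have h4 : 1 * (1 + (n : ℝ) ^ 2) ≤ (1 + 2 / β) * (β / 2 * (n : ℝ) ^ 2 + 1) := by
      have : (1 + 2 / β) * (β / 2 * (n : ℝ) ^ 2 + 1)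
          = 1 + (n : ℝ) ^ 2 + (β / 2 * (n : ℝ) ^ 2 + 2 / β) := by field_simp; ring
      rw [this]
      have : 0 ≤ β / 2 * (n : ℝ) ^ 2 + 2 / β := by positivity
      linarith
    exact h4.trans (mul_le_mul_of_nonneg_left h3 (by positivity))
  calc Real.exp (-(β * ((n : ℝ) + y) ^ 2)) ≤ Real.exp (β * y ^ 2 - β / 2 * n ^ 2) :=
        Real.exp_le_exp.mpr h1
    _ = Real.exp (β * y ^ 2) * Real.exp (-(β / 2 * (n : ℝ) ^ 2)) := by
        rw [← Real.exp_add]; ring_nf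
    _ ≤ _ := by rw [mul_assoc]; exact mul_le_mul_of_nonneg_left h2 (Real.exp_pos _).le

theorem tsum_gauss_le {β : ℝ} (hβ : 1 ≤ β) (y : ℝ) :
    ∑' n : ℤ, Real.exp (-(β * (n + y) ^ 2)) ≤ 30 := by
  have hper : ∑' n : ℤ, Real.exp (-(β * (n + y) ^ 2))
      = ∑' n : ℤ, Real.exp (-(β * (n + Int.fract y) ^ 2)) := by
    rw [← (Equiv.addRight ⌊y⌋).tsum_eq fun n : ℤ => Real.exp (-(β * (n + Int.fract y) ^ 2))]
    congr 1; ext n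
    simp only [Equiv.coe_addRight, Int.cast_add, Int.fract]
    ring_nf
  rw [hper]
  obtain ⟨hls, hle⟩ := summable_lorentz 1 one_pos le_rfl
  have hb (n : ℤ) : Real.exp (-(β * (n + Int.fract y) ^ 2))
      ≤ 6 * (1 ^ 2 / (1 + 1 ^ 2 * (n : ℝ) ^ 2)) := by
    set f := Int.fract y
    have hf0 : 0 ≤ f := Int.fract_nonneg y
    have hf1 : f < 1 := Int.fract_lt_one y
    have h1 : -(β * ((n : ℝ) + f) ^ 2) ≤ 1 + -((n : ℝ) ^ 2 / 2) := by
      nlinarith [sq_nonneg ((n : ℝ) + 2 * f), sq_nonneg ((n : ℝ) + f)]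
    have h3 := Real.add_one_le_exp ((n : ℝ) ^ 2 / 2)
    have h2 : Real.exp (-((n : ℝ) ^ 2 / 2)) ≤ 2 / (1 + (n : ℝ) ^ 2) := by
      rw [Real.exp_neg, ← one_div, div_le_div_iff₀ (Real.exp_pos _) (by positivity)]
      nlinarith
    calc _ ≤ Real.exp (1 + -((n : ℝ) ^ 2 / 2)) := Real.exp_le_exp.mpr h1
      _ = Real.exp 1 * Real.exp (-((n : ℝ) ^ 2 / 2)) := Real.exp_add _ _
      _ ≤ 3 * (2 / (1 + (n : ℝ) ^ 2)) := by
        have := Real.exp_one_lt_d9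
        exact mul_le_mul (by linarith) h2 (Real.exp_pos _).le (by norm_num)
      _ = _ := by rw [one_pow, one_mul]; ring
  refine ((summable_gauss (by linarith) _).tsum_le_tsum hb (hls.mul_left 6)).trans ?_
  rw [tsum_mul_left]; linarith

theorem tsum_gauss_tail_le {β d : ℝ} (hβ : 2 ≤ β) (hd : 0 ≤ d) {y : ℝ}
    (h : ∀ n : ℤ, d ≤ |(n : ℝ) + y|) :
    ∑' n : ℤ, Real.exp (-(β * (n + y) ^ 2)) ≤ 30 * Real.exp (-(β / 2 * d ^ 2)) := by
  have hb (n : ℤ) : Real.exp (-(β * (n + y) ^ 2))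
      ≤ Real.exp (-(β / 2 * (n + y) ^ 2)) * Real.exp (-(β / 2 * d ^ 2)) := by
    rw [← Real.exp_add, Real.exp_le_exp]
    have : d ^ 2 ≤ ((n : ℝ) + y) ^ 2 := by rw [← sq_abs (_ + _)]; exact pow_le_pow_left₀ hd (h n) 2
    nlinarith
  have hs := summable_gauss (show 0 < β / 2 by linarith) y
  refine ((summable_gauss (by linarith) y).tsum_le_tsum hb (hs.mul_right _)).trans ?_
  rw [tsum_mul_right]
  exact mul_le_mul_of_nonneg_right (tsum_gauss_le (by linarith) y) (Real.exp_pos _).le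

theorem tsum_gauss_poisson {α : ℝ} (hα : 0 < α) (c θ : ℝ) :
    ∑' n : ℤ, (Real.exp (-(Real.pi * α * (n - c) ^ 2)) : ℂ) * expi (θ * n)
      = ((1 / Real.sqrt α : ℝ) : ℂ) * ∑' n : ℤ, (Real.exp (-(Real.pi / α * (n - θ) ^ 2)) : ℂ)
        * expi (-(c * (n - θ))) := by
  have h := Complex.tsum_exp_neg_quadratic (a := (α : ℂ)) (by simpa) (α * c + Complex.I * θ)
  have hαc : (α : ℂ) ≠ 0 := by exact_mod_cast hα.ne'
  have hsq : (α : ℂ) ^ (1 / 2 : ℂ) = ((Real.sqrt α : ℝ) : ℂ) := by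
    rw [Real.sqrt_eq_rpow, Complex.ofReal_cpow hα.le]; norm_num
  have e1 (n : ℤ) : (Real.exp (-(Real.pi * α * (n - c) ^ 2)) : ℂ) * expi (θ * n)
      = Complex.exp (-(Real.pi * α * c ^ 2)) * Complex.exp (-Real.pi * α * n ^ 2
        + 2 * Real.pi * (α * c + Complex.I * θ) * n) := by
    rw [expi, Complex.ofReal_exp, ← Complex.exp_add, ← Complex.exp_add]
    congr 1; push_cast; ring
  have e2 (n : ℤ) : (Real.exp (-(Real.pi / α * (n - θ) ^ 2)) : ℂ) * expi (-(c * (n - θ)))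
      = Complex.exp (-(Real.pi * α * c ^ 2)) * Complex.exp (-Real.pi / α
        * (n + Complex.I * (α * c + Complex.I * θ)) ^ 2) := by
    rw [expi, Complex.ofReal_exp, ← Complex.exp_add, ← Complex.exp_add]
    congr 1; push_cast
    have hI : Complex.I ^ 2 = -1 := Complex.I_sq
    have : ((n : ℂ) + Complex.I * (α * c + Complex.I * θ)) ^ 2
        = ((n : ℂ) - θ) ^ 2 + 2 * Complex.I * α * c * (n - θ) - α ^ 2 * c ^ 2 := by
      linear_combination (α ^ 2 * c ^ 2 + 2 * n * θ + θ ^ 2 * (Complex.I ^ 2 - 1)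
        + 2 * α * c * Complex.I * θ) * hI
    rw [this]
    field_simp
    ring
  simp_rw [e1, e2, tsum_mul_left, h, hsq]
  push_cast
  ring

/-! ### Coherent states on the torus -/

/-- The Gaussian wave packet centred at `(q, p)` with squeezing `s`, on the lattice of step `1/N`. -/
def wave (N : ℕ) (s : ℝ) (x : ℝ × ℝ) (n : ℤ) : ℂ :=
  (Real.exp (-(Real.pi * (s / N) * (n - N * x.1) ^ 2)) : ℂ) * expi (x.2 * n)

/-- The torus coherent state at `(q, p)` with squeezing `s`. -/
def coherent (N : ℕ) (s : ℝ) (x : ℝ × ℝ) (j : Fin N) : ℂ :=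
  ((Real.sqrt (Real.sqrt (2 * s / N)) : ℝ) : ℂ) * ∑' n : ℤ, wave N s x ((j : ℕ) + N * n)

theorem norm_wave (N : ℕ) (s : ℝ) (x : ℝ × ℝ) (n : ℤ) :
    ‖wave N s x n‖ = Real.exp (-(Real.pi * (s / N) * (n - N * x.1) ^ 2)) := by
  rw [wave, norm_mul, norm_expi, mul_one, Complex.norm_real, Real.norm_of_nonneg (Real.exp_pos _).le]

theorem norm_wave_add_mul {N : ℕ} (hN : 0 < N) (s : ℝ) (x : ℝ × ℝ) (j n : ℤ) :
    ‖wave N s x (j + N * n)‖ = Real.exp (-(Real.pi * s * N * (n + (j / N - x.1)) ^ 2)) := by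
  have hNr : (N : ℝ) ≠ 0 := by exact_mod_cast hN.ne'
  rw [norm_wave]
  congr 1
  push_cast
  field_simp
  ring

theorem summable_wave {N : ℕ} (hN : 0 < N) {s : ℝ} (hs : 0 < s) (x : ℝ × ℝ) :
    Summable fun n : ℤ => ‖wave N s x n‖ := by
  have hNr : (0 : ℝ) < N := by exact_mod_cast hN
  simp_rw [norm_wave, sub_eq_add_neg]
  exact summable_gauss (by have := Real.pi_pos; positivity) _

theorem summable_wave_add_mul {N : ℕ} (hN : 0 < N) {s : ℝ} (hs : 0 < s) (x : ℝ × ℝ) (j : ℤ) :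
    Summable fun n : ℤ => ‖wave N s x (j + N * n)‖ := by
  have hNr : (0 : ℝ) < N := by exact_mod_cast hN
  simp_rw [norm_wave_add_mul hN]
  exact summable_gauss (by have := Real.pi_pos; positivity) _

/-- The Fourier coefficients of the projector onto a coherent state. -/
def projCoeff (N : ℕ) (s : ℝ) (x : ℝ × ℝ) (k : ℤ × ℤ) : ℂ :=
  ((1 / N * Real.exp (-qform N s k) : ℝ) : ℂ) * expi (-(x.1 * k.2 - x.2 * k.1))

theorem norm_projCoeff (N : ℕ) (s : ℝ) (x : ℝ × ℝ) (k : ℤ × ℤ) :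
    ‖projCoeff N s x k‖ = 1 / N * Real.exp (-qform N s k) := by
  rw [projCoeff, norm_mul, norm_expi, mul_one, Complex.norm_real, Real.norm_of_nonneg (by positivity)]

theorem summable_exp_qform {N : ℕ} (hN : 0 < N) {s : ℝ} (hs : 0 < s) :
    Summable fun k => Real.exp (-qform N s k) := by
  have hNr : (0 : ℝ) < N := by exact_mod_cast hN
  have hπ := Real.pi_pos
  have h1 := summable_gauss (β := Real.pi / (2 * N) * s) (by positivity) 0
  have h2 := summable_gauss (β := Real.pi / (2 * N) / s) (by positivity) 0
  refine (h1.mul_of_nonneg h2 (fun _ => (Real.exp_pos _).le) fun _ => (Real.exp_pos _).le).congr ?_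
  intro k
  rw [← Real.exp_add, qform]
  congr 1
  ring

theorem summable_projCoeff {N : ℕ} (hN : 0 < N) {s : ℝ} (hs : 0 < s) (x : ℝ × ℝ) :
    Summable fun k => ‖projCoeff N s x k‖ := by
  simp_rw [norm_projCoeff]
  exact (summable_exp_qform hN hs).mul_left _

theorem transSum_projCoeff {N : ℕ} (hN : 0 < N) {s : ℝ} (hs : 0 < s) (x : ℝ × ℝ) :
    transSum N (projCoeff N s x)
      = Matrix.vecMulVec (coherent N s x) (star (coherent N s x)) := by
  have hNr : (0 : ℝ) < N := by exact_mod_cast hN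
  have hNz : (N : ℤ) ≠ 0 := by exact_mod_cast hN.ne'
  have hπ := Real.pi_pos
  ext m j
  rw [transSum_apply N (summable_projCoeff hN hs x), Matrix.vecMulVec_apply, Pi.star_apply,
    RCLike.star_def]
  have hinj : Function.Injective fun l : ℤ => ((m : ℕ) : ℤ) - (j : ℕ) + N * l := by
    intro a b hab
    have : (N : ℤ) * a = N * b := add_left_cancel hab
    exact mul_left_cancel₀ hNz this
  rw [← hinj.tsum_eq]
  swap
  · intro k hk
    rw [Function.mem_support] at hk
    have hmod : ((m : ℕ) : ℤ) ≡ (j : ℕ) + k [ZMOD N] := by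
      by_contra h; exact hk (if_neg h)
    obtain ⟨t, ht⟩ := hmod.dvd
    exact ⟨t, by simp only; linarith⟩
  have hmod (l : ℤ) : ((m : ℕ) : ℤ) ≡ (j : ℕ) + (((m : ℕ) : ℤ) - (j : ℕ) + N * l) [ZMOD N] := by
    rw [Int.modEq_iff_dvd]; exact ⟨l, by ring⟩
  simp_rw [if_pos (hmod _)]
  set γ : ℝ := Real.sqrt (Real.sqrt (2 * s / N)) with hγ
  have hγ2 : γ * γ = Real.sqrt (2 * s / N) := Real.mul_self_sqrt (Real.sqrt_nonneg _)
  have hγ3 : 1 / N * (1 / Real.sqrt (1 / (2 * N * s))) = γ * γ := by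
    rw [hγ2, Real.sqrt_div zero_le_one, Real.sqrt_one, one_div_one_div,
      show 2 * s / N = (2 * N * s) / N ^ 2 by field_simp, Real.sqrt_div (by positivity),
      Real.sqrt_sq hNr.le]
    ring
  let a : ℤ → ℂ := fun n => wave N s x ((m : ℕ) + N * n)
  let b : ℤ → ℂ := fun n => (starRingEnd ℂ) (wave N s x ((j : ℕ) + N * n))
  have ha : Summable fun n => ‖a n‖ := summable_wave_add_mul hN hs x _
  have hb : Summable fun n => ‖b n‖ := by
    simpa [b] using summable_wave_add_mul hN hs x ((j : ℕ) : ℤ)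
  -- Poisson summation in the second index
  have hrow (l : ℤ) : (∑' k₂ : ℤ, projCoeff N s x (((m : ℕ) : ℤ) - (j : ℕ) + N * l, k₂)
      * expi (k₂ * (((j : ℕ) + ((((m : ℕ) : ℤ) - (j : ℕ) + N * l : ℤ) : ℝ) / 2) / N)))
      = ((γ * γ : ℝ) : ℂ) * ∑' n : ℤ, a (l + n) * b n := by
    set k₁ : ℤ := ((m : ℕ) : ℤ) - (j : ℕ) + N * l with hk₁
    have hk₁r : (k₁ : ℝ) = (m : ℕ) - (j : ℕ) + N * l := by rw [hk₁]; push_cast; rfl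
    set y : ℝ := ((j : ℕ) + (k₁ : ℝ) / 2) / N - x.1 with hy
    have e1 (k₂ : ℤ) : projCoeff N s x (k₁, k₂) * expi (k₂ * (((j : ℕ) + (k₁ : ℝ) / 2) / N))
        = ((1 / N * Real.exp (-(Real.pi * s / (2 * N) * k₁ ^ 2)) : ℝ) * expi (x.2 * k₁)) *
          ((Real.exp (-(Real.pi * (1 / (2 * N * s)) * ((k₂ : ℝ) - 0) ^ 2)) : ℂ) * expi (y * k₂)) := by
      have : Real.exp (-qform N s (k₁, k₂)) = Real.exp (-(Real.pi * s / (2 * N) * k₁ ^ 2))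
          * Real.exp (-(Real.pi * (1 / (2 * N * s)) * ((k₂ : ℝ) - 0) ^ 2)) := by
        rw [← Real.exp_add, qform]; congr 1; field_simp; ring
      rw [projCoeff, this]
      simp only
      rw [mul_assoc, ← expi_add]
      have h2 : expi (-(x.1 * (k₂ : ℝ) - x.2 * k₁) + k₂ * (((j : ℕ) + (k₁ : ℝ) / 2) / N))
          = expi (x.2 * k₁) * expi (y * k₂) := by
        rw [← expi_add, hy]; congr 1; ring
      rw [h2]; push_cast; ring
    simp_rw [e1]
    rw [tsum_mul_left, tsum_gauss_poisson (by positivity), ← hγ3,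
      ← (Equiv.neg ℤ).tsum_eq fun n : ℤ =>
        (Real.exp (-(Real.pi / (1 / (2 * N * s)) * (n - y) ^ 2)) : ℂ) * expi (-(0 * (n - y)))]
    rw [← tsum_mul_left, ← tsum_mul_left, ← tsum_mul_left]
    congr 1; ext n
    simp only [a, b, wave, map_mul, Complex.conj_ofReal, conj_expi, Equiv.neg_apply]
    have h3 : expi (x.2 * ((((m : ℕ) : ℤ) + N * (l + n) : ℤ) : ℝ))
        * expi (-(x.2 * ((((j : ℕ) : ℤ) + N * n : ℤ) : ℝ))) = expi (x.2 * k₁) := by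
      rw [← expi_add, hk₁r]; congr 1; push_cast; ring
    have h4 : Real.exp (-(Real.pi * (s / N) * (((((m : ℕ) : ℤ) + N * (l + n) : ℤ) : ℝ) - N * x.1) ^ 2))
        * Real.exp (-(Real.pi * (s / N) * (((((j : ℕ) : ℤ) + N * n : ℤ) : ℝ) - N * x.1) ^ 2))
        = Real.exp (-(Real.pi * s / (2 * N) * k₁ ^ 2))
          * Real.exp (-(Real.pi / (1 / (2 * N * s)) * (((-n : ℤ) : ℝ) - y) ^ 2)) := by
      rw [← Real.exp_add, ← Real.exp_add, hy, hk₁r]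
      congr 1
      push_cast
      field_simp
      ring
    rw [zero_mul, neg_zero, expi_zero, mul_one, ← h3]
    have h4c := congrArg (fun t : ℝ => (t : ℂ)) h4
    simp only [Complex.ofReal_mul] at h4c
    push_cast at h4c ⊢
    linear_combination (-(1 / (N : ℂ) * (1 / (Real.sqrt (1 / (2 * N * s)) : ℂ)))
      * expi (x.2 * (((m : ℕ) : ℝ) + N * (l + n))) * expi (-(x.2 * (((j : ℕ) : ℝ) + N * n)))) * h4c
  simp_rw [hrow]
  rw [tsum_mul_left]
  have hab : Summable fun z : ℤ × ℤ => a (z.1 + z.2) * b z.2 := by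
    have h1 := summable_mul_of_summable_norm ha hb
    let e : ℤ × ℤ ≃ ℤ × ℤ :=
      { toFun := fun z => (z.1 + z.2, z.2), invFun := fun z => (z.1 - z.2, z.2),
        left_inv := fun z => by simp, right_inv := fun z => by simp }
    exact (e.summable_iff (f := fun z : ℤ × ℤ => a z.1 * b z.2)).mpr h1
  rw [← Summable.tsum_comm (f := fun l n => a (l + n) * b n) hab]
  simp_rw [tsum_mul_right]
  have hshift (n : ℤ) : ∑' l : ℤ, a (l + n) = ∑' l, a l := (Equiv.addRight n).tsum_eq a
  simp_rw [hshift]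
  rw [tsum_mul_left]
  simp only [coherent, map_mul, Complex.conj_ofReal, Complex.conj_tsum]
  push_cast
  ring

/-- The momentum representation of a coherent state. -/
def momWave (N : ℕ) (s : ℝ) (x : ℝ × ℝ) (y : ℝ) : ℂ :=
  (Real.exp (-(Real.pi * (N / s) * (y - x.2) ^ 2)) : ℂ) * expi (-(N * x.1 * (y - x.2)))

theorem sum_tsum_residue {N : ℕ} (hN : 0 < N) {F : ℤ → ℂ} (hF : Summable F) :
    ∑ j : Fin N, ∑' n : ℤ, F ((j : ℕ) + N * n) = ∑' n : ℤ, F n := by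
  have : NeZero N := ⟨hN.ne'⟩
  have he (n : ℤ) (j : Fin N) : (Int.divModEquiv N).symm (n, j) = (j : ℕ) + N * n := by
    rw [add_comm, mul_comm]; rfl
  have hF' : Summable fun z : ℤ × Fin N => F ((Int.divModEquiv N).symm z) :=
    (Int.divModEquiv N).symm.summable_iff.mpr hF
  rw [← (Int.divModEquiv N).symm.tsum_eq, hF'.tsum_prod]
  simp_rw [tsum_fintype, he]
  rw [Summable.tsum_finsetSum]
  intro j _
  have := hF'.comp_injective (Prod.mk_left_injective j)
  simpa only [Function.comp_def, he] using this

theorem dft_mulVec_coherent {N : ℕ} (hN : 0 < N) {s : ℝ} (hs : 0 < s) (x : ℝ × ℝ) (l : ℤ) :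
    ((1 / Real.sqrt N : ℝ) : ℂ) * ∑ j : Fin N, expi (-(l * (j : ℕ) / N)) * coherent N s x j
      = ((Real.sqrt (Real.sqrt (2 / (N * s))) : ℝ) : ℂ) * ∑' n : ℤ, momWave N s x (l / N + n) := by
  have hNr : (0 : ℝ) < N := by exact_mod_cast hN
  have e1 (j : Fin N) (n : ℤ) : expi (-(l * (j : ℕ) / N)) * wave N s x ((j : ℕ) + N * n)
      = expi (-(l * (((j : ℕ) + N * n : ℤ) : ℝ) / N)) * wave N s x ((j : ℕ) + N * n) := by
    congr 1
    refine expi_eq_of_sub_int (l * n) ?_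
    push_cast; field_simp; ring
  have hw : Summable fun n : ℤ => expi (-(l * n / N)) * wave N s x n := by
    refine Summable.of_norm ?_
    simpa [norm_expi] using summable_wave hN hs x
  have h2 : ∑ j : Fin N, ∑' n : ℤ, expi (-(l * (j : ℕ) / N)) * wave N s x ((j : ℕ) + N * n)
      = ∑' n : ℤ, expi (-(l * n / N)) * wave N s x n := by
    simp_rw [e1]
    exact sum_tsum_residue hN hw
  have h3 : ∑' n : ℤ, expi (-(l * n / N)) * wave N s x n
      = ∑' n : ℤ, (Real.exp (-(Real.pi * (s / N) * (n - N * x.1) ^ 2)) : ℂ)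
        * expi ((x.2 - l / N) * n) := by
    congr 1; ext n
    rw [wave, mul_left_comm, ← expi_add]
    congr 2; ring
  simp only [coherent]
  simp_rw [mul_left_comm (expi _), ← Finset.mul_sum, ← tsum_mul_left]
  rw [h2, h3, tsum_gauss_poisson (by positivity), ← mul_assoc, ← mul_assoc]
  have hconst : 1 / Real.sqrt N * Real.sqrt (Real.sqrt (2 * s / N)) * (1 / Real.sqrt (s / N))
      = Real.sqrt (Real.sqrt (2 / (N * s))) := by
    have h1 : Real.sqrt (2 * s / N) = Real.sqrt (2 / (N * s)) * s := by
      rw [show 2 * s / N = 2 / (N * s) * s ^ 2 by field_simp, Real.sqrt_mul (by positivity),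
        Real.sqrt_sq hs.le]
    have hsN : Real.sqrt s ≠ 0 := (Real.sqrt_pos.mpr hs).ne'
    have hNN : Real.sqrt N ≠ 0 := (Real.sqrt_pos.mpr hNr).ne'
    rw [h1, Real.sqrt_mul (Real.sqrt_nonneg _), Real.sqrt_div hs.le]
    field_simp
  rw [← hconst, Complex.ofReal_mul, Complex.ofReal_mul]
  rw [← tsum_mul_left]
  refine tsum_congr fun n => ?_
  rw [momWave]
  congr 1
  congr 2
  · congr 2; field_simp; ring
  · congr 1; ring


/-! ### One step of the quantised baker's map on coherent states -/

theorem bakerMix_apply {N : ℕ} (hev : Even N) (hN : 0 < N) (l j : Fin N) :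
    bakerMix N l j = if ((l : ℕ) < N / 2 ↔ (j : ℕ) < N / 2) then
      ((Real.sqrt 2 : ℝ) : ℂ) * (((1 / Real.sqrt N : ℝ) : ℂ)
        * expi (-((2 * (l : ℕ) : ℤ) * (j : ℕ) / N))) else 0 := by
  obtain ⟨m, rfl⟩ := hev
  have hm : 0 < m := by omega
  have hmr : (0 : ℝ) < m := by exact_mod_cast hm
  have hdiv : (m + m) / 2 = m := by omega
  have hconst : 1 / Real.sqrt m = Real.sqrt 2 * (1 / Real.sqrt ((m + m : ℕ) : ℝ)) := by
    have : ((m + m : ℕ) : ℝ) = 2 * m := by push_cast; ring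
    have h2 : Real.sqrt 2 ≠ 0 := by positivity
    have h3 : Real.sqrt m ≠ 0 := by positivity
    rw [this, Real.sqrt_mul (by norm_num)]; field_simp
  simp only [bakerMix, Matrix.of_apply, hdiv, dftEntry_eq, hconst]
  by_cases hl : (l : ℕ) < m <;> by_cases hj : (j : ℕ) < m
  · rw [if_pos ⟨hl, hj⟩, if_pos (by tauto), Complex.ofReal_mul, mul_assoc]
    congr 3; push_cast; field_simp; ring
  · rw [if_neg (by tauto), if_neg (by omega), if_neg (by tauto)]
  · rw [if_neg (by tauto), if_neg (by omega), if_neg (by tauto)]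
  · rw [if_neg (by tauto), if_pos (by omega), if_pos (by tauto), Complex.ofReal_mul, mul_assoc]
    congr 2
    refine expi_eq_of_sub_int (l + j - m) ?_
    rw [Nat.cast_sub (not_lt.mp hl), Nat.cast_sub (not_lt.mp hj)]
    push_cast; field_simp; ring

theorem hasSum_int_even_add_odd {f : ℤ → ℂ} {a b : ℂ} (he : HasSum (fun n : ℤ => f (2 * n)) a)
    (ho : HasSum (fun n : ℤ => f (2 * n + 1)) b) : HasSum f (a + b) := by
  have he' : Function.Injective fun n : ℤ => 2 * n := fun m n h => by simpa using h
  have ho' : Function.Injective fun n : ℤ => 2 * n + 1 := fun m n h => by simpa using h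
  refine (he'.hasSum_range_iff.mpr he).add_isCompl ?_ (ho'.hasSum_range_iff.mpr ho)
  have h1 : (Set.range fun n : ℤ => 2 * n) = {n | Even n} := by
    ext n; simp [even_iff_exists_two_mul]
  have h2 : (Set.range fun n : ℤ => 2 * n + 1) = {n | Odd n} := by
    ext n; simp [Odd]
  rw [h1, h2]
  exact Int.isCompl_even_odd

theorem norm_momWave (N : ℕ) (s : ℝ) (x : ℝ × ℝ) (y : ℝ) :
    ‖momWave N s x y‖ = Real.exp (-(Real.pi * (N / s) * (y - x.2) ^ 2)) := by
  rw [momWave, norm_mul, norm_expi, mul_one, Complex.norm_real, Real.norm_of_nonneg (Real.exp_pos _).le]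

theorem summable_momWave {N : ℕ} (hN : 0 < N) {s : ℝ} (hs : 0 < s) (x : ℝ × ℝ) (y : ℝ) :
    Summable fun n : ℤ => ‖momWave N s x (y + n)‖ := by
  have hNr : (0 : ℝ) < N := by exact_mod_cast hN
  have := Real.pi_pos
  simp_rw [norm_momWave]
  refine (summable_gauss (β := Real.pi * (N / s)) (by positivity) (y - x.2)).congr fun n => ?_
  congr 2; ring

theorem tsum_momWave_parity {N : ℕ} (hN : 0 < N) {s : ℝ} (hs : 0 < s) (x : ℝ × ℝ) (y : ℝ) (b : ℤ) :
    ∑' n : ℤ, momWave N s x (y + n) = (∑' n : ℤ, momWave N s x (y - b + 2 * n))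
      + ∑' n : ℤ, momWave N s x (y - b + (1 : ℤ) + 2 * n) := by
  have hsum := (summable_momWave hN hs x (y - b)).of_norm
  have h2 : Summable fun n : ℤ => momWave N s x (y - b + ((2 * n : ℤ) : ℝ)) :=
    hsum.comp_injective (i := fun n : ℤ => 2 * n) (fun a b h => by simpa using h)
  have h3 : Summable fun n : ℤ => momWave N s x (y - b + ((2 * n + 1 : ℤ) : ℝ)) :=
    hsum.comp_injective (i := fun n : ℤ => 2 * n + 1) (fun a b h => by simpa using h)
  have h4 := (hasSum_int_even_add_odd (f := fun n : ℤ => momWave N s x (y - b + n))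
    h2.hasSum h3.hasSum).tsum_eq
  have h5 := (Equiv.addRight b).tsum_eq fun n : ℤ => momWave N s x (y - b + n)
  have e1 (n : ℤ) : y - b + ((Equiv.addRight b n : ℤ) : ℝ) = y + n := by
    rw [Equiv.coe_addRight]; push_cast; ring
  have e2 (n : ℤ) : y - b + ((2 * n : ℤ) : ℝ) = y - b + 2 * n := by push_cast; ring
  have e3 (n : ℤ) : y - b + ((2 * n + 1 : ℤ) : ℝ) = y - b + (1 : ℤ) + 2 * n := by push_cast; ring
  simp_rw [e1] at h5
  simp_rw [e2, e3] at h4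
  rw [h5, h4]

theorem norm_tsum_momWave_two_le {N : ℕ} (hN : 0 < N) {s : ℝ} (hs : 0 < s) (hsN : s ≤ N)
    {x : ℝ × ℝ} {y d : ℝ} (hd : 0 ≤ d) (h : ∀ n : ℤ, d ≤ |y + 2 * n - x.2|) :
    ‖∑' n : ℤ, momWave N s x (y + 2 * n)‖ ≤ 30 * Real.exp (-(Real.pi / 2 * (N / s) * d ^ 2)) := by
  have hNr : (0 : ℝ) < N := by exact_mod_cast hN
  have hπ := Real.pi_gt_three
  have h1 : 1 ≤ N / s := by rw [le_div_iff₀ hs]; linarith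
  have e (n : ℤ) : ‖momWave N s x (y + 2 * n)‖
      = Real.exp (-(4 * Real.pi * (N / s) * (n + (y - x.2) / 2) ^ 2)) := by
    rw [norm_momWave]; congr 1; ring
  have hsum := summable_gauss (β := 4 * Real.pi * (N / s)) (by positivity) ((y - x.2) / 2)
  have hb := tsum_gauss_tail_le (β := 4 * Real.pi * (N / s)) (d := d / 2) (y := (y - x.2) / 2)
    (by nlinarith) (by positivity) (fun n => by
      have h2 := h n
      rw [show y + 2 * (n : ℝ) - x.2 = 2 * (n + (y - x.2) / 2) by ring, abs_mul, abs_two] at h2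
      linarith)
  refine (norm_tsum_le_tsum_norm (by simpa only [e] using hsum)).trans ?_
  simp_rw [e]
  refine hb.trans (le_of_eq ?_)
  congr 2; ring

theorem norm_coherent_le {N : ℕ} (hN : 0 < N) {s : ℝ} (hs : 0 < s) (hsN : s ≤ N) (h1 : 1 ≤ N * s)
    (x : ℝ × ℝ) (j : Fin N) : ‖coherent N s x j‖ ≤ 45 := by
  have hNr : (0 : ℝ) < N := by exact_mod_cast hN
  have hπ := Real.pi_gt_three
  have hc : Real.sqrt (Real.sqrt (2 * s / N)) ≤ 3 / 2 := by
    rw [Real.sqrt_le_left (by norm_num), Real.sqrt_le_left (by norm_num), div_le_iff₀ hNr]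
    nlinarith
  rw [coherent, norm_mul, Complex.norm_real, Real.norm_of_nonneg (Real.sqrt_nonneg _)]
  have hsum : ‖∑' n : ℤ, wave N s x ((j : ℕ) + N * n)‖ ≤ 30 := by
    refine (norm_tsum_le_tsum_norm (summable_wave_add_mul hN hs x _)).trans ?_
    simp_rw [norm_wave_add_mul hN]
    exact tsum_gauss_le (by nlinarith) _
  calc _ ≤ 3 / 2 * 30 := mul_le_mul hc hsum (norm_nonneg _) (by norm_num)
    _ = 45 := by norm_num

theorem norm_coherent_tail_le {N : ℕ} (hN : 0 < N) {s : ℝ} (hs : 0 < s) (hsN : s ≤ N)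
    (h1 : 1 ≤ N * s) {x : ℝ × ℝ} {j : Fin N} {d : ℝ} (hd : 0 ≤ d)
    (h : ∀ n : ℤ, d ≤ |(n : ℝ) + ((j : ℕ) / N - x.1)|) :
    ‖coherent N s x j‖ ≤ 45 * Real.exp (-(Real.pi / 2 * (N * s) * d ^ 2)) := by
  have hNr : (0 : ℝ) < N := by exact_mod_cast hN
  have hπ := Real.pi_gt_three
  have hc : Real.sqrt (Real.sqrt (2 * s / N)) ≤ 3 / 2 := by
    rw [Real.sqrt_le_left (by norm_num), Real.sqrt_le_left (by norm_num), div_le_iff₀ hNr]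
    nlinarith
  rw [coherent, norm_mul, Complex.norm_real, Real.norm_of_nonneg (Real.sqrt_nonneg _)]
  have hsum : ‖∑' n : ℤ, wave N s x ((j : ℕ) + N * n)‖
      ≤ 30 * Real.exp (-(Real.pi / 2 * (N * s) * d ^ 2)) := by
    refine (norm_tsum_le_tsum_norm (summable_wave_add_mul hN hs x _)).trans ?_
    simp_rw [norm_wave_add_mul hN]
    refine (tsum_gauss_tail_le (by nlinarith) hd fun n => by
      rw [Int.cast_natCast]; exact h n).trans (le_of_eq ?_)
    congr 2; ring
  calc _ ≤ 3 / 2 * (30 * Real.exp (-(Real.pi / 2 * (N * s) * d ^ 2))) :=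
        mul_le_mul hc hsum (norm_nonneg _) (by norm_num)
    _ = _ := by ring

theorem momWave_quarter {N : ℕ} {s : ℝ} (hs : 0 < s) (q p : ℝ) (b l n : ℤ) (hN : 0 < N) :
    momWave N (s / 4) (2 * q - b, (p + b) / 2) (l / N + n)
      = expi (-(N * b * (p + b) / 2)) * momWave N s (q, p) (2 * l / N - b + 2 * n) := by
  have hNr : (N : ℝ) ≠ 0 := by exact_mod_cast hN.ne'
  simp only [momWave]
  rw [mul_left_comm, ← expi_add]
  congr 1
  · congr 2; field_simp; ring
  · refine expi_eq_of_sub_int (b * l + N * b * n) ?_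
    push_cast; field_simp; ring

theorem sqrt_sqrt_quarter {N : ℕ} (s : ℝ) :
    Real.sqrt (Real.sqrt (2 / (N * (s / 4)))) = Real.sqrt 2 * Real.sqrt (Real.sqrt (2 / (N * s))) := by
  rw [show 2 / ((N : ℝ) * (s / 4)) = 2 ^ 2 * (2 / (N * s)) by
    rw [show (N : ℝ) * (s / 4) = N * s / 4 by ring, div_div_eq_mul_div]; ring,
    Real.sqrt_mul (by positivity), Real.sqrt_sq (by norm_num), Real.sqrt_mul (by norm_num)]

set_option maxHeartbeats 400000 in
theorem norm_bakerMix_coherent_sub_le {N : ℕ} (hev : Even N) (hN : 0 < N) {s : ℝ} (hs : 0 < s)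
    (hsN : s ≤ N) (h1 : 1 ≤ N * s) {q p d₁ d₂ Λ : ℝ} {b : ℤ} (hb : b = 0 ∨ b = 1)
    (hd₁ : 0 ≤ d₁) (hd₂ : 0 ≤ d₂) (hq : (b : ℝ) / 2 + d₁ ≤ q) (hq' : q ≤ ((b : ℝ) + 1) / 2 - d₁)
    (hp : d₂ ≤ p) (hp' : p ≤ 1 - d₂) (hΛ₁ : Λ ≤ Real.pi / 2 * (N * s) * d₁ ^ 2)
    (hΛ₂ : Λ ≤ Real.pi / 2 * (N / s) * d₂ ^ 2) (l : Fin N) :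
    ‖(bakerMix N).mulVec (coherent N s (q, p)) l
      - expi (N * b * (p + b) / 2)
        * (dft N).mulVec (coherent N (s / 4) (2 * q - b, (p + b) / 2)) l‖
      ≤ 160 * Real.sqrt N * Real.exp (-Λ) := by
  have hNr : (0 : ℝ) < N := by exact_mod_cast hN
  have hN1 : (1 : ℝ) ≤ N := by exact_mod_cast hN
  set c : ℝ := Real.sqrt (Real.sqrt (2 / (N * s))) with hc
  have hc2 : c ≤ 3 / 2 := by
    rw [hc, Real.sqrt_le_left (by norm_num), Real.sqrt_le_left (by norm_num),
      div_le_iff₀ (by positivity)]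
    nlinarith
  have hc0 : 0 ≤ c := Real.sqrt_nonneg _
  have hsqrt2 : Real.sqrt 2 ≤ 3 / 2 := by rw [Real.sqrt_le_left (by norm_num)]; norm_num
  have hsqrt20 : 0 ≤ Real.sqrt 2 := Real.sqrt_nonneg _
  have hE := Real.exp_pos (-Λ)
  -- the image coherent state in the momentum representation
  have htarget : expi (N * b * (p + b) / 2)
        * (dft N).mulVec (coherent N (s / 4) (2 * q - b, (p + b) / 2)) l
      = ((Real.sqrt 2 * c : ℝ) : ℂ) * ∑' n : ℤ, momWave N s (q, p) (2 * (l : ℕ) / N - b + 2 * n) := by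
    have h := dft_mulVec_coherent hN (show 0 < s / 4 by positivity)
      (2 * q - b, (p + b) / 2) (l : ℕ)
    have h2 : (dft N).mulVec (coherent N (s / 4) (2 * q - b, (p + b) / 2)) l
        = ((1 / Real.sqrt N : ℝ) : ℂ) * ∑ j : Fin N, expi (-(((l : ℕ) : ℤ) * (j : ℕ) / N))
          * coherent N (s / 4) (2 * q - b, (p + b) / 2) j := by
      rw [Matrix.mulVec, dotProduct, Finset.mul_sum]
      refine Finset.sum_congr rfl fun j _ => ?_
      rw [dft_apply, mul_assoc]; push_cast; rfl
    rw [h2, h, sqrt_sqrt_quarter, ← hc]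
    simp_rw [momWave_quarter hs _ _ _ _ _ hN]
    rw [tsum_mul_left, mul_left_comm (((Real.sqrt 2 * c : ℝ) : ℂ)), ← mul_assoc (expi _),
      ← expi_add, add_neg_cancel, expi_zero, one_mul]
    push_cast
    rfl
  -- the contribution of the other half of the position axis
  set T : ℂ := ((1 / Real.sqrt N : ℝ) : ℂ) * ∑ j : Fin N,
    if ((j : ℕ) < N / 2 ↔ b = 0) then 0 else
      expi (-((2 * (l : ℕ) : ℤ) * (j : ℕ) / N)) * coherent N s (q, p) j with hT
  have hTn : ‖T‖ ≤ 45 * Real.sqrt N * Real.exp (-Λ) := by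
    rw [hT, norm_mul, Complex.norm_real, Real.norm_of_nonneg (by positivity)]
    have hsum : ‖∑ j : Fin N, if ((j : ℕ) < N / 2 ↔ b = 0) then 0 else
        expi (-((2 * (l : ℕ) : ℤ) * (j : ℕ) / N)) * coherent N s (q, p) j‖
        ≤ N * (45 * Real.exp (-Λ)) := by
      refine (norm_sum_le_of_le Finset.univ (f := _) (n := fun _ => 45 * Real.exp (-Λ))
        fun j _ => ?_).trans (by simp)
      split_ifs with hj
      · simp only [norm_zero]; positivity
      · rw [norm_mul, norm_expi, one_mul]
        refine (norm_coherent_tail_le hN hs hsN h1 hd₁ (fun n => ?_)).trans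
          (mul_le_mul_of_nonneg_left (Real.exp_le_exp.mpr (by linarith)) (by norm_num))
        obtain ⟨m, rfl⟩ := hev
        have hjlt : ((j : ℕ) : ℝ) < ((m + m : ℕ) : ℝ) := by exact_mod_cast j.2
        have hj1 : ((j : ℕ) : ℝ) / ((m + m : ℕ) : ℝ) < 1 := (div_lt_one hNr).mpr hjlt
        have hj0 : (0 : ℝ) ≤ ((j : ℕ) : ℝ) / ((m + m : ℕ) : ℝ) := by positivity
        have hmm : (m + m) / 2 = m := by omega
        rw [hmm] at hj
        simp only
        rcases hb with rfl | rfl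
        · have hjm : m ≤ (j : ℕ) := by omega
          have hj2 : 1 / 2 ≤ ((j : ℕ) : ℝ) / ((m + m : ℕ) : ℝ) := by
            rw [le_div_iff₀ hNr]
            have : (m : ℝ) ≤ (j : ℕ) := by exact_mod_cast hjm
            push_cast; linarith
          push_cast at hq hq' hj1 hj2 ⊢
          rcases le_or_gt 0 n with hn | hn
          · have : (0 : ℝ) ≤ n := by exact_mod_cast hn
            rw [le_abs]; left; linarith
          · have : (n : ℝ) ≤ -1 := by exact_mod_cast (by omega : n ≤ -1)
            rw [le_abs]; right; linarith
        · have hjm : (j : ℕ) < m := by omega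
          have hj2 : ((j : ℕ) : ℝ) / ((m + m : ℕ) : ℝ) ≤ 1 / 2 := by
            rw [div_le_iff₀ hNr]
            have : ((j : ℕ) : ℝ) ≤ m := by exact_mod_cast hjm.le
            push_cast; linarith
          push_cast at hq hq' hj0 hj2 ⊢
          rcases le_or_gt 1 n with hn | hn
          · have : (1 : ℝ) ≤ n := by exact_mod_cast hn
            rw [le_abs]; left; linarith
          · have : (n : ℝ) ≤ 0 := by exact_mod_cast (by omega : n ≤ 0)
            rw [le_abs]; right; linarith
    calc 1 / Real.sqrt N * _ ≤ 1 / Real.sqrt N * (N * (45 * Real.exp (-Λ))) :=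
          mul_le_mul_of_nonneg_left hsum (by positivity)
      _ = _ := by
        have h0 : Real.sqrt N ≠ 0 := by positivity
        have h3 : Real.sqrt N * Real.sqrt N = N := Real.mul_self_sqrt hNr.le
        field_simp; linear_combination -h3
  -- Gaussian tails in momentum
  have hmom (y₀ : ℝ) (hy : (0 ≤ y₀ ∧ y₀ < 1)) (t : ℤ) (ht : Odd t) :
      ‖∑' n : ℤ, momWave N s (q, p) (y₀ + t + 2 * n)‖ ≤ 30 * Real.exp (-Λ) := by
    refine (norm_tsum_momWave_two_le hN hs hsN hd₂ (fun n => ?_)).trans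
      (mul_le_mul_of_nonneg_left (Real.exp_le_exp.mpr (by linarith)) (by norm_num))
    obtain ⟨u, rfl⟩ := ht
    simp only
    push_cast
    rcases le_or_gt 0 (u + n) with hn | hn
    · have : (0 : ℝ) ≤ u + n := by exact_mod_cast hn
      rw [le_abs]; left; linarith
    · have : (u : ℝ) + n ≤ -1 := by exact_mod_cast (by omega : u + n ≤ -1)
      rw [le_abs]; right; linarith
  have hfin {z : ℂ} (hz : ‖z‖ ≤ 30 * Real.exp (-Λ)) {w : ℂ}
      (hw : w = ((Real.sqrt 2 : ℝ) : ℂ) * T - ((Real.sqrt 2 * c : ℝ) : ℂ) * z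
        ∨ w = ((Real.sqrt 2 * c : ℝ) : ℂ) * z - ((Real.sqrt 2 : ℝ) : ℂ) * T) :
      ‖w‖ ≤ 160 * Real.sqrt N * Real.exp (-Λ) := by
    have hw' : ‖w‖ ≤ Real.sqrt 2 * ‖T‖ + Real.sqrt 2 * c * ‖z‖ := by
      have e1 : ‖((Real.sqrt 2 : ℝ) : ℂ) * T‖ = Real.sqrt 2 * ‖T‖ := by
        rw [norm_mul, Complex.norm_real, Real.norm_of_nonneg hsqrt20]
      have e2 : ‖((Real.sqrt 2 * c : ℝ) : ℂ) * z‖ = Real.sqrt 2 * c * ‖z‖ := by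
        rw [norm_mul, Complex.norm_real, Real.norm_of_nonneg (by positivity)]
      rw [← e1, ← e2]
      rcases hw with rfl | rfl
      · exact norm_sub_le _ _
      · rw [add_comm]; exact norm_sub_le _ _
    have hsN1 : 1 ≤ Real.sqrt N := Real.one_le_sqrt.mpr hN1
    have a1 : Real.sqrt 2 * ‖T‖ ≤ 3 / 2 * (45 * Real.sqrt N * Real.exp (-Λ)) :=
      mul_le_mul hsqrt2 hTn (norm_nonneg _) (by norm_num)
    have a2 : Real.sqrt 2 * c * ‖z‖ ≤ (3 / 2 * (3 / 2)) * (30 * Real.exp (-Λ)) :=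
      mul_le_mul (mul_le_mul hsqrt2 hc2 hc0 (by norm_num)) hz (norm_nonneg _) (by norm_num)
    nlinarith [mul_le_mul_of_nonneg_right hsN1 hE.le]
  rw [htarget]
  have hmix : (bakerMix N).mulVec (coherent N s (q, p)) l
      = ((Real.sqrt 2 : ℝ) : ℂ) * (((1 / Real.sqrt N : ℝ) : ℂ) * ∑ j : Fin N,
        if ((l : ℕ) < N / 2 ↔ (j : ℕ) < N / 2) then
          expi (-((2 * (l : ℕ) : ℤ) * (j : ℕ) / N)) * coherent N s (q, p) j else 0) := by
    rw [Matrix.mulVec, dotProduct, Finset.mul_sum, Finset.mul_sum]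
    refine Finset.sum_congr rfl fun j _ => ?_
    rw [bakerMix_apply hev hN]
    split_ifs <;> ring
  rw [hmix]
  have hl1 : ((l : ℕ) : ℝ) / N < 1 := (div_lt_one hNr).mpr (by exact_mod_cast l.2)
  have hl0 : (0 : ℝ) ≤ ((l : ℕ) : ℝ) / N := by positivity
  have hlhalf : ((l : ℕ) < N / 2) ↔ ((l : ℕ) : ℝ) / N < 1 / 2 := by
    obtain ⟨m, rfl⟩ := hev
    rw [div_lt_iff₀ hNr, show (m + m) / 2 = m by omega]
    push_cast
    rw [show 1 / 2 * ((m : ℝ) + m) = m by ring]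
    exact_mod_cast Iff.rfl
  by_cases hlb : ((l : ℕ) < N / 2 ↔ b = 0)
  · -- `l` lies in the half reached by the packet
    refine hfin (hmom (2 * ((l : ℕ) : ℝ) / N - b) ?_ 1 odd_one) (Or.inr ?_)
    · rw [mul_div_assoc]
      rcases hb with rfl | rfl
      · have := hlhalf.mp (hlb.mpr rfl)
        push_cast; constructor <;> linarith
      · have : ¬ ((l : ℕ) : ℝ) / N < 1 / 2 := fun h => by
          have := hlb.mp (hlhalf.mpr h); omega
        push_cast; constructor <;> linarith
    · have hfull := dft_mulVec_coherent hN hs (q, p) (2 * (l : ℕ))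
      rw [← hc] at hfull
      have hsplit : ∑ j : Fin N, expi (-(((2 * (l : ℕ) : ℤ) : ℝ) * (j : ℕ) / N)) * coherent N s (q, p) j
          = (∑ j : Fin N, if ((l : ℕ) < N / 2 ↔ (j : ℕ) < N / 2) then
            expi (-((2 * (l : ℕ) : ℤ) * (j : ℕ) / N)) * coherent N s (q, p) j else 0)
            + ∑ j : Fin N, if ((j : ℕ) < N / 2 ↔ b = 0) then 0 else
              expi (-((2 * (l : ℕ) : ℤ) * (j : ℕ) / N)) * coherent N s (q, p) j := by
        rw [← Finset.sum_add_distrib]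
        refine Finset.sum_congr rfl fun j _ => ?_
        by_cases hj : ((j : ℕ) < N / 2 ↔ b = 0)
        · rw [if_pos (by tauto), if_pos hj, add_zero]
        · rw [if_neg (by tauto), if_neg hj, zero_add]
      rw [hsplit, mul_add, ← hT] at hfull
      have hpar := tsum_momWave_parity hN hs (q, p) (2 * ((l : ℕ) : ℝ) / N) b
      have hcast : ((2 * (l : ℕ) : ℤ) : ℝ) / N = 2 * ((l : ℕ) : ℝ) / N := by push_cast; rfl
      rw [hcast, hpar] at hfull
      push_cast at hfull ⊢
      linear_combination (Real.sqrt 2 : ℂ) * hfull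
  · refine hfin (hmom (2 * ((l : ℕ) : ℝ) / N - (1 - b)) ?_ (1 - 2 * b) ⟨-b, by ring⟩) (Or.inl ?_)
    · rw [mul_div_assoc]
      rcases hb with rfl | rfl
      · have : ¬ ((l : ℕ) : ℝ) / N < 1 / 2 := fun h => hlb ⟨fun _ => rfl, fun _ => hlhalf.mpr h⟩
        push_cast; constructor <;> linarith
      · have : ((l : ℕ) : ℝ) / N < 1 / 2 := by
          by_contra h
          exact hlb ⟨fun h' => absurd (hlhalf.mp h') h, fun h' => by omega⟩
        push_cast; constructor <;> linarith
    · congr 1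
      · rw [hT]; congr 2
        refine Finset.sum_congr rfl fun j _ => ?_
        by_cases hj : ((j : ℕ) < N / 2 ↔ b = 0)
        · rw [if_neg (by tauto), if_pos hj]
        · rw [if_pos (by tauto), if_neg hj]
      · congr 1
        refine tsum_congr fun n => ?_
        congr 1; push_cast; ring


/-! ### Iterating the quantised baker's map on coherent states -/

section Iterate
open scoped Matrix.Norms.L2Operator

theorem norm_col_le {N : ℕ} {V : Matrix (Fin N) (Fin 1) ℂ} {b : ℝ} (hb : 0 ≤ b)
    (h : ∀ j, ‖V j 0‖ ≤ b) : ‖V‖ ≤ Real.sqrt N * b := by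
  have key : V.conjTranspose * V = Matrix.diagonal fun _ => ((∑ j, ‖V j 0‖ ^ 2 : ℝ) : ℂ) := by
    ext i k
    rw [Subsingleton.elim i 0, Subsingleton.elim k 0, Matrix.mul_apply, Matrix.diagonal_apply_eq]
    push_cast
    refine Finset.sum_congr rfl fun j _ => ?_
    rw [Matrix.conjTranspose_apply, RCLike.star_def, Complex.conj_mul']
  have h2 : ‖V‖ * ‖V‖ ≤ (Real.sqrt N * b) * (Real.sqrt N * b) := by
    rw [← Matrix.l2_opNorm_conjTranspose_mul_self, key, Matrix.l2_opNorm_diagonal,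
      pi_norm_le_iff_of_nonneg (by positivity)]
    intro _
    rw [Complex.norm_real, Real.norm_of_nonneg (by positivity), mul_mul_mul_comm,
      Real.mul_self_sqrt (Nat.cast_nonneg _)]
    refine (Finset.sum_le_sum fun j _ => pow_le_pow_left₀ (norm_nonneg _) (h j) 2).trans ?_
    simp [sq]
  exact abs_le_of_sq_le_sq' (by rwa [pow_two, pow_two]) (by positivity) |>.2

theorem norm_le_one_of_unitary {N : ℕ} {U : Matrix (Fin N) (Fin N) ℂ}
    (hU : U ∈ unitary (Matrix (Fin N) (Fin N) ℂ)) : ‖U‖ ≤ 1 := by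
  rcases isEmpty_or_nonempty (Fin N) with h | h
  · rw [Subsingleton.elim U 0, norm_zero]; exact zero_le_one
  · exact (CStarRing.norm_of_mem_unitary hU).le

theorem norm_unitary_mul_le {N : ℕ} {U : Matrix (Fin N) (Fin N) ℂ}
    (hU : U ∈ unitary (Matrix (Fin N) (Fin N) ℂ)) (V : Matrix (Fin N) (Fin 1) ℂ) :
    ‖U * V‖ ≤ ‖V‖ :=
  (Matrix.l2_opNorm_mul U V).trans
    (mul_le_of_le_one_left (norm_nonneg _) (norm_le_one_of_unitary hU))

/-- A coherent state as a column. -/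
def cohCol (N : ℕ) (s : ℝ) (x : ℝ × ℝ) : Matrix (Fin N) (Fin 1) ℂ :=
  Matrix.replicateCol (Fin 1) (coherent N s x)

theorem norm_cohCol_le {N : ℕ} (hN : 0 < N) {s : ℝ} (hs : 0 < s) (hsN : s ≤ N) (h1 : 1 ≤ N * s)
    (x : ℝ × ℝ) : ‖cohCol N s x‖ ≤ Real.sqrt N * 45 :=
  norm_col_le (by norm_num) fun j => norm_coherent_le hN hs hsN h1 x j

theorem transSum_projCoeff_eq_cohCol {N : ℕ} (hN : 0 < N) {s : ℝ} (hs : 0 < s) (x : ℝ × ℝ) :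
    transSum N (projCoeff N s x) = cohCol N s x * (cohCol N s x).conjTranspose := by
  rw [transSum_projCoeff hN hs, cohCol, Matrix.vecMulVec_eq (Fin 1), Matrix.conjTranspose_replicateCol]
  rfl

theorem norm_quantumBaker_step_le {N : ℕ} (hev : Even N) (hN : 0 < N) {s : ℝ} (hs : 0 < s)
    (hsN : s ≤ N) (h1 : 1 ≤ N * s) {q p d₁ d₂ Λ : ℝ} {b : ℤ} (hb : b = 0 ∨ b = 1)
    (hd₁ : 0 ≤ d₁) (hd₂ : 0 ≤ d₂) (hq : (b : ℝ) / 2 + d₁ ≤ q) (hq' : q ≤ ((b : ℝ) + 1) / 2 - d₁)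
    (hp : d₂ ≤ p) (hp' : p ≤ 1 - d₂) (hΛ₁ : Λ ≤ Real.pi / 2 * (N * s) * d₁ ^ 2)
    (hΛ₂ : Λ ≤ Real.pi / 2 * (N / s) * d₂ ^ 2) :
    ‖quantumBaker N * cohCol N s (q, p)
      - expi (N * b * (p + b) / 2) • cohCol N (s / 4) (2 * q - b, (p + b) / 2)‖
      ≤ 160 * N * Real.exp (-Λ) := by
  set θ := expi (N * b * (p + b) / 2)
  set W := quantumBaker N * cohCol N s (q, p)
      - θ • cohCol N (s / 4) (2 * q - b, (p + b) / 2) with hW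
  have hF := dft_mem_unitary hN
  have e1 : star (dft N) * (dft N * W) = W := by
    rw [← Matrix.mul_assoc, Unitary.star_mul_self_of_mem hF, Matrix.one_mul]
  have e2 : ‖W‖ ≤ ‖dft N * W‖ := by
    rw [← e1]
    refine (norm_unitary_mul_le (Unitary.star_mem hF) _).trans ?_
    rw [e1]
  refine e2.trans ((norm_col_le (b := 160 * Real.sqrt N * Real.exp (-Λ)) (by positivity)
    fun l => ?_).trans (le_of_eq ?_))
  · have e3 : (dft N * W) l 0 = (bakerMix N).mulVec (coherent N s (q, p)) l
        - θ * (dft N).mulVec (coherent N (s / 4) (2 * q - b, (p + b) / 2)) l := by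
      rw [hW, Matrix.mul_sub, ← Matrix.mul_assoc, dft_mul_quantumBaker hN, Matrix.mul_smul,
        cohCol, cohCol, ← Matrix.replicateCol_mulVec, ← Matrix.replicateCol_mulVec]
      rfl
    rw [e3]
    exact norm_bakerMix_coherent_sub_le hev hN hs hsN h1 hb hd₁ hd₂ hq hq' hp hp' hΛ₁ hΛ₂ l
  · have := Real.mul_self_sqrt (Nat.cast_nonneg (α := ℝ) N)
    linear_combination (160 * Real.exp (-Λ)) * this

/-- A point of the square as a point of the plane. -/
def sq (x : Square) : ℝ × ℝ := (x.1, x.2)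

theorem baker_apply (y : Square) : ∃ b : ℤ, (b = 0 ∨ b = 1) ∧ (b : ℝ) / 2 ≤ y.1 ∧
    (y.1 : ℝ) < (b + 1) / 2 ∧ sq (baker y) = (2 * (y.1 : ℝ) - b, ((y.2 : ℝ) + b) / 2) := by
  have h : baker y = bakerFun y := rfl
  by_cases hy : (y.1 : ℝ) < 1 / 2
  · refine ⟨0, Or.inl rfl, ?_, ?_, ?_⟩
    · simpa using y.1.2.1
    · simpa using hy
    · rw [h, bakerFun, dif_pos hy]; simp [sq]
  · refine ⟨1, Or.inr rfl, ?_, ?_, ?_⟩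
    · simpa using hy
    · have := y.1.2.2; push_cast; linarith
    · rw [h, bakerFun, dif_neg hy]; simp [sq]

theorem baker_pow_apply (x : Square) (m : ℕ) : ∃ a r : ℤ,
    sq ((baker ^ m) x) = (2 ^ m * (x.1 : ℝ) - a, ((x.2 : ℝ) + r) / 2 ^ m) := by
  induction m with
  | zero => exact ⟨0, 0, by simp [sq]⟩
  | succ m ih =>
    obtain ⟨a, r, h⟩ := ih
    obtain ⟨b, -, -, -, hb⟩ := baker_apply ((baker ^ m) x)
    have h1 : ((((baker ^ m) x).1 : ℝ)) = 2 ^ m * x.1 - a := congrArg Prod.fst h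
    have h2 : ((((baker ^ m) x).2 : ℝ)) = (x.2 + r) / 2 ^ m := congrArg Prod.snd h
    refine ⟨2 * a + b, r + 2 ^ m * b, ?_⟩
    rw [pow_succ', Equiv.Perm.mul_apply, hb, h1, h2]
    refine Prod.ext ?_ ?_
    · push_cast; ring
    · push_cast; field_simp; ring

/-- `(q, p)` is at distance at least `δ` from the discontinuities of the first `n` iterates. -/
def Good (n : ℕ) (δ : ℝ) (x : ℝ × ℝ) : Prop :=
  (∀ k : ℤ, δ ≤ |2 ^ n * x.1 - k|) ∧ ∀ k : ℤ, δ ≤ |x.2 - k|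

theorem norm_quantumBaker_pow_coherent_le {N : ℕ} (hev : Even N) (hN : 0 < N) {n : ℕ}
    (hn : (2 : ℝ) ^ n ≤ N) {δ : ℝ} (hδ : 0 < δ) {x : Square} (hx : Good n δ (sq x)) {m : ℕ}
    (hm : m ≤ n) :
    ∃ θ : ℂ, ‖θ‖ = 1 ∧ ‖quantumBaker N ^ m * cohCol N (2 ^ n) (sq x)
        - θ • cohCol N (2 ^ n / 4 ^ m) (sq ((baker ^ m) x))‖
      ≤ m * (160 * N * Real.exp (-(Real.pi / 2 * (N * δ ^ 2 / 2 ^ n)))) := by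
  induction m with
  | zero => exact ⟨1, norm_one, by simp⟩
  | succ m ih =>
    have hNr : (0 : ℝ) < N := by exact_mod_cast hN
    have hN1 : (1 : ℝ) ≤ N := by exact_mod_cast hN
    obtain ⟨θ, hθ, hle⟩ := ih (by omega)
    set E := 160 * N * Real.exp (-(Real.pi / 2 * (N * δ ^ 2 / 2 ^ n))) with hE
    set s : ℝ := 2 ^ n / 4 ^ m with hs
    obtain ⟨t, rfl⟩ : ∃ t, n = m + 1 + t := ⟨n - (m + 1), by omega⟩
    have h4 : (4 : ℝ) ^ m = 2 ^ m * 2 ^ m := by rw [← mul_pow]; norm_num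
    have h2m : (1 : ℝ) ≤ 2 ^ m := one_le_pow₀ one_le_two
    have h2t : (1 : ℝ) ≤ 2 ^ t := one_le_pow₀ one_le_two
    have hs0 : 0 < s := by positivity
    have hse : s = 2 * 2 ^ t / 2 ^ m := by rw [hs, h4, pow_add, pow_succ]; field_simp
    have hn' : (2 : ℝ) * 2 ^ m * 2 ^ t ≤ N := by
      rw [pow_add, pow_succ] at hn; linarith
    have hsN : s ≤ N := by
      rw [hse, div_le_iff₀ (by positivity)]
      nlinarith
    have h1s : 1 ≤ N * s := by
      rw [hse, mul_div_assoc', le_div_iff₀ (by positivity)]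
      nlinarith
    set y := (baker ^ m) x with hy
    obtain ⟨a, r, hor⟩ := baker_pow_apply x m
    rw [← hy] at hor
    have hy1 : (y.1 : ℝ) = 2 ^ m * x.1 - a := congrArg Prod.fst hor
    have hy2 : (y.2 : ℝ) = (x.2 + r) / 2 ^ m := congrArg Prod.snd hor
    obtain ⟨b, hb, hb0, hb1, hby⟩ := baker_apply y
    set d₁ : ℝ := δ / (2 * 2 ^ t) with hd₁
    set d₂ : ℝ := δ / 2 ^ m with hd₂
    have hdist1 (k : ℤ) : d₁ ≤ |(y.1 : ℝ) - k / 2| := by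
      have h := hx.1 (2 * 2 ^ t * a + 2 ^ t * k)
      have e : 2 ^ (m + 1 + t) * (sq x).1 - ((2 * 2 ^ t * a + 2 ^ t * k : ℤ) : ℝ)
          = (2 * 2 ^ t) * ((y.1 : ℝ) - k / 2) := by
        rw [hy1, sq]; push_cast; rw [pow_add, pow_succ]; ring
      rw [e, abs_mul, abs_of_pos (by positivity)] at h
      rw [hd₁, div_le_iff₀ (by positivity)]
      linarith
    have hdist2 (k : ℤ) : d₂ ≤ |(y.2 : ℝ) - k| := by
      have h := hx.2 (2 ^ m * k - r)
      have e : (sq x).2 - ((2 ^ m * k - r : ℤ) : ℝ) = 2 ^ m * ((y.2 : ℝ) - k) := by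
        rw [hy2, sq]; push_cast; field_simp; ring
      rw [e, abs_mul, abs_of_pos (by positivity)] at h
      rw [hd₂, div_le_iff₀ (by positivity)]
      linarith
    have hq : (b : ℝ) / 2 + d₁ ≤ y.1 := by
      have := hdist1 b
      rw [abs_of_nonneg (by linarith)] at this
      linarith
    have hq' : (y.1 : ℝ) ≤ (b + 1) / 2 - d₁ := by
      have := hdist1 (b + 1)
      push_cast at this
      rw [abs_of_neg (by linarith)] at this
      linarith
    have hp : d₂ ≤ y.2 := by
      have := hdist2 0
      rw [Int.cast_zero, sub_zero, abs_of_nonneg y.2.2.1] at this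
      exact this
    have hp' : (y.2 : ℝ) ≤ 1 - d₂ := by
      have := hdist2 1
      have h2 := y.2.2.2
      rw [Int.cast_one, abs_of_neg (by linarith)] at this
      linarith
    have hstep := norm_quantumBaker_step_le hev hN hs0 hsN h1s hb
      (by positivity : 0 ≤ d₁) (by positivity : 0 ≤ d₂) hq hq' hp hp'
      (Λ := Real.pi / 2 * (N * δ ^ 2 / 2 ^ (m + 1 + t)))
      (le_of_eq (by rw [hse, hd₁, pow_add, pow_succ]; field_simp; try ring))
      (le_of_eq (by rw [hse, hd₂, pow_add, pow_succ]; field_simp; try ring))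
    set φ := expi (N * b * (y.2 + b) / 2) with hφ
    refine ⟨θ * φ, by rw [norm_mul, hθ, hφ, norm_expi, one_mul], ?_⟩
    have hs4 : (2 : ℝ) ^ (m + 1 + t) / 4 ^ (m + 1) = s / 4 := by rw [hs, pow_succ 4]; field_simp
    rw [hs4, pow_succ' baker, Equiv.Perm.mul_apply, ← hy, hby]
    have e : quantumBaker N ^ (m + 1) * cohCol N (2 ^ (m + 1 + t)) (sq x)
        - (θ * φ) • cohCol N (s / 4) (2 * (y.1 : ℝ) - b, ((y.2 : ℝ) + b) / 2)
        = quantumBaker N * (quantumBaker N ^ m * cohCol N (2 ^ (m + 1 + t)) (sq x)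
            - θ • cohCol N s (sq y))
          + θ • (quantumBaker N * cohCol N s (sq y)
            - φ • cohCol N (s / 4) (2 * (y.1 : ℝ) - b, ((y.2 : ℝ) + b) / 2)) := by
      rw [pow_succ', Matrix.mul_sub, Matrix.mul_smul, smul_sub, smul_smul, Matrix.mul_assoc]
      abel
    rw [e]
    refine (norm_add_le _ _).trans ?_
    have n1 := (norm_unitary_mul_le (quantumBaker_mem_unitary hN hev) (quantumBaker N ^ m
      * cohCol N (2 ^ (m + 1 + t)) (sq x) - θ • cohCol N s (sq y))).trans hle
    have n2 : ‖θ • (quantumBaker N * cohCol N s (sq y)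
        - φ • cohCol N (s / 4) (2 * (y.1 : ℝ) - b, ((y.2 : ℝ) + b) / 2))‖ ≤ E := by
      rw [norm_smul, hθ, one_mul]; exact hstep
    push_cast
    linarith

theorem norm_conj_projector_sub_le {N : ℕ} (hev : Even N) (hN : 0 < N) {n : ℕ}
    (hn : (2 : ℝ) ^ n ≤ N) {δ : ℝ} (hδ : 0 < δ) {x : Square} (hx : Good n δ (sq x)) :
    ‖quantumBaker N ^ n * transSum N (projCoeff N (2 ^ n) (sq x)) * star (quantumBaker N ^ n)
        - transSum N (projCoeff N (1 / 2 ^ n) (sq ((baker ^ n) x)))‖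
      ≤ 14400 * n * N ^ 2 * Real.exp (-(Real.pi / 2 * (N * δ ^ 2 / 2 ^ n))) := by
  have hNr : (0 : ℝ) < N := by exact_mod_cast hN
  have hN1 : (1 : ℝ) ≤ N := by exact_mod_cast hN
  have h2n : (1 : ℝ) ≤ 2 ^ n := one_le_pow₀ one_le_two
  obtain ⟨θ, hθ, hle⟩ := norm_quantumBaker_pow_coherent_le hev hN hn hδ hx le_rfl
  have h4 : (4 : ℝ) ^ n = 2 ^ n * 2 ^ n := by rw [← mul_pow]; norm_num
  rw [show (2 : ℝ) ^ n / 4 ^ n = 1 / 2 ^ n by rw [h4]; field_simp] at hle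
  set E := 160 * N * Real.exp (-(Real.pi / 2 * (N * δ ^ 2 / 2 ^ n))) with hE
  set U := quantumBaker N ^ n * cohCol N (2 ^ n) (sq x) with hU
  set W := θ • cohCol N (1 / 2 ^ n) (sq ((baker ^ n) x)) with hW
  have hV : quantumBaker N ^ n * transSum N (projCoeff N (2 ^ n) (sq x)) * star (quantumBaker N ^ n)
      = U * U.conjTranspose := by
    rw [transSum_projCoeff_eq_cohCol hN (by positivity), hU, Matrix.conjTranspose_mul]
    simp only [Matrix.mul_assoc]
    rfl
  have hW2 : transSum N (projCoeff N (1 / 2 ^ n) (sq ((baker ^ n) x))) = W * W.conjTranspose := by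
    have h1 : star θ * θ = 1 := by
      rw [RCLike.star_def, Complex.conj_mul', hθ]; norm_num
    rw [transSum_projCoeff_eq_cohCol hN (by positivity), hW, Matrix.conjTranspose_smul,
      Matrix.smul_mul, Matrix.mul_smul, smul_smul, mul_comm, h1, one_smul]
  have hnU : ‖U‖ ≤ Real.sqrt N * 45 :=
    (norm_unitary_mul_le (pow_mem (quantumBaker_mem_unitary hN hev) n) _).trans
      (norm_cohCol_le hN (by positivity) hn (by nlinarith) _)
  have hnW : ‖W‖ ≤ Real.sqrt N * 45 := by
    rw [hW, norm_smul, hθ, one_mul]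
    refine norm_cohCol_le hN (by positivity) ?_ ?_ _
    · rw [div_le_iff₀ (by positivity)]; nlinarith
    · rw [mul_one_div, le_div_iff₀ (by positivity)]; linarith
  rw [hV, hW2]
  have e : U * U.conjTranspose - W * W.conjTranspose
      = (U - W) * U.conjTranspose + W * (U - W).conjTranspose := by
    rw [Matrix.conjTranspose_sub, Matrix.sub_mul, Matrix.mul_sub]; abel
  rw [e]
  have hsq : Real.sqrt N ≤ N := by
    rw [Real.sqrt_le_left hNr.le]; nlinarith
  have hnE : 0 ≤ n * E := by positivity
  have m1 : ‖(U - W) * U.conjTranspose‖ ≤ (n * E) * (N * 45) := by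
    refine (Matrix.l2_opNorm_mul _ _).trans ?_
    rw [Matrix.l2_opNorm_conjTranspose]
    exact mul_le_mul hle (hnU.trans (by nlinarith)) (norm_nonneg _) hnE
  have m2 : ‖W * (U - W).conjTranspose‖ ≤ (N * 45) * (n * E) := by
    refine (Matrix.l2_opNorm_mul _ _).trans ?_
    rw [Matrix.l2_opNorm_conjTranspose]
    exact mul_le_mul (hnW.trans (by nlinarith)) hle (norm_nonneg _) (by positivity)
  refine (norm_add_le _ _).trans ((add_le_add m1 m2).trans (le_of_eq ?_))
  rw [hE]; ring

end Iterate


/-! ### The baker's map preserves area -/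

/-- The fundamental square. -/
def unitSquare : Set (ℝ × ℝ) := Set.Ico (0 : ℝ) 1 ×ˢ Set.Ico (0 : ℝ) 1

theorem measurableSet_unitSquare : MeasurableSet unitSquare :=
  measurableSet_Ico.prod measurableSet_Ico

/-- Lebesgue measure on the fundamental square. -/
def squareMeasure : MeasureTheory.Measure (ℝ × ℝ) := MeasureTheory.volume.restrict unitSquare

theorem toSquare_sq (y : Square) : toSquare (sq y) = y := by
  refine Prod.ext (Subtype.ext ?_) (Subtype.ext ?_)
  · exact Int.fract_eq_self.mpr y.1.2
  · exact Int.fract_eq_self.mpr y.2.2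

theorem sq_toSquare {x : ℝ × ℝ} (hx : x ∈ unitSquare) : sq (toSquare x) = x :=
  Prod.ext (Int.fract_eq_self.mpr hx.1) (Int.fract_eq_self.mpr hx.2)

/-- The `n`-th iterate of the baker's map on the plane. -/
def bakerIter (n : ℕ) (x : ℝ × ℝ) : ℝ × ℝ := sq ((baker ^ n) (toSquare x))

theorem bakerIter_succ (n : ℕ) : bakerIter (n + 1) = bakerIter 1 ∘ bakerIter n := by
  ext1 x
  simp only [bakerIter, Function.comp, toSquare_sq, pow_succ' baker n, pow_one, Equiv.Perm.mul_apply]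

theorem measurePreserving_squeeze :
    MeasureTheory.MeasurePreserving (fun x : ℝ × ℝ => (2 * x.1, 2⁻¹ * x.2)) where
  measurable := by fun_prop
  map_eq := by
    have h1 := Real.map_volume_mul_left (two_ne_zero (α := ℝ))
    have h2 := Real.map_volume_mul_left (inv_ne_zero (two_ne_zero (α := ℝ)))
    have h := MeasureTheory.Measure.map_prod_map (MeasureTheory.volume : MeasureTheory.Measure ℝ)
      (MeasureTheory.volume : MeasureTheory.Measure ℝ) (f := fun x : ℝ => 2 * x)
      (g := fun x : ℝ => 2⁻¹ * x) (by fun_prop) (by fun_prop)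
    have h3 : |((2 : ℝ)⁻¹ : ℝ)| * |((2 : ℝ)⁻¹⁻¹ : ℝ)| = 1 := by norm_num
    rw [h1, h2, MeasureTheory.Measure.prod_smul_left, MeasureTheory.Measure.prod_smul_right,
      smul_smul, ← ENNReal.ofReal_mul (abs_nonneg _), h3, ENNReal.ofReal_one, one_smul] at h
    exact h.symm

theorem measurePreserving_squeeze_add (a b : ℝ) :
    MeasureTheory.MeasurePreserving (fun x : ℝ × ℝ => (2 * x.1 + a, 2⁻¹ * x.2 + b)) :=
  (((MeasureTheory.measurePreserving_add_right MeasureTheory.volume a).prod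
    (MeasureTheory.measurePreserving_add_right MeasureTheory.volume b))).comp
    measurePreserving_squeeze

theorem bakerIter_one_apply (x : ℝ × ℝ) : bakerIter 1 x = if Int.fract x.1 < 1 / 2 then
    (2 * Int.fract x.1 + 0, 2⁻¹ * Int.fract x.2 + 0)
    else (2 * Int.fract x.1 + -1, 2⁻¹ * Int.fract x.2 + 2⁻¹) := by
  have h : bakerIter 1 x = sq (bakerFun (toSquare x)) := by rw [bakerIter, pow_one]; rfl
  rw [h, bakerFun]
  split_ifs with h1 h2 h2
  · simp [sq, toSquare]; ring
  · exact absurd h1 h2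
  · exact absurd h2 h1
  · simp only [sq, toSquare]; refine Prod.ext ?_ ?_ <;> simp only <;> ring

theorem measurable_bakerIter_one : Measurable (bakerIter 1) := by
  rw [show bakerIter 1 = _ from funext bakerIter_one_apply]
  refine Measurable.ite (measurableSet_lt (by fun_prop) measurable_const) ?_ ?_ <;> fun_prop

theorem measurePreserving_bakerIter_one :
    MeasureTheory.MeasurePreserving (bakerIter 1) squareMeasure squareMeasure where
  measurable := measurable_bakerIter_one
  map_eq := by
    ext S hS
    rw [MeasureTheory.Measure.map_apply measurable_bakerIter_one hS, squareMeasure,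
      MeasureTheory.Measure.restrict_apply (measurable_bakerIter_one hS),
      MeasureTheory.Measure.restrict_apply hS]
    have hm0 : MeasurableSet (S ∩ Set.Ico (0 : ℝ) 1 ×ˢ Set.Ico (0 : ℝ) (1 / 2)) :=
      hS.inter (measurableSet_Ico.prod measurableSet_Ico)
    have hm1 : MeasurableSet (S ∩ Set.Ico (0 : ℝ) 1 ×ˢ Set.Ico (1 / 2 : ℝ) 1) :=
      hS.inter (measurableSet_Ico.prod measurableSet_Ico)
    have p0 := (measurePreserving_squeeze_add 0 0).measure_preimage hm0.nullMeasurableSet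
    have p1 := (measurePreserving_squeeze_add (-1) 2⁻¹).measure_preimage hm1.nullMeasurableSet
    have e0 : bakerIter 1 ⁻¹' S ∩ unitSquare
        = (fun x : ℝ × ℝ => (2 * x.1 + 0, 2⁻¹ * x.2 + 0)) ⁻¹'
            (S ∩ Set.Ico (0 : ℝ) 1 ×ˢ Set.Ico (0 : ℝ) (1 / 2))
          ∪ (fun x : ℝ × ℝ => (2 * x.1 + -1, 2⁻¹ * x.2 + 2⁻¹)) ⁻¹'
            (S ∩ Set.Ico (0 : ℝ) 1 ×ˢ Set.Ico (1 / 2 : ℝ) 1) := by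
      ext x
      simp only [Set.mem_inter_iff, Set.mem_preimage, Set.mem_union, Set.mem_prod, Set.mem_Ico,
        unitSquare]
      constructor
      · rintro ⟨hxS, ⟨h1, h2⟩, h3, h4⟩
        rw [bakerIter_one_apply, Int.fract_eq_self.mpr ⟨h1, h2⟩, Int.fract_eq_self.mpr ⟨h3, h4⟩] at hxS
        split_ifs at hxS with h
        · left; exact ⟨hxS, ⟨by linarith, by linarith⟩, by linarith, by linarith⟩
        · right; exact ⟨hxS, ⟨by linarith, by linarith⟩, by linarith, by linarith⟩
      · rintro (⟨hxS, ⟨h1, h2⟩, h3, h4⟩ | ⟨hxS, ⟨h1, h2⟩, h3, h4⟩)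
        · have hx1 : (0 : ℝ) ≤ x.1 ∧ x.1 < 1 := ⟨by linarith, by linarith⟩
          have hx2 : (0 : ℝ) ≤ x.2 ∧ x.2 < 1 := ⟨by linarith, by linarith⟩
          refine ⟨?_, hx1, hx2⟩
          rw [bakerIter_one_apply, Int.fract_eq_self.mpr hx1, Int.fract_eq_self.mpr hx2,
            if_pos (by linarith)]
          exact hxS
        · have hx1 : (0 : ℝ) ≤ x.1 ∧ x.1 < 1 := ⟨by linarith, by linarith⟩
          have hx2 : (0 : ℝ) ≤ x.2 ∧ x.2 < 1 := ⟨by linarith, by linarith⟩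
          refine ⟨?_, hx1, hx2⟩
          rw [bakerIter_one_apply, Int.fract_eq_self.mpr hx1, Int.fract_eq_self.mpr hx2,
            if_neg (by linarith)]
          exact hxS
    rw [e0, MeasureTheory.measure_union]
    · rw [p0, p1, ← MeasureTheory.measure_union _ hm1]
      · congr 1
        ext x
        simp only [Set.mem_inter_iff, Set.mem_union, Set.mem_prod, Set.mem_Ico, unitSquare]
        constructor
        · rintro (⟨hxS, ⟨h1, h2⟩, h3, h4⟩ | ⟨hxS, ⟨h1, h2⟩, h3, h4⟩)
          · exact ⟨hxS, ⟨h1, h2⟩, h3, by linarith⟩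
          · exact ⟨hxS, ⟨h1, h2⟩, by linarith, h4⟩
        · rintro ⟨hxS, h12, h3, h4⟩
          rcases lt_or_ge x.2 (1 / 2) with h | h
          · exact Or.inl ⟨hxS, h12, h3, h⟩
          · exact Or.inr ⟨hxS, h12, h, h4⟩
      · rw [Set.disjoint_left]
        rintro x ⟨-, -, h3, h4⟩ ⟨-, -, h5, h6⟩
        linarith
    · rw [Set.disjoint_left]
      rintro x ⟨-, ⟨h1, h2⟩, -⟩ ⟨-, ⟨h3, h4⟩, -⟩
      simp only at h1 h2 h3 h4
      linarith
    · exact (measurePreserving_squeeze_add (-1) 2⁻¹).measurable hm1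

theorem measurePreserving_bakerIter (n : ℕ) :
    MeasureTheory.MeasurePreserving (bakerIter n) squareMeasure squareMeasure := by
  induction n with
  | zero =>
    have h0 : bakerIter 0 = fun x => (Int.fract x.1, Int.fract x.2) := rfl
    refine ⟨by rw [h0]; fun_prop, ?_⟩
    have : bakerIter 0 =ᵐ[squareMeasure] id := by
      refine (MeasureTheory.ae_restrict_mem measurableSet_unitSquare).mono fun x hx => ?_
      exact sq_toSquare hx
    rw [MeasureTheory.Measure.map_congr this, MeasureTheory.Measure.map_id]
  | succ n ih => rw [bakerIter_succ]; exact measurePreserving_bakerIter_one.comp ih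

/-! ### Anti-Wick quantisation -/

section AntiWick
open scoped Matrix.Norms.L2Operator

/-- The anti-Wick quantisation of `b` with squeezing `s`, through Fourier coefficients. -/
def antiWick (N : ℕ) (s : ℝ) (b : ℝ × ℝ → ℂ) : Matrix (Fin N) (Fin N) ℂ :=
  transSum N fun k => (Real.exp (-qform N s k) : ℂ) * fourierCoeff₂ b k

theorem continuous_projCoeff (N : ℕ) (s : ℝ) (k : ℤ × ℤ) :
    Continuous fun x => projCoeff N s x k := by
  have := continuous_expi
  unfold projCoeff; fun_prop

theorem integrable_of_continuous {E : Type*} [NormedAddCommGroup E] {g : ℝ × ℝ → E}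
    (hg : Continuous g) : MeasureTheory.Integrable g squareMeasure := by
  have hK : IsCompact (Set.Icc (0 : ℝ) 1 ×ˢ Set.Icc (0 : ℝ) 1) := isCompact_Icc.prod isCompact_Icc
  exact (hg.continuousOn.integrableOn_compact (μ := MeasureTheory.volume) hK).mono_set
    (Set.prod_mono Set.Ico_subset_Icc_self Set.Ico_subset_Icc_self)

instance : MeasureTheory.IsProbabilityMeasure squareMeasure where
  measure_univ := by
    rw [squareMeasure, MeasureTheory.Measure.restrict_apply_univ, unitSquare,
      MeasureTheory.Measure.volume_eq_prod, MeasureTheory.Measure.prod_prod, Real.volume_Ico]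
    simp

theorem continuous_transSum_projCoeff {N : ℕ} (hN : 0 < N) {s : ℝ} (hs : 0 < s) :
    Continuous fun x => transSum N (projCoeff N s x) := by
  refine continuous_tsum (u := fun k => 1 / N * Real.exp (-qform N s k))
    (fun k => (continuous_projCoeff N s k).smul continuous_const)
    ((summable_exp_qform hN hs).mul_left _) fun k x => ?_
  rw [norm_smul, norm_projCoeff]
  exact mul_le_of_le_one_right (by positivity) (norm_translation_le N k)

theorem antiWick_eq_integral {N : ℕ} (hN : 0 < N) {s : ℝ} (hs : 0 < s) {b : ℝ × ℝ → ℂ}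
    (hb : Continuous b) {M : ℝ} (hM : ∀ x, ‖b x‖ ≤ M) :
    antiWick N s b = (N : ℂ) • ∫ x, b x • transSum N (projCoeff N s x) ∂squareMeasure := by
  have hNc : (N : ℂ) ≠ 0 := by exact_mod_cast hN.ne'
  have hM0 : 0 ≤ M := (norm_nonneg _).trans (hM 0)
  let F : ℤ × ℤ → ℝ × ℝ → Matrix (Fin N) (Fin N) ℂ := fun k x =>
    (b x * projCoeff N s x k) • translation N k
  have hFc (k : ℤ × ℤ) : Continuous (F k) :=
    (hb.mul (continuous_projCoeff N s k)).smul continuous_const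
  have hFn (k : ℤ × ℤ) (x : ℝ × ℝ) : ‖F k x‖ ≤ M * (1 / N * Real.exp (-qform N s k)) := by
    simp only [F]
    rw [norm_smul, norm_mul, norm_projCoeff]
    exact (mul_le_of_le_one_right (by positivity) (norm_translation_le N k)).trans
      (mul_le_mul_of_nonneg_right (hM x) (by positivity))
  have hs0 : Summable fun k => M * (1 / (N : ℝ) * Real.exp (-qform N s k)) :=
    ((summable_exp_qform hN hs).mul_left _).mul_left _
  have hsum := MeasureTheory.hasSum_integral_of_summable_integral_norm (μ := squareMeasure)
    (fun k => integrable_of_continuous (hFc k)) (by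
      refine Summable.of_nonneg_of_le
        (fun k => MeasureTheory.integral_nonneg fun x => norm_nonneg _) (fun k => ?_) hs0
      have := MeasureTheory.integral_mono (μ := squareMeasure)
        (integrable_of_continuous (hFc k)).norm (MeasureTheory.integrable_const _) (hFn k)
      simpa using this)
  have h1 (x : ℝ × ℝ) : ∑' k, F k x = b x • transSum N (projCoeff N s x) := by
    simp only [F, transSum, ← smul_smul]
    exact (summable_trans N (summable_projCoeff hN hs x)).tsum_const_smul _
  simp_rw [h1] at hsum
  rw [← hsum.tsum_eq, ← hsum.summable.tsum_const_smul, antiWick, transSum]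
  congr 1; ext1 k
  simp only [F]
  rw [integral_smul_const, smul_smul]
  congr 1
  have h2 (x : ℝ × ℝ) : b x * projCoeff N s x k = ((1 / N * Real.exp (-qform N s k) : ℝ) : ℂ)
      * (b x * Complex.exp (-(2 * Real.pi * Complex.I * (x.1 * k.2 - x.2 * k.1)))) := by
    rw [projCoeff, expi, mul_left_comm]
    congr 3; push_cast; ring
  simp_rw [h2]
  rw [MeasureTheory.integral_const_mul, fourierCoeff₂, squareMeasure, unitSquare]
  rw [← mul_assoc]
  congr 1
  push_cast
  field_simp

theorem compBaker_bakerIter (f : ℝ × ℝ → ℂ) (n : ℕ) {x : ℝ × ℝ} (hx : x ∈ unitSquare) :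
    compBaker f (-n) (bakerIter n x) = f x := by
  have h : (baker ^ (-(n : ℤ))) ((baker ^ n) (toSquare x)) = toSquare x := by
    rw [zpow_neg, zpow_natCast]; exact Equiv.symm_apply_apply _ _
  have h2 : compBaker f (-n) (bakerIter n x)
      = f (sq ((baker ^ (-(n : ℤ))) (toSquare (bakerIter n x)))) := rfl
  rw [h2, bakerIter, toSquare_sq, h, sq_toSquare hx]

theorem norm_conj_antiWick_sub_le {N : ℕ} (hev : Even N) (hN : 0 < N) {n : ℕ}
    (hn : (2 : ℝ) ^ n ≤ N) {δ : ℝ} (hδ : 0 < δ) {b b' : ℝ × ℝ → ℂ} (hb : Continuous b)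
    (hb' : Continuous b') {M : ℝ} (hM : ∀ x, ‖b x‖ ≤ M) (hM' : ∀ x, ‖b' x‖ ≤ M)
    (hsupp : ∀ x, ¬ Good n δ x → b x = 0) (hbb' : ∀ x ∈ unitSquare, b' (bakerIter n x) = b x) :
    ‖quantumBaker N ^ n * antiWick N (2 ^ n) b * star (quantumBaker N ^ n)
        - antiWick N (1 / 2 ^ n) b'‖
      ≤ 14400 * M * n * N ^ 3 * Real.exp (-(Real.pi / 2 * (N * δ ^ 2 / 2 ^ n))) := by
  have hs : (0 : ℝ) < 2 ^ n := by positivity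
  have hs' : (0 : ℝ) < 1 / 2 ^ n := by positivity
  have hM0 : 0 ≤ M := (norm_nonneg _).trans (hM 0)
  set U := quantumBaker N ^ n with hU
  have hP := continuous_transSum_projCoeff hN hs
  have hP' := continuous_transSum_projCoeff hN hs'
  have hmp := measurePreserving_bakerIter n
  have h1 : U * antiWick N (2 ^ n) b * star U
      = (N : ℂ) • ∫ x, b x • (U * transSum N (projCoeff N (2 ^ n) x) * star U) ∂squareMeasure := by
    let L : Matrix (Fin N) (Fin N) ℂ →L[ℂ] Matrix (Fin N) (Fin N) ℂ :=
      LinearMap.toContinuousLinearMap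
        ((LinearMap.mulRight ℂ (star U)).comp (LinearMap.mulLeft ℂ U))
    have hL (A : Matrix (Fin N) (Fin N) ℂ) : L A = U * A * star U := rfl
    rw [antiWick_eq_integral hN hs hb hM, ← hL, map_smul, ← L.integral_comp_comm]
    · simp_rw [map_smul, hL]
    · exact integrable_of_continuous (hb.smul hP)
  have h2 : antiWick N (1 / 2 ^ n) b'
      = (N : ℂ) • ∫ x, b x • transSum N (projCoeff N (1 / 2 ^ n) (bakerIter n x)) ∂squareMeasure := by
    rw [antiWick_eq_integral hN hs' hb' hM']
    congr 1
    have hc : Continuous fun x => b' x • transSum N (projCoeff N (1 / 2 ^ n) x) := hb'.smul hP'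
    conv_lhs => rw [← hmp.map_eq]
    rw [MeasureTheory.integral_map hmp.measurable.aemeasurable hc.aestronglyMeasurable]
    refine MeasureTheory.integral_congr_ae
      ((MeasureTheory.ae_restrict_mem measurableSet_unitSquare).mono fun x hx => ?_)
    simp only
    rw [hbb' x hx]
  have i1 : MeasureTheory.Integrable
      (fun x => b x • (U * transSum N (projCoeff N (2 ^ n) x) * star U)) squareMeasure :=
    integrable_of_continuous (hb.smul ((continuous_const.mul hP).mul continuous_const))
  have i2 : MeasureTheory.Integrable
      (fun x => b x • transSum N (projCoeff N (1 / 2 ^ n) (bakerIter n x))) squareMeasure := by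
    have := (hmp.integrable_comp (hb'.smul hP').aestronglyMeasurable).mpr
      (integrable_of_continuous (hb'.smul hP'))
    refine this.congr
      ((MeasureTheory.ae_restrict_mem measurableSet_unitSquare).mono fun x hx => ?_)
    change b' (bakerIter n x) • transSum N (projCoeff N (1 / 2 ^ n) (bakerIter n x)) = _
    rw [hbb' x hx]
  rw [h1, h2, ← smul_sub, ← MeasureTheory.integral_sub i1 i2, norm_smul, Complex.norm_natCast]
  set E := Real.exp (-(Real.pi / 2 * (N * δ ^ 2 / 2 ^ n))) with hE
  have h3 : ‖∫ x, (b x • (U * transSum N (projCoeff N (2 ^ n) x) * star U)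
      - b x • transSum N (projCoeff N (1 / 2 ^ n) (bakerIter n x))) ∂squareMeasure‖
      ≤ M * (14400 * n * N ^ 2 * E) := by
    have := MeasureTheory.norm_integral_le_of_norm_le_const (μ := squareMeasure)
      (f := fun x => b x • (U * transSum N (projCoeff N (2 ^ n) x) * star U)
        - b x • transSum N (projCoeff N (1 / 2 ^ n) (bakerIter n x)))
      (C := M * (14400 * n * N ^ 2 * E))
      ((MeasureTheory.ae_restrict_mem measurableSet_unitSquare).mono fun x hx => ?_)
    · simpa using this
    · rw [← smul_sub, norm_smul]
      by_cases hg : Good n δ x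
      · have hx' := sq_toSquare hx
        have := norm_conj_projector_sub_le hev hN hn hδ (x := toSquare x) (hx'.symm ▸ hg)
        rw [hx'] at this
        exact mul_le_mul (hM x) this (norm_nonneg _) hM0
      · rw [hsupp x hg, norm_zero, zero_mul]; positivity
  calc (N : ℝ) * _ ≤ N * (M * (14400 * n * N ^ 2 * E)) :=
        mul_le_mul_of_nonneg_left h3 (Nat.cast_nonneg _)
    _ = _ := by ring

end AntiWick


/-! ### Composition of observables with iterates of the baker's map -/

theorem bakerInv_apply (y : Square) : ∃ b : ℤ, ⌊2 * (y.2 : ℝ)⌋ = b ∧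
    sq (baker⁻¹ y) = (((y.1 : ℝ) + b) / 2, 2 * (y.2 : ℝ) - b) := by
  have h : baker⁻¹ y = bakerInv y := rfl
  have h0 := y.2.2.1
  have h1 := y.2.2.2
  by_cases hy : (y.2 : ℝ) < 1 / 2
  · refine ⟨0, ?_, ?_⟩
    · rw [Int.floor_eq_iff]; constructor <;> push_cast <;> linarith
    · rw [h, bakerInv, dif_pos hy]; simp [sq]
  · refine ⟨1, ?_, ?_⟩
    · rw [Int.floor_eq_iff]; constructor <;> push_cast <;> linarith
    · rw [h, bakerInv, dif_neg hy]; simp [sq]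

theorem floor_two_mul (x : ℝ) : ⌊2 * x⌋ = 2 * ⌊x⌋ + ⌊2 * Int.fract x⌋ := by
  have h : 2 * x = 2 * Int.fract x + ((2 * ⌊x⌋ : ℤ) : ℝ) := by
    push_cast; nlinarith [Int.floor_add_fract x]
  rw [h, Int.floor_add_intCast, add_comm]

theorem exists_baker_inv_pow (n : ℕ) (r : ℤ) : ∃ a : ℤ, ∀ y : Square, ⌊2 ^ n * (y.2 : ℝ)⌋ = r →
    sq ((baker⁻¹ ^ n) y) = (((y.1 : ℝ) + a) / 2 ^ n, 2 ^ n * (y.2 : ℝ) - r) := by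
  induction n generalizing r with
  | zero =>
    refine ⟨0, fun y hy => ?_⟩
    have h0 : r = 0 := by
      rw [← hy, Int.floor_eq_iff]
      have := y.2.2.1; have := y.2.2.2
      constructor <;> simp <;> assumption
    simp [sq, h0]
  | succ n ih =>
    obtain ⟨a, ha⟩ := ih (r / 2)
    refine ⟨a + 2 ^ n * (r - 2 * (r / 2)), fun y hy => ?_⟩
    rw [pow_succ', mul_assoc, floor_two_mul] at hy
    obtain ⟨b, hb, hby⟩ := bakerInv_apply ((baker⁻¹ ^ n) y)
    have hf0 := Int.fract_nonneg (2 ^ n * (y.2 : ℝ))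
    have hf1 := Int.fract_lt_one (2 ^ n * (y.2 : ℝ))
    have hc0 : 0 ≤ ⌊2 * Int.fract (2 ^ n * (y.2 : ℝ))⌋ := Int.floor_nonneg.mpr (by linarith)
    have hc1 : ⌊2 * Int.fract (2 ^ n * (y.2 : ℝ))⌋ < 2 := Int.floor_lt.mpr (by push_cast; linarith)
    have hr : ⌊2 ^ n * (y.2 : ℝ)⌋ = r / 2 := by omega
    have hsq := ha y hr
    have e1 : (((baker⁻¹ ^ n) y).1 : ℝ) = ((y.1 : ℝ) + a) / 2 ^ n := congrArg Prod.fst hsq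
    have e2 : (((baker⁻¹ ^ n) y).2 : ℝ) = 2 ^ n * (y.2 : ℝ) - (r / 2 : ℤ) := congrArg Prod.snd hsq
    have e3 : 2 ^ n * (y.2 : ℝ) - (r / 2 : ℤ) = Int.fract (2 ^ n * (y.2 : ℝ)) := by
      rw [← hr]; rfl
    have hbr : b = r - 2 * (r / 2) := by
      rw [e2, e3] at hb; omega
    rw [pow_succ', Equiv.Perm.mul_apply, hby, e1, e2]
    have hbr' : (b : ℝ) = r - 2 * (r / 2 : ℤ) := by exact_mod_cast hbr
    have h2 : (2 : ℝ) ^ n ≠ 0 := by positivity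
    refine Prod.ext ?_ ?_
    · simp only [hbr']; push_cast; field_simp; ring
    · simp only [hbr']; ring

theorem IsObservable.add_int {f : ℝ × ℝ → ℂ} (hf : IsObservable f) (q p : ℝ) (k l : ℤ) :
    f (q + k, p + l) = f (q, p) := by
  rw [← hf.periodic_fract, Int.fract_add_intCast, Int.fract_add_intCast, hf.periodic_fract]

theorem exists_compBaker_neg_eq (n : ℕ) (l R : ℤ) : ∃ a : ℤ, ∀ f : ℝ × ℝ → ℂ, IsObservable f →
    ∀ y : ℝ × ℝ, ⌊y.1⌋ = l → ⌊2 ^ n * y.2⌋ = R →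
      compBaker f (-n) y = f ((y.1 + a) / 2 ^ n, 2 ^ n * y.2) := by
  obtain ⟨a, ha⟩ := exists_baker_inv_pow n (R - 2 ^ n * (R / 2 ^ n))
  refine ⟨a - l, fun f hf y hl hR => ?_⟩
  have hpos : (0 : ℤ) < 2 ^ n := by positivity
  have h2 : (0 : ℝ) < 2 ^ n := by positivity
  have hfl : ⌊y.2⌋ = R / 2 ^ n := by
    rw [Int.floor_eq_iff]
    obtain ⟨g1, g2⟩ := Int.floor_eq_iff.mp hR
    have i1 : R / 2 ^ n * 2 ^ n ≤ R := Int.ediv_mul_le _ hpos.ne'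
    have i2 : R + 1 ≤ (R / 2 ^ n + 1) * 2 ^ n := Int.lt_ediv_add_one_mul_self _ hpos
    have j1 : ((R / 2 ^ n : ℤ) : ℝ) * 2 ^ n ≤ R := by exact_mod_cast i1
    have j2 : (R : ℝ) + 1 ≤ (((R / 2 ^ n : ℤ) : ℝ) + 1) * 2 ^ n := by exact_mod_cast i2
    constructor
    · refine le_of_mul_le_mul_left ?_ h2; linarith
    · refine lt_of_mul_lt_mul_left ?_ h2.le; linarith
  have e1 : ((toSquare y).1 : ℝ) = y.1 - l := by rw [← hl]; rfl
  have e2 : ((toSquare y).2 : ℝ) = y.2 - (R / 2 ^ n : ℤ) := by rw [← hfl]; rfl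
  have e3 : ⌊2 ^ n * ((toSquare y).2 : ℝ)⌋ = R - 2 ^ n * (R / 2 ^ n) := by
    rw [e2, mul_sub, show (2 : ℝ) ^ n * ((R / 2 ^ n : ℤ) : ℝ) = ((2 ^ n * (R / 2 ^ n) : ℤ) : ℝ) by
      push_cast; rfl, Int.floor_sub_intCast, hR]
  have h := ha _ e3
  have hc : compBaker f (-n) y = f (sq ((baker⁻¹ ^ n) (toSquare y))) := by
    rw [inv_pow, ← zpow_natCast, ← zpow_neg]; rfl
  rw [hc, h, e1, e2]
  have := hf.add_int ((y.1 + (a - l : ℤ)) / 2 ^ n) (2 ^ n * y.2) 0 (-R)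
  rw [← this]
  congr 2
  · push_cast; ring
  · push_cast; ring

theorem isOpen_not_good (n : ℕ) (δ : ℝ) : IsOpen {x | ¬ Good n δ x} := by
  have h : {x | ¬ Good n δ x} = (⋃ k : ℤ, {x : ℝ × ℝ | |2 ^ n * x.1 - k| < δ})
      ∪ ⋃ k : ℤ, {x : ℝ × ℝ | |x.2 - k| < δ} := by
    ext x; simp only [Good, Set.mem_ofPred_eq, Set.mem_union, Set.mem_iUnion, not_and_or,
      not_forall, not_le]
  rw [h]
  exact (isOpen_iUnion fun k => isOpen_lt (by fun_prop) continuous_const).union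
    (isOpen_iUnion fun k => isOpen_lt (by fun_prop) continuous_const)

theorem eventually_floor_eq {g : ℝ × ℝ → ℝ} (hg : Continuous g) {δ : ℝ} (hδ : 0 < δ) {y : ℝ × ℝ}
    (h : ∀ k : ℤ, δ ≤ |g y - k|) : ∀ᶠ z in nhds y, ⌊g z⌋ = ⌊g y⌋ := by
  have h1 : (⌊g y⌋ : ℝ) < g y := by
    refine lt_of_le_of_ne (Int.floor_le _) fun he => ?_
    have := h ⌊g y⌋
    rw [he, sub_self, abs_zero] at this
    linarith
  filter_upwards [hg.continuousAt.eventually_const_lt h1,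
    hg.continuousAt.eventually_lt_const (Int.lt_floor_add_one (g y))] with z hz1 hz2
  exact Int.floor_eq_iff.mpr ⟨hz1.le, hz2⟩

theorem dq_congr {f g : ℝ × ℝ → ℂ} {x : ℝ × ℝ} (h : f =ᶠ[nhds x] g) : dq f x = dq g x := by
  refine Filter.EventuallyEq.deriv_eq ?_
  have : Filter.Tendsto (fun t : ℝ => (t, x.2)) (nhds x.1) (nhds x) :=
    Continuous.tendsto (by fun_prop) x.1
  exact this.eventually h

theorem dp_congr {f g : ℝ × ℝ → ℂ} {x : ℝ × ℝ} (h : f =ᶠ[nhds x] g) : dp f x = dp g x := by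
  refine Filter.EventuallyEq.deriv_eq ?_
  have : Filter.Tendsto (fun t : ℝ => (x.1, t)) (nhds x.2) (nhds x) :=
    Continuous.tendsto (by fun_prop) x.2
  exact this.eventually h

theorem dq_zero : dq (fun _ => 0) = fun _ => 0 := by ext x; simp [dq]

theorem dp_zero : dp (fun _ => 0) = fun _ => 0 := by ext x; simp [dp]

/-- The observables that vanish at distance less than `δ` from the discontinuities of `B ^ n`. -/
structure IsGoodObservable (n : ℕ) (δ : ℝ) (f : ℝ × ℝ → ℂ) : Prop where
  obs : IsObservable f
  supp : ∀ x, ¬ Good n δ x → f x = 0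

theorem IsGoodObservable.eventually_eq_zero {n : ℕ} {δ : ℝ} {f : ℝ × ℝ → ℂ}
    (hf : IsGoodObservable n δ f) {x : ℝ × ℝ} (hx : ¬ Good n δ x) : f =ᶠ[nhds x] fun _ => 0 :=
  Filter.mem_of_superset ((isOpen_not_good n δ).mem_nhds hx) hf.supp

theorem IsGoodObservable.dq {n : ℕ} {δ : ℝ} {f : ℝ × ℝ → ℂ} (hf : IsGoodObservable n δ f) :
    IsGoodObservable n δ (dq f) :=
  ⟨hf.obs.dq, fun x hx => by rw [dq_congr (hf.eventually_eq_zero hx), dq_zero]⟩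

theorem IsGoodObservable.dp {n : ℕ} {δ : ℝ} {f : ℝ × ℝ → ℂ} (hf : IsGoodObservable n δ f) :
    IsGoodObservable n δ (dp f) :=
  ⟨hf.obs.dp, fun x hx => by rw [dp_congr (hf.eventually_eq_zero hx), dp_zero]⟩

theorem IsGoodObservable.iterate {n : ℕ} {δ : ℝ} {f : ℝ × ℝ → ℂ} (hf : IsGoodObservable n δ f)
    (i j : ℕ) : IsGoodObservable n δ (QBaker.dq^[i] (QBaker.dp^[j] f)) := by
  have h : IsGoodObservable n δ (QBaker.dp^[j] f) := by
    induction j with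
    | zero => exact hf
    | succ j ih => rw [Function.iterate_succ_apply']; exact ih.dp
  induction i with
  | zero => exact h
  | succ i ih => rw [Function.iterate_succ_apply']; exact ih.dq

theorem IsGoodObservable.compBaker_eq_zero {n : ℕ} {δ : ℝ} {f : ℝ × ℝ → ℂ}
    (hf : IsGoodObservable n δ f) {y : ℝ × ℝ} (hy : ¬ Good n δ y.swap) : compBaker f (-n) y = 0 := by
  obtain ⟨a, ha⟩ := exists_compBaker_neg_eq n ⌊y.1⌋ ⌊2 ^ n * y.2⌋
  rw [ha f hf.obs y rfl rfl]
  refine hf.supp _ fun hg => hy ⟨hg.2, fun k => ?_⟩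
  have := hg.1 (k + a)
  simp only at this
  rw [mul_div_cancel₀ _ (by positivity)] at this
  simpa [add_sub_add_right_eq_sub] using this

theorem IsGoodObservable.compBaker_eventually_eq_zero {n : ℕ} {δ : ℝ} {f : ℝ × ℝ → ℂ}
    (hf : IsGoodObservable n δ f) {y : ℝ × ℝ} (hy : ¬ Good n δ y.swap) :
    compBaker f (-n) =ᶠ[nhds y] fun _ => 0 :=
  Filter.mem_of_superset (((isOpen_not_good n δ).preimage continuous_swap).mem_nhds hy)
    fun _ hz => hf.compBaker_eq_zero hz

theorem exists_compBaker_eventually_eq {n : ℕ} {δ : ℝ} (hδ : 0 < δ) {y : ℝ × ℝ}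
    (hy : Good n δ y.swap) : ∃ a : ℤ, ∀ f : ℝ × ℝ → ℂ, IsObservable f →
      compBaker f (-n) =ᶠ[nhds y] fun z => f ((z.1 + a) / 2 ^ n, 2 ^ n * z.2) := by
  obtain ⟨a, ha⟩ := exists_compBaker_neg_eq n ⌊y.1⌋ ⌊2 ^ n * y.2⌋
  refine ⟨a, fun f hf => ?_⟩
  filter_upwards [eventually_floor_eq (g := fun z => z.1) (by fun_prop) hδ hy.2,
    eventually_floor_eq (g := fun z => 2 ^ n * z.2) (by fun_prop) hδ hy.1] with z h1 h2
  exact ha f hf z h1 h2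

theorem IsGoodObservable.isObservable_compBaker {n : ℕ} {δ : ℝ} (hδ : 0 < δ) {f : ℝ × ℝ → ℂ}
    (hf : IsGoodObservable n δ f) : IsObservable (compBaker f (-n)) where
  smooth := by
    rw [contDiff_iff_contDiffAt]
    intro y
    by_cases hy : Good n δ y.swap
    · obtain ⟨a, ha⟩ := exists_compBaker_eventually_eq hδ hy
      refine ContDiffAt.congr_of_eventuallyEq (ContDiff.contDiffAt ?_) (ha f hf.obs)
      exact hf.obs.smooth.comp (by fun_prop)
    · exact contDiffAt_const.congr_of_eventuallyEq (hf.compBaker_eventually_eq_zero hy)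
  periodic_q q p := by simp only [compBaker, toSquare, Int.fract_add_one]
  periodic_p q p := by simp only [compBaker, toSquare, Int.fract_add_one]

theorem IsGoodObservable.dq_compBaker {n : ℕ} {δ : ℝ} (hδ : 0 < δ) {f : ℝ × ℝ → ℂ}
    (hf : IsGoodObservable n δ f) (y : ℝ × ℝ) :
    QBaker.dq (compBaker f (-n)) y = (1 / 2 ^ n : ℂ) * compBaker (QBaker.dq f) (-n) y := by
  by_cases hy : Good n δ y.swap
  · obtain ⟨a, ha⟩ := exists_compBaker_eventually_eq hδ hy
    rw [dq_congr (ha f hf.obs), (ha _ hf.obs.dq).self_of_nhds]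
    have h1 := hf.obs.hasDerivAt_dq ((y.1 + a) / 2 ^ n) (2 ^ n * y.2)
    have h2 : HasDerivAt (fun t : ℝ => (t + a) / 2 ^ n) (1 / 2 ^ n) y.1 :=
      ((hasDerivAt_id y.1).add_const _).div_const _
    have h3 := (h1.scomp y.1 h2).deriv
    refine h3.trans ?_
    rw [Complex.real_smul]; push_cast; rfl
  · rw [dq_congr (hf.compBaker_eventually_eq_zero hy), dq_zero, hf.dq.compBaker_eq_zero hy, mul_zero]

theorem IsGoodObservable.dp_compBaker {n : ℕ} {δ : ℝ} (hδ : 0 < δ) {f : ℝ × ℝ → ℂ}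
    (hf : IsGoodObservable n δ f) (y : ℝ × ℝ) :
    QBaker.dp (compBaker f (-n)) y = (2 ^ n : ℂ) * compBaker (QBaker.dp f) (-n) y := by
  by_cases hy : Good n δ y.swap
  · obtain ⟨a, ha⟩ := exists_compBaker_eventually_eq hδ hy
    rw [dp_congr (ha f hf.obs), (ha _ hf.obs.dp).self_of_nhds]
    have h1 := hf.obs.hasDerivAt_dp ((y.1 + a) / 2 ^ n) (2 ^ n * y.2)
    have h2 : HasDerivAt (fun t : ℝ => 2 ^ n * t) (2 ^ n) y.2 := by
      simpa using (hasDerivAt_id y.2).const_mul ((2 : ℝ) ^ n)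
    have h3 := (h1.scomp y.2 h2).deriv
    refine h3.trans ?_
    rw [Complex.real_smul]; push_cast; rfl
  · rw [dp_congr (hf.compBaker_eventually_eq_zero hy), dp_zero, hf.dp.compBaker_eq_zero hy, mul_zero]

theorem dq_const_mul (c : ℂ) (f : ℝ × ℝ → ℂ) : dq (fun x => c * f x) = fun x => c * dq f x := by
  ext x; simp only [dq, deriv_const_mul_field]

theorem dp_const_mul (c : ℂ) (f : ℝ × ℝ → ℂ) : dp (fun x => c * f x) = fun x => c * dp f x := by
  ext x; simp only [dp, deriv_const_mul_field]

theorem IsGoodObservable.iterate_compBaker {n : ℕ} {δ : ℝ} (hδ : 0 < δ) {f : ℝ × ℝ → ℂ}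
    (hf : IsGoodObservable n δ f) (i j : ℕ) :
    QBaker.dq^[i] (QBaker.dp^[j] (compBaker f (-n))) = fun y =>
      ((1 / 2 ^ n : ℂ) ^ i * (2 ^ n : ℂ) ^ j) * compBaker (QBaker.dq^[i] (QBaker.dp^[j] f)) (-n) y := by
  induction i with
  | zero =>
    induction j with
    | zero => simp
    | succ j ih =>
      simp only [Function.iterate_zero, id] at ih
      simp only [Function.iterate_zero, id, Function.iterate_succ_apply', ih, dp_const_mul]
      ext y
      have h := (hf.iterate 0 j).dp_compBaker hδ y
      simp only [Function.iterate_zero, id] at h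
      rw [h]; ring
  | succ i ih =>
    rw [Function.iterate_succ_apply', Function.iterate_succ_apply', ih, dq_const_mul]
    ext y
    rw [(hf.iterate i j).dq_compBaker hδ]; ring

/-! ### Exchanging position and momentum -/

theorem bakerFun_swap (x : Square) : bakerFun x.swap = (bakerInv x).swap := by
  unfold bakerFun bakerInv
  split_ifs <;> first | rfl | contradiction

theorem baker_pow_swap (m : ℕ) (x : Square) : (baker ^ m) x.swap = ((baker⁻¹ ^ m) x).swap := by
  induction m with
  | zero => rfl
  | succ m ih => rw [pow_succ', pow_succ', Equiv.Perm.mul_apply, ih]; exact bakerFun_swap _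

theorem compBaker_swap (f : ℝ × ℝ → ℂ) (m : ℕ) (y : ℝ × ℝ) :
    compBaker (f ∘ Prod.swap) (-m) y.swap = compBaker f m y := by
  have h1 : compBaker (f ∘ Prod.swap) (-m) y.swap
      = f (sq ((baker⁻¹ ^ m) (toSquare y).swap).swap) := by
    rw [inv_pow, ← zpow_natCast, ← zpow_neg]; rfl
  have h2 : compBaker f m y = f (sq ((baker ^ m) (toSquare y))) := by rw [← zpow_natCast]; rfl
  rw [h1, h2, ← baker_pow_swap, Prod.swap_swap]

theorem IsObservable.comp_swap {f : ℝ × ℝ → ℂ} (hf : IsObservable f) :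
    IsObservable (f ∘ Prod.swap) where
  smooth := hf.smooth.comp (contDiff_snd.prodMk contDiff_fst)
  periodic_q q p := hf.periodic_p p q
  periodic_p q p := hf.periodic_q p q

theorem iterate_dq_comp_swap (f : ℝ × ℝ → ℂ) (i : ℕ) :
    dq^[i] (f ∘ Prod.swap) = dp^[i] f ∘ Prod.swap := by
  induction i with
  | zero => rfl
  | succ i ih => rw [Function.iterate_succ_apply', Function.iterate_succ_apply', ih]; rfl

theorem iterate_dp_comp_swap (f : ℝ × ℝ → ℂ) (i : ℕ) :
    dp^[i] (f ∘ Prod.swap) = dq^[i] f ∘ Prod.swap := by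
  induction i with
  | zero => rfl
  | succ i ih => rw [Function.iterate_succ_apply', Function.iterate_succ_apply', ih]; rfl

theorem compBaker_compBaker {f : ℝ × ℝ → ℂ} (hf : IsObservable f) (m : ℤ) :
    compBaker (compBaker f m) (-m) = f := by
  ext y
  have h : compBaker (compBaker f m) (-m) y
      = f (sq ((baker ^ m) (toSquare (sq ((baker ^ (-m)) (toSquare y)))))) := rfl
  rw [h, toSquare_sq, zpow_neg]
  have h2 : (baker ^ m) ((baker ^ m)⁻¹ (toSquare y)) = toSquare y := Equiv.apply_symm_apply _ _
  rw [h2]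
  exact hf.periodic_fract y.1 y.2

theorem isGoodObservable_compBaker {m : ℕ} {δ : ℝ} (hδ : 0 < δ) {f : ℝ × ℝ → ℂ}
    (hf : IsGoodObservable m δ (f ∘ Prod.swap)) : IsGoodObservable m δ (compBaker f m) := by
  have e : compBaker f m = compBaker (f ∘ Prod.swap) (-m) ∘ Prod.swap := by
    ext y; exact (compBaker_swap f m y).symm
  refine ⟨e ▸ (hf.isObservable_compBaker hδ).comp_swap, fun x hx => ?_⟩
  rw [e]
  exact hf.compBaker_eq_zero (y := x.swap) hx

/-! ### Derivatives of cutoff observables -/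

theorem iterate_dq_eq (f : ℝ × ℝ → ℂ) (i : ℕ) (x : ℝ × ℝ) :
    dq^[i] f x = iteratedDeriv i (fun t => f (t, x.2)) x.1 := by
  induction i generalizing x with
  | zero => simp
  | succ i ih =>
    rw [Function.iterate_succ_apply', iteratedDeriv_succ, dq]
    simp_rw [ih]

theorem norm_iteratedDeriv_smul_le {u : ℝ → ℝ} {h : ℝ → ℂ} (hu : ContDiff ℝ ∞ u)
    (hh : ContDiff ℝ ∞ h) {i : ℕ} {K A α : ℝ} (hα : 1 ≤ α) {x : ℝ}
    (hu' : ∀ k ≤ i, |iteratedDeriv k u x| ≤ K * α ^ k)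
    (hh' : ∀ k ≤ i, ‖iteratedDeriv k h x‖ ≤ A) :
    ‖iteratedDeriv i (fun t => u t • h t) x‖ ≤ 2 ^ i * (K * α ^ i * A) := by
  have hK : 0 ≤ K := by
    have := (abs_nonneg _).trans (hu' 0 (Nat.zero_le _))
    simpa using this
  rw [← norm_iteratedFDeriv_eq_norm_iteratedDeriv]
  refine (norm_iteratedFDeriv_smul_le hu hh x (n := i)
    (by exact_mod_cast le_top)).trans ?_
  have h2 : (2 : ℝ) ^ i = ∑ k ∈ Finset.range (i + 1), (i.choose k : ℝ) := by
    exact_mod_cast (Nat.sum_range_choose i).symm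
  rw [h2, Finset.sum_mul]
  refine Finset.sum_le_sum fun k hk => ?_
  have hk' : k ≤ i := Nat.lt_succ_iff.mp (Finset.mem_range.mp hk)
  rw [norm_iteratedFDeriv_eq_norm_iteratedDeriv, norm_iteratedFDeriv_eq_norm_iteratedDeriv,
    Real.norm_eq_abs, mul_assoc]
  have h3 : |iteratedDeriv k u x| ≤ K * α ^ i :=
    (hu' k hk').trans (mul_le_mul_of_nonneg_left (pow_le_pow_right₀ hα hk') hK)
  have h4 := hh' (i - k) (Nat.sub_le _ _)
  gcongr

theorem norm_iterate_dq_smul_le {u : ℝ → ℝ} {f : ℝ × ℝ → ℂ} (hu : ContDiff ℝ ∞ u)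
    (hf : ContDiff ℝ ∞ f) {i : ℕ} {K A α : ℝ} (hα : 1 ≤ α)
    (hu' : ∀ k ≤ i, ∀ x, |iteratedDeriv k u x| ≤ K * α ^ k)
    (hf' : ∀ k ≤ i, ∀ x, ‖dq^[k] f x‖ ≤ A) (x : ℝ × ℝ) :
    ‖dq^[i] (fun y => u y.1 • f y) x‖ ≤ 2 ^ i * (K * α ^ i * A) := by
  rw [iterate_dq_eq]
  refine norm_iteratedDeriv_smul_le hu (hf.comp (by fun_prop)) hα (fun k hk => hu' k hk _)
    fun k hk => ?_
  have := hf' k hk x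
  rwa [iterate_dq_eq] at this

theorem norm_iterate_dp_smul_le {u : ℝ → ℝ} {f : ℝ × ℝ → ℂ} (hu : ContDiff ℝ ∞ u)
    (hf : ContDiff ℝ ∞ f) {i : ℕ} {K A α : ℝ} (hα : 1 ≤ α)
    (hu' : ∀ k ≤ i, ∀ x, |iteratedDeriv k u x| ≤ K * α ^ k)
    (hf' : ∀ k ≤ i, ∀ x, ‖dp^[k] f x‖ ≤ A) (x : ℝ × ℝ) :
    ‖dp^[i] (fun y => u y.2 • f y) x‖ ≤ 2 ^ i * (K * α ^ i * A) := by
  have e : (fun y : ℝ × ℝ => u y.2 • f y) = (fun y => u y.1 • (f ∘ Prod.swap) y) ∘ Prod.swap := rfl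
  rw [e, iterate_dp_comp_swap]
  refine norm_iterate_dq_smul_le (f := f ∘ Prod.swap) hu
    (hf.comp (contDiff_snd.prodMk contDiff_fst)) hα hu' (fun k hk y => ?_) _
  rw [iterate_dq_comp_swap]; exact hf' k hk _

theorem iterate_dp_smul (u : ℝ → ℝ) (f : ℝ × ℝ → ℂ) (j : ℕ) :
    dp^[j] (fun y => u y.1 • f y) = fun y => u y.1 • dp^[j] f y := by
  induction j with
  | zero => rfl
  | succ j ih =>
    rw [Function.iterate_succ_apply', ih, Function.iterate_succ_apply']
    ext x
    simp only [dp, Complex.real_smul, deriv_const_mul_field]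

theorem iterate_dq_smul (u : ℝ → ℝ) (f : ℝ × ℝ → ℂ) (j : ℕ) :
    dq^[j] (fun y => u y.2 • f y) = fun y => u y.2 • dq^[j] f y := by
  induction j with
  | zero => rfl
  | succ j ih =>
    rw [Function.iterate_succ_apply', ih, Function.iterate_succ_apply']
    ext x
    simp only [dq, Complex.real_smul, deriv_const_mul_field]

theorem IsObservable.smul_fst {f : ℝ × ℝ → ℂ} (hf : IsObservable f) {u : ℝ → ℝ}
    (hu : ContDiff ℝ ∞ u) (hp : Function.Periodic u 1) : IsObservable fun y => u y.1 • f y where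
  smooth := (hu.comp contDiff_fst).smul hf.smooth
  periodic_q q p := by simp only [hp q, hf.periodic_q]
  periodic_p q p := by simp only [hf.periodic_p]

theorem IsObservable.smul_snd {f : ℝ × ℝ → ℂ} (hf : IsObservable f) {u : ℝ → ℝ}
    (hu : ContDiff ℝ ∞ u) (hp : Function.Periodic u 1) : IsObservable fun y => u y.2 • f y where
  smooth := (hu.comp contDiff_snd).smul hf.smooth
  periodic_q q p := by simp only [hf.periodic_q]
  periodic_p q p := by simp only [hp p, hf.periodic_p]

theorem IsCutoff.apply_eq_zero {K δ : ℝ} {χ : ℝ → ℝ} (hχ : IsCutoff K δ χ) {t : ℝ} {k : ℤ}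
    (h : |t - k| < δ) : χ t = 0 := by
  have h1 := hχ.periodic.sub_int_mul_eq (x := t) k
  rw [mul_one] at h1
  rw [← h1]
  exact hχ.eq_zero _ (abs_le.mp h.le)

/-- The good part of an observable, for non-negative times. -/
def cutoffPart (χ : ℝ → ℝ) (n : ℕ) (a : ℝ × ℝ → ℂ) (x : ℝ × ℝ) : ℂ :=
  χ (2 ^ n * x.1) • χ x.2 • a x

theorem periodic_comp_two_pow_mul {χ : ℝ → ℝ} (hχ : Function.Periodic χ 1) (n : ℕ) :
    Function.Periodic (fun t => χ (2 ^ n * t)) 1 := fun t => by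
  have := hχ.nat_mul (2 ^ n) (2 ^ n * t)
  simp only
  rw [← this]
  congr 1; push_cast; ring

theorem IsCutoff.isGoodObservable {K δ : ℝ} {χ : ℝ → ℝ} (hχ : IsCutoff K δ χ) {a : ℝ × ℝ → ℂ}
    (ha : IsObservable a) (n : ℕ) : IsGoodObservable n δ (cutoffPart χ n a) where
  obs := (ha.smul_snd hχ.smooth hχ.periodic).smul_fst (u := fun t => χ (2 ^ n * t))
    (hχ.smooth.comp (by fun_prop)) (periodic_comp_two_pow_mul hχ.periodic n)
  supp x hx := by
    simp only [Good, not_and_or, not_forall, not_le] at hx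
    rw [cutoffPart]
    rcases hx with ⟨k, hk⟩ | ⟨k, hk⟩
    · rw [hχ.apply_eq_zero hk, zero_smul]
    · rw [hχ.apply_eq_zero hk, zero_smul, smul_zero]

theorem IsCutoff.norm_deriv_cutoffPart_le {K δ : ℝ} {χ : ℝ → ℝ} (hχ : IsCutoff K δ χ) (hδ : 0 < δ)
    (h1 : δ ≤ 1) {a : ℝ × ℝ → ℂ} (ha : IsObservable a) {A : ℝ} (hA0 : 0 ≤ A)
    (hA : ∀ i j, i + j ≤ 4 → ∀ x, ‖dq^[i] (dp^[j] a) x‖ ≤ A) (n : ℕ) {i j : ℕ} (hij : i + j ≤ 4)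
    (x : ℝ × ℝ) :
    ‖dq^[i] (dp^[j] (cutoffPart χ n a)) x‖
      ≤ 16 * K ^ 2 * A * (2 ^ n * (1 / δ)) ^ i * (1 / δ) ^ j := by
  have hδ1 : 1 ≤ 1 / δ := by rw [le_div_iff₀ hδ]; linarith
  have h2n : (1 : ℝ) ≤ 2 ^ n := one_le_pow₀ (by norm_num)
  have hs1 : 1 ≤ 2 ^ n * (1 / δ) := one_le_mul_of_one_le_of_one_le h2n hδ1
  have hd (k : ℕ) (hk : k ≤ 4) (t : ℝ) : |iteratedDeriv k χ t| ≤ K * (1 / δ) ^ k := by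
    rw [one_div_pow, mul_one_div]; exact hχ.deriv_le k hk t
  have hb := ha.smul_snd hχ.smooth hχ.periodic
  set b : ℝ × ℝ → ℂ := fun y => χ y.2 • a y with hbdef
  have hb' (k : ℕ) (hk : k ≤ i) (y : ℝ × ℝ) :
      ‖dq^[k] (dp^[j] b) y‖ ≤ 2 ^ j * (K * (1 / δ) ^ j * A) := by
    rw [iterate_dq_iterate_dp hb, hbdef, iterate_dq_smul]
    refine norm_iterate_dp_smul_le hχ.smooth (ha.iterate_dq k).smooth hδ1
      (fun l hl => hd l (by omega)) (fun l hl z => ?_) y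
    rw [← iterate_dq_iterate_dp ha]
    exact hA k l (by omega) z
  have hu : ContDiff ℝ ∞ fun t => χ (2 ^ n * t) := hχ.smooth.comp (by fun_prop)
  have hu' (k : ℕ) (hk : k ≤ i) (t : ℝ) :
      |iteratedDeriv k (fun t => χ (2 ^ n * t)) t| ≤ K * (2 ^ n * (1 / δ)) ^ k := by
    rw [iteratedDeriv_comp_const_mul (hχ.smooth.of_le (by exact_mod_cast le_top)), abs_mul, abs_pow,
      abs_of_nonneg (by positivity : (0 : ℝ) ≤ 2 ^ n), mul_pow]
    have := mul_le_mul_of_nonneg_left (hd k (by omega) (2 ^ n * t))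
      (by positivity : (0 : ℝ) ≤ (2 ^ n) ^ k)
    linarith
  have e : dp^[j] (cutoffPart χ n a) = fun y => (fun t => χ (2 ^ n * t)) y.1 • dp^[j] b y :=
    iterate_dp_smul (fun t => χ (2 ^ n * t)) b j
  rw [e]
  refine (norm_iterate_dq_smul_le hu (hb.iterate_dp j).smooth hs1 hu' hb' x).trans ?_
  have h16 : (2 : ℝ) ^ (i + j) ≤ 2 ^ 4 := pow_le_pow_right₀ (by norm_num) hij
  calc _ = 2 ^ (i + j) * (K ^ 2 * A * (2 ^ n * (1 / δ)) ^ i * (1 / δ) ^ j) := by rw [pow_add]; ring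
    _ ≤ 2 ^ 4 * (K ^ 2 * A * (2 ^ n * (1 / δ)) ^ i * (1 / δ) ^ j) :=
        mul_le_mul_of_nonneg_right h16 (by positivity)
    _ = _ := by ring


/-! ### Weyl and corrected anti-Wick symbols -/

/-- The symbol whose anti-Wick quantisation with squeezing `s` is close to the Weyl quantisation
of `g`. -/
def corrected (N : ℕ) (s : ℝ) (g : ℝ × ℝ → ℂ) (x : ℝ × ℝ) : ℂ :=
  g x - ((1 / (8 * Real.pi * N * s) : ℝ) : ℂ) * dq^[2] (dp^[0] g) x
    - ((s / (8 * Real.pi * N) : ℝ) : ℂ) * dq^[0] (dp^[2] g) x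

theorem continuous_corrected (N : ℕ) (s : ℝ) {g : ℝ × ℝ → ℂ} (hg : IsObservable g) :
    Continuous (corrected N s g) := by
  have h1 := ((hg.iterate_dp 0).iterate_dq 2).smooth.continuous
  have h2 := ((hg.iterate_dp 2).iterate_dq 0).smooth.continuous
  have h0 := hg.smooth.continuous
  unfold corrected
  fun_prop

theorem fourierCoeff₂_sub {f g : ℝ × ℝ → ℂ} (hf : Continuous f) (hg : Continuous g) (k : ℤ × ℤ) :
    fourierCoeff₂ (fun x => f x - g x) k = fourierCoeff₂ f k - fourierCoeff₂ g k := by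
  unfold fourierCoeff₂
  simp_rw [sub_mul]
  refine MeasureTheory.integral_sub ?_ ?_
  · exact integrable_of_continuous (by fun_prop)
  · exact integrable_of_continuous (by fun_prop)

theorem fourierCoeff₂_const_mul (c : ℂ) (f : ℝ × ℝ → ℂ) (k : ℤ × ℤ) :
    fourierCoeff₂ (fun x => c * f x) k = c * fourierCoeff₂ f k := by
  unfold fourierCoeff₂
  simp_rw [mul_assoc]
  exact MeasureTheory.integral_const_mul _ _

theorem fourierCoeff₂_corrected {N : ℕ} (hN : 0 < N) {s : ℝ} (hs : 0 < s) {g : ℝ × ℝ → ℂ}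
    (hg : IsObservable g) (k : ℤ × ℤ) :
    fourierCoeff₂ (corrected N s g) k = ((1 + qform N s k : ℝ) : ℂ) * fourierCoeff₂ g k := by
  have h1 := ((hg.iterate_dp 0).iterate_dq 2).smooth.continuous
  have h2 := ((hg.iterate_dp 2).iterate_dq 0).smooth.continuous
  have h0 := hg.smooth.continuous
  have hNc : (N : ℂ) ≠ 0 := by exact_mod_cast hN.ne'
  have hsc : (s : ℂ) ≠ 0 := by exact_mod_cast hs.ne'
  have hπ : (Real.pi : ℂ) ≠ 0 := by exact_mod_cast Real.pi_ne_zero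
  unfold corrected
  rw [fourierCoeff₂_sub (by fun_prop) (by fun_prop), fourierCoeff₂_sub (by fun_prop) (by fun_prop),
    fourierCoeff₂_const_mul, fourierCoeff₂_const_mul, fourierCoeff₂_iterate hg,
    fourierCoeff₂_iterate hg, qform]
  push_cast
  field_simp
  rw [Complex.I_sq]
  ring

section Egorov
open scoped Matrix.Norms.L2Operator

theorem weyl_sub_antiWick_corrected {N : ℕ} (hN : 0 < N) {s : ℝ} (hs : 0 < s) {g : ℝ × ℝ → ℂ}
    (hg : IsObservable g) :
    weyl N g - antiWick N s (corrected N s g) = transSum N (remCoeff N s g) := by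
  have hr := summable_trans N (summable_remCoeff hg N hs)
  have hw := summable_trans N (summable_fourierCoeff₂ hg)
  have h (k : ℤ × ℤ) : (Real.exp (-qform N s k) : ℂ) * fourierCoeff₂ (corrected N s g) k
      = fourierCoeff₂ g k - remCoeff N s g k := by
    rw [fourierCoeff₂_corrected hN hs hg, remCoeff]; push_cast; ring
  rw [weyl_eq_transSum, antiWick, transSum, transSum, transSum]
  simp_rw [h, sub_smul]
  rw [hw.tsum_sub hr, sub_sub_cancel]

theorem norm_corrected_le {N : ℕ} (hN : 0 < N) {s ρ M h : ℝ} (hs : 0 < s) (h1 : h ≤ 1)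
    (hM : 0 ≤ M) (hsρ : s * ρ ^ 2 ≤ h * N) {g : ℝ × ℝ → ℂ} {x : ℝ × ℝ} (h00 : ‖g x‖ ≤ M)
    (h20 : ‖dq^[2] (dp^[0] g) x‖ ≤ M * (s * ρ) ^ 2) (h02 : ‖dq^[0] (dp^[2] g) x‖ ≤ M * ρ ^ 2) :
    ‖corrected N s g x‖ ≤ 2 * M := by
  have hNr : (0 : ℝ) < N := by exact_mod_cast hN
  have hπ := Real.pi_gt_three
  have hsN : s * ρ ^ 2 ≤ N := hsρ.trans (mul_le_of_le_one_left hNr.le h1)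
  have c1 : 0 ≤ 1 / (8 * Real.pi * N * s) := by positivity
  have c2 : 0 ≤ s / (8 * Real.pi * N) := by positivity
  have key : s * ρ ^ 2 / (8 * Real.pi * N) ≤ 1 / 2 := by
    rw [div_le_iff₀ (by positivity)]; nlinarith
  have e1 : 1 / (8 * Real.pi * N * s) * (M * (s * ρ) ^ 2) = M * (s * ρ ^ 2 / (8 * Real.pi * N)) := by
    field_simp
  have e2 : s / (8 * Real.pi * N) * (M * ρ ^ 2) = M * (s * ρ ^ 2 / (8 * Real.pi * N)) := by
    field_simp
  have b1 := mul_le_mul_of_nonneg_left h20 c1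
  have b2 := mul_le_mul_of_nonneg_left h02 c2
  rw [e1] at b1
  rw [e2] at b2
  have b3 := mul_le_mul_of_nonneg_left key hM
  unfold corrected
  refine (norm_sub_le _ _).trans ?_
  have := norm_sub_le (g x) (((1 / (8 * Real.pi * N * s) : ℝ) : ℂ) * dq^[2] (dp^[0] g) x)
  rw [norm_mul, Complex.norm_real, Real.norm_of_nonneg c1] at this
  rw [norm_mul, Complex.norm_real, Real.norm_of_nonneg c2]
  linarith

theorem one_div_pow_mul_pow {T : ℝ} (hT : T ≠ 0) (M r : ℝ) (i j : ℕ) :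
    (1 / T) ^ i * T ^ j * (M * (T * r) ^ i * r ^ j) = M * (T * r) ^ j * r ^ i := by
  rw [mul_pow, mul_pow, one_div_pow]
  field_simp

theorem corrected_compBaker {N : ℕ} {n : ℕ} {δ : ℝ} (hδ : 0 < δ) {g : ℝ × ℝ → ℂ}
    (hg : IsGoodObservable n δ g) :
    corrected N (1 / 2 ^ n) (compBaker g (-n)) = compBaker (corrected N (2 ^ n) g) (-n) := by
  ext y
  have h (y : ℝ × ℝ) : compBaker (corrected N (2 ^ n) g) (-n) y = compBaker g (-n) y
      - ((1 / (8 * Real.pi * N * 2 ^ n) : ℝ) : ℂ) * compBaker (dq^[2] (dp^[0] g)) (-n) y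
      - ((2 ^ n / (8 * Real.pi * N) : ℝ) : ℂ) * compBaker (dq^[0] (dp^[2] g)) (-n) y := rfl
  rw [h, corrected, hg.iterate_compBaker hδ, hg.iterate_compBaker hδ]
  have h2 : (2 : ℂ) ^ n ≠ 0 := pow_ne_zero _ two_ne_zero
  have e1 : ((1 / (8 * Real.pi * N * (1 / 2 ^ n)) : ℝ) : ℂ) * ((1 / 2 ^ n : ℂ) ^ 2 * (2 ^ n : ℂ) ^ 0)
      = ((1 / (8 * Real.pi * N * 2 ^ n) : ℝ) : ℂ) := by
    push_cast
    generalize (2 : ℂ) ^ n = T at h2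
    rw [pow_zero, mul_one, one_div_pow]
    field_simp
  have e2 : ((1 / 2 ^ n / (8 * Real.pi * N) : ℝ) : ℂ) * ((1 / 2 ^ n : ℂ) ^ 0 * (2 ^ n : ℂ) ^ 2)
      = ((2 ^ n / (8 * Real.pi * N) : ℝ) : ℂ) := by
    push_cast
    generalize (2 : ℂ) ^ n = T at h2
    rw [pow_zero, one_mul]
    field_simp
  simp only [← mul_assoc] at e1 e2 ⊢
  rw [e1, e2]

theorem norm_conj_le_of_unitary {N : ℕ} {U : Matrix (Fin N) (Fin N) ℂ}
    (hU : U ∈ unitary (Matrix (Fin N) (Fin N) ℂ)) (A : Matrix (Fin N) (Fin N) ℂ) :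
    ‖U * A * star U‖ ≤ ‖A‖ := by
  have h1 := norm_le_one_of_unitary hU
  have h2 := norm_le_one_of_unitary (Unitary.star_mem hU)
  calc _ ≤ ‖U * A‖ * ‖star U‖ := norm_mul_le _ _
    _ ≤ ‖U * A‖ := mul_le_of_le_one_right (norm_nonneg _) h2
    _ ≤ ‖U‖ * ‖A‖ := norm_mul_le _ _
    _ ≤ ‖A‖ := mul_le_of_le_one_left (norm_nonneg _) h1

/-- Egorov's theorem for observables that vanish near the discontinuities. -/
theorem norm_conj_weyl_sub_le {N : ℕ} (hev : Even N) (hN : 0 < N) {n : ℕ} (hn : (2 : ℝ) ^ n ≤ N)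
    {δ h M : ℝ} (hδ : 0 < δ) (hh : 0 < h) (h1 : h ≤ 1) (hM : 0 ≤ M) (hρ : (1 / δ) ^ 2 ≤ 1 / h)
    (hsρ : 2 ^ n * (1 / δ) ^ 2 ≤ h * N) {g : ℝ × ℝ → ℂ} (hg : IsGoodObservable n δ g)
    (hgM : ∀ i j, i + j ≤ 4 → ∀ x,
      ‖dq^[i] (dp^[j] g) x‖ ≤ M * (2 ^ n * (1 / δ)) ^ i * (1 / δ) ^ j) :
    ‖quantumBaker N ^ n * weyl N g * star (quantumBaker N ^ n) - weyl N (compBaker g (-n))‖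
      ≤ 60 * M * h + 28800 * M * n * N ^ 3 * Real.exp (-(Real.pi / 2 * (N * δ ^ 2 / 2 ^ n))) := by
  have hs : (0 : ℝ) < 2 ^ n := by positivity
  set f := compBaker g (-n) with hf
  have hfo : IsObservable f := hg.isObservable_compBaker hδ
  have hfM (i j : ℕ) (hij : i + j ≤ 4) (x : ℝ × ℝ) :
      ‖dq^[i] (dp^[j] f) x‖ ≤ M * (2 ^ n * (1 / δ)) ^ j * (1 / δ) ^ i := by
    rw [hf, hg.iterate_compBaker hδ, norm_mul, norm_mul, norm_pow, norm_pow, norm_div, norm_pow,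
      norm_one, Complex.norm_ofNat]
    have h2 := hgM i j hij (sq ((baker ^ (-(n : ℤ))) (toSquare x)))
    exact (mul_le_mul_of_nonneg_left h2 (by positivity)).trans_eq
      (one_div_pow_mul_pow (by positivity) _ _ _ _)
  have cg := continuous_corrected N (2 ^ n) hg.obs
  have cf := continuous_corrected N (1 / 2 ^ n) hfo
  have eL := corrected_compBaker (N := N) hδ hg
  have bL (x : ℝ × ℝ) : ‖corrected N (2 ^ n) g x‖ ≤ 2 * M :=
    norm_corrected_le hN hs h1 hM hsρ (by simpa using hgM 0 0 (by norm_num) x)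
      (by simpa using hgM 2 0 (by norm_num) x) (by simpa using hgM 0 2 (by norm_num) x)
  have r1 := norm_remainder_le hg.obs hN hs hh h1 hM hρ hsρ
    (fun x => by simpa using hgM 4 0 (by norm_num) x) (fun x => hgM 2 2 (by norm_num) x)
    (fun x => by simpa using hgM 0 4 (by norm_num) x)
  have r2 := norm_remainder_rot_le hfo hN hs hh h1 hM hρ hsρ
    (fun x => by simpa using hfM 0 4 (by norm_num) x) (fun x => hfM 2 2 (by norm_num) x)
    (fun x => by simpa using hfM 4 0 (by norm_num) x)
  have r3 := norm_conj_antiWick_sub_le hev hN hn hδ cg cf bL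
    (fun x => by rw [eL]; exact bL _)
    (fun x hx => by
      rw [corrected, (hg.iterate 2 0).supp x hx, (hg.iterate 0 2).supp x hx, hg.supp x hx]; simp)
    (fun x hx => by rw [eL]; exact compBaker_bakerIter _ n hx)
  rw [← weyl_sub_antiWick_corrected hN hs hg.obs] at r1
  rw [← weyl_sub_antiWick_corrected hN (by positivity) hfo] at r2
  have hU : quantumBaker N ^ n ∈ unitary (Matrix (Fin N) (Fin N) ℂ) :=
    pow_mem (quantumBaker_mem_unitary hN hev) n
  set U := quantumBaker N ^ n
  set G := antiWick N (2 ^ n) (corrected N (2 ^ n) g)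
  set F := antiWick N (1 / 2 ^ n) (corrected N (1 / 2 ^ n) f)
  have r4 := (norm_conj_le_of_unitary hU (weyl N g - G)).trans r1
  have e : U * weyl N g * star U - weyl N f
      = U * (weyl N g - G) * star U + (U * G * star U - F) - (weyl N f - F) := by noncomm_ring
  rw [e]
  calc _ ≤ ‖U * (weyl N g - G) * star U + (U * G * star U - F)‖ + ‖weyl N f - F‖ := norm_sub_le _ _
    _ ≤ ‖U * (weyl N g - G) * star U‖ + ‖U * G * star U - F‖ + ‖weyl N f - F‖ := by
      gcongr; exact norm_add_le _ _
    _ ≤ _ := by linarith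

theorem goodPart_natCast (χ : ℝ → ℝ) (a : ℝ × ℝ → ℂ) (n : ℕ) :
    goodPart χ a n = cutoffPart χ n a := by
  ext x
  simp only [goodPart, torusCutoff, cutoffPart, Complex.real_smul, Int.natCast_nonneg, if_true,
    Int.natAbs_natCast]
  push_cast; ring

theorem goodPart_neg (χ : ℝ → ℝ) (a : ℝ × ℝ → ℂ) {n : ℕ} (hn : 0 < n) :
    goodPart χ a (-n) = cutoffPart χ n (a ∘ Prod.swap) ∘ Prod.swap := by
  ext x
  have h : ¬ (0 : ℤ) ≤ -n := by omega
  simp only [goodPart, torusCutoff, cutoffPart, Complex.real_smul, h, if_false, Int.natAbs_neg,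
    Int.natAbs_natCast, Function.comp, Prod.swap_swap, Prod.fst_swap, Prod.snd_swap]
  push_cast; ring

theorem IsCutoff.norm_conj_weyl_sub_le {K δ : ℝ} {χ : ℝ → ℝ} (hχ : IsCutoff K δ χ) (hδ : 0 < δ)
    (hδ1 : δ ≤ 1) {a : ℝ × ℝ → ℂ} (ha : IsObservable a) {N : ℕ} (hev : Even N) (hN : 0 < N) {n : ℤ}
    {m : ℕ} (hm : n.natAbs = m) (hn : (2 : ℝ) ^ m ≤ N) {h : ℝ} (hh : 0 < h) (h1 : h ≤ 1)
    (hρ : (1 / δ) ^ 2 ≤ 1 / h) (hsρ : 2 ^ m * (1 / δ) ^ 2 ≤ h * N) :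
    IsObservable (compBaker (goodPart χ a n) (-n)) ∧
      ‖quantumBaker N ^ n * weyl N (goodPart χ a n) * quantumBaker N ^ (-n)
          - weyl N (compBaker (goodPart χ a n) (-n))‖
        ≤ 60 * (16 * K ^ 2 * cNorm 4 a) * h + 28800 * (16 * K ^ 2 * cNorm 4 a) * m * N ^ 3
            * Real.exp (-(Real.pi / 2 * (N * δ ^ 2 / 2 ^ m))) := by
  have hA0 := cNorm_nonneg 4 a
  have hM : 0 ≤ 16 * K ^ 2 * cNorm 4 a := by positivity
  have hU : quantumBaker N ^ m ∈ unitary (Matrix (Fin N) (Fin N) ℂ) :=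
    pow_mem (quantumBaker_mem_unitary hN hev) m
  have hinv : (quantumBaker N ^ m)⁻¹ = star (quantumBaker N ^ m) :=
    Matrix.inv_eq_left_inv (Unitary.star_mul_self_of_mem hU)
  have hz : quantumBaker N ^ (-(m : ℤ)) = star (quantumBaker N ^ m) := by
    rw [Matrix.zpow_neg_natCast, hinv]
  rcases le_or_gt 0 n with hn0 | hn0
  · obtain rfl : n = m := by omega
    have hg := hχ.isGoodObservable ha m
    rw [goodPart_natCast, hz, zpow_natCast]
    exact ⟨hg.isObservable_compBaker hδ, QBaker.norm_conj_weyl_sub_le hev hN hn hδ hh h1 hM hρ hsρ hg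
      fun i j hij x => hχ.norm_deriv_cutoffPart_le hδ hδ1 ha hA0
        (fun i j hij => ha.norm_deriv_le_cNorm hij) m hij x⟩
  · obtain rfl : n = -m := by omega
    have hm0 : 0 < m := by omega
    have hg := hχ.isGoodObservable ha.comp_swap m
    have hd := fun i j (hij : i + j ≤ 4) x => hχ.norm_deriv_cutoffPart_le hδ hδ1 ha.comp_swap hA0
      (A := cNorm 4 a) (fun i j hij x => by
        rw [iterate_dp_comp_swap, iterate_dq_comp_swap, Function.comp,
          ← iterate_dq_iterate_dp ha]
        exact ha.norm_deriv_le_cNorm (by omega) _) m hij x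
    rw [neg_neg, hz, zpow_natCast, goodPart_neg χ a hm0]
    set b := cutoffPart χ m (a ∘ Prod.swap) with hb
    set f := b ∘ Prod.swap with hf
    have hfb : f ∘ Prod.swap = b := by ext x; simp [hf]
    have hfo : IsObservable f := hg.obs.comp_swap
    have hcg : IsGoodObservable m δ (compBaker f m) := isGoodObservable_compBaker hδ (hfb ▸ hg)
    have hback : compBaker (compBaker f m) (-m) = f := compBaker_compBaker hfo m
    have e : compBaker f m = compBaker b (-m) ∘ Prod.swap := by
      ext y; rw [← hfb]; exact (compBaker_swap f m y).symm
    have key := QBaker.norm_conj_weyl_sub_le hev hN hn hδ hh h1 hM hρ hsρ hcg (fun i j hij x => by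
      rw [e, iterate_dp_comp_swap, iterate_dq_comp_swap, Function.comp,
        ← iterate_dq_iterate_dp (hg.isObservable_compBaker hδ), hg.iterate_compBaker hδ, norm_mul,
        norm_mul, norm_pow, norm_pow, norm_div, norm_pow, norm_one, Complex.norm_ofNat]
      have h2 := hd j i (by omega) (sq ((baker ^ (-(m : ℤ))) (toSquare x.swap)))
      exact (mul_le_mul_of_nonneg_left h2 (by positivity)).trans_eq
        (one_div_pow_mul_pow (by positivity) _ _ _ _))
    rw [hback] at key
    refine ⟨hcg.obs, le_trans ?_ key⟩
    have hU1 := Unitary.star_mul_self_of_mem hU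
    set U := quantumBaker N ^ m
    have hc := norm_conj_le_of_unitary (Unitary.star_mem hU)
      (weyl N f - U * weyl N (compBaker f m) * star U)
    rw [star_star] at hc
    have e2 : star U * (weyl N f - U * weyl N (compBaker f m) * star U) * U
        = star U * weyl N f * U - weyl N (compBaker f m) := by
      rw [mul_sub, sub_mul]
      congr 1
      calc _ = (star U * U) * weyl N (compBaker f m) * (star U * U) := by noncomm_ring
        _ = _ := by rw [hU1, one_mul, mul_one]
    rw [e2] at hc
    rw [norm_sub_rev (U * weyl N (compBaker f m) * star U)]
    exact hc

end Egorov

theorem exists_threshold {ε : ℝ} (hε : 0 < ε) : ∃ N₀ : ℕ, ∀ N : ℕ, N₀ ≤ N →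
    (N : ℝ) ^ (-(ε / 4)) ≤ 1 / 10 ∧
    (N : ℝ) ^ 4 * Real.exp (-(Real.pi / 2 * (N : ℝ) ^ (ε / 2))) ≤ (N : ℝ) ^ (-(ε / 2)) := by
  have h1 : Filter.Tendsto (fun N : ℕ => (N : ℝ) ^ (-(ε / 4))) Filter.atTop (nhds 0) :=
    (tendsto_rpow_neg_atTop (by positivity)).comp tendsto_natCast_atTop_atTop
  have h2 : Filter.Tendsto (fun N : ℕ => ((N : ℝ) ^ (ε / 2)) ^ (8 / ε + 1)
      * Real.exp (-(Real.pi / 2) * (N : ℝ) ^ (ε / 2))) Filter.atTop (nhds 0) :=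
    ((tendsto_rpow_mul_exp_neg_mul_atTop_nhds_zero (8 / ε + 1) (Real.pi / 2) (by positivity)).comp
      (tendsto_rpow_atTop (by positivity))).comp tendsto_natCast_atTop_atTop
  have h := ((h1.eventually_le_const (by norm_num : (0 : ℝ) < 1 / 10)).and
    (h2.eventually_le_const zero_lt_one)).and (Filter.eventually_gt_atTop 0)
  obtain ⟨N₀, hN₀⟩ := Filter.eventually_atTop.mp h
  refine ⟨N₀, fun N hN => ?_⟩
  obtain ⟨⟨g1, g2⟩, g3⟩ := hN₀ N hN
  have hNr : (0 : ℝ) < N := by exact_mod_cast g3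
  refine ⟨g1, ?_⟩
  have e : ((N : ℝ) ^ (ε / 2)) ^ (8 / ε + 1) = (N : ℝ) ^ 4 * (N : ℝ) ^ (ε / 2) := by
    rw [← Real.rpow_mul hNr.le, ← Real.rpow_natCast, ← Real.rpow_add hNr]
    congr 1; push_cast; field_simp; ring
  have hpos : 0 < (N : ℝ) ^ (ε / 2) := by positivity
  rw [e] at g2
  rw [Real.rpow_neg hNr.le, ← one_div, le_div_iff₀ hpos]
  refine le_trans (le_of_eq ?_) g2
  rw [neg_mul]; ring

theorem two_pow_natAbs_le {ε : ℝ} {N : ℕ} (hN : 0 < N) {n : ℤ}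
    (hn : |(n : ℝ)| ≤ (1 - ε) * ehrenfestTime N) : (2 : ℝ) ^ n.natAbs ≤ (N : ℝ) ^ (1 - ε) := by
  have hNr : (0 : ℝ) < N := by exact_mod_cast hN
  have hlog : 0 < Real.log 2 := Real.log_pos one_lt_two
  rw [← Real.rpow_natCast, Nat.cast_natAbs, Int.cast_abs, Real.rpow_def_of_pos two_pos,
    Real.rpow_def_of_pos hNr]
  refine Real.exp_le_exp.mpr ?_
  calc _ ≤ Real.log 2 * ((1 - ε) * ehrenfestTime N) := mul_le_mul_of_nonneg_left hn hlog.le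
    _ = _ := by rw [ehrenfestTime]; field_simp

end QBaker

end

theorem mainTheorem3 :
    ∃ N₀ : ℝ → ℕ, ∀ K : ℝ, ∃ C : ℝ, 0 < C ∧
      ∀ ε : ℝ, 0 < ε →
      ∀ a : ℝ × ℝ → ℂ, QBaker.IsObservable a →
      ∀ N : ℕ, Even N → 0 < N → N₀ ε ≤ N →
      ∀ (δ : ℝ) (χ : ℝ → ℝ), δ < 1 / 4 → min ((N : ℝ) ^ (-(ε / 4))) (1 / 10) ≤ δ →
        QBaker.IsCutoff K δ χ →
      ∀ n : ℤ, |(n : ℝ)| ≤ (1 - ε) * QBaker.ehrenfestTime N →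
        QBaker.IsObservable (QBaker.compBaker (QBaker.goodPart χ a n) (-n)) ∧
        QBaker.opNorm
            (QBaker.quantumBaker N ^ n * QBaker.weyl N (QBaker.goodPart χ a n)
                * QBaker.quantumBaker N ^ (-n)
              - QBaker.weyl N (QBaker.compBaker (QBaker.goodPart χ a n) (-n)))
          ≤ C * (QBaker.supNorm a * (N : ℝ) ^ (3 / 2 : ℝ)
                    * Real.exp (-(Real.pi * (N : ℝ) ^ (ε / 2)))
                  + QBaker.cNorm 4 a / (N : ℝ) ^ (ε / 2)) := by
  choose N₀ hN₀ using fun ε : {ε : ℝ // 0 < ε} => QBaker.exists_threshold ε.2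
  refine ⟨fun ε => if h : 0 < ε then N₀ ⟨ε, h⟩ else 0, fun K => ⟨461760 * K ^ 2 + 1, by positivity, ?_⟩⟩
  intro ε hε a ha N hev hN hNN δ χ hδ hδ' hχ n hn
  simp only [dif_pos hε] at hNN
  obtain ⟨t1, t2⟩ := hN₀ ⟨ε, hε⟩ N hNN
  rw [min_eq_left t1] at hδ'
  have hNr : (0 : ℝ) < N := by exact_mod_cast hN
  have hN1 : (1 : ℝ) ≤ N := by exact_mod_cast hN
  have hδ0 : 0 < δ := lt_of_lt_of_le (by positivity) hδ'
  have hpow := QBaker.two_pow_natAbs_le hN hn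
  have hpowN : (2 : ℝ) ^ n.natAbs ≤ N :=
    hpow.trans ((Real.rpow_le_rpow_of_exponent_le hN1 (by linarith)).trans_eq (Real.rpow_one _))
  set h := (N : ℝ) ^ (-(ε / 2)) with hh
  have hh0 : 0 < h := by positivity
  have hh1 : h ≤ 1 := Real.rpow_le_one_of_one_le_of_nonpos hN1 (by linarith)
  have hinv : 1 / h = (N : ℝ) ^ (ε / 2) := by rw [hh, Real.rpow_neg hNr.le, one_div, inv_inv]
  have hδ2 : h ≤ δ ^ 2 := by
    have e : h = ((N : ℝ) ^ (-(ε / 4))) ^ 2 := by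
      rw [← Real.rpow_natCast, ← Real.rpow_mul hNr.le, hh]; congr 1; push_cast; ring
    rw [e]; exact pow_le_pow_left₀ (by positivity) hδ' 2
  have hρ : (1 / δ) ^ 2 ≤ 1 / h := by
    rw [one_div_pow]; exact one_div_le_one_div_of_le hh0 hδ2
  have hmul : (N : ℝ) ^ (1 - ε) * (1 / h) = h * N := by
    rw [hinv, hh, ← Real.rpow_add hNr, ← Real.rpow_add_one hNr.ne']; congr 1; ring
  have hsρ : 2 ^ n.natAbs * (1 / δ) ^ 2 ≤ h * N :=
    (mul_le_mul hpow hρ (by positivity) (by positivity)).trans_eq hmul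
  obtain ⟨r1, r2⟩ := hχ.norm_conj_weyl_sub_le hδ0 (by linarith) ha hev hN rfl hpowN hh0 hh1 hρ hsρ
  refine ⟨r1, ?_⟩
  rw [QBaker.opNorm_eq]
  refine r2.trans ?_
  have hA0 := QBaker.cNorm_nonneg 4 a
  have hexp : (N : ℝ) ^ (ε / 2) ≤ N * δ ^ 2 / 2 ^ n.natAbs := by
    have h2 : (0 : ℝ) < 2 ^ n.natAbs := by positivity
    rw [← hinv, div_le_div_iff₀ hh0 h2]
    have : 2 ^ n.natAbs * (1 / δ) ^ 2 * δ ^ 2 ≤ h * N * δ ^ 2 :=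
      mul_le_mul_of_nonneg_right hsρ (by positivity)
    have e : 2 ^ n.natAbs * (1 / δ) ^ 2 * δ ^ 2 = 2 ^ n.natAbs := by field_simp
    linarith
  have hE : (n.natAbs : ℝ) * N ^ 3 * Real.exp (-(Real.pi / 2 * (N * δ ^ 2 / 2 ^ n.natAbs))) ≤ h := by
    have hnN : (n.natAbs : ℝ) ≤ N :=
      le_trans (by exact_mod_cast Nat.lt_two_pow_self.le) hpowN
    refine le_trans ?_ t2
    have h3 : Real.exp (-(Real.pi / 2 * (N * δ ^ 2 / 2 ^ n.natAbs)))
        ≤ Real.exp (-(Real.pi / 2 * (N : ℝ) ^ (ε / 2))) :=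
      Real.exp_le_exp.mpr (neg_le_neg (mul_le_mul_of_nonneg_left hexp (by positivity)))
    calc _ ≤ (N : ℝ) * N ^ 3 * Real.exp (-(Real.pi / 2 * (N : ℝ) ^ (ε / 2))) := by gcongr
      _ = _ := by ring
  have hKA : 0 ≤ K ^ 2 * QBaker.cNorm 4 a := by positivity
  have hS : 0 ≤ QBaker.supNorm a * (N : ℝ) ^ (3 / 2 : ℝ)
      * Real.exp (-(Real.pi * (N : ℝ) ^ (ε / 2))) :=
    mul_nonneg (mul_nonneg (QBaker.supNorm_nonneg a) (by positivity)) (Real.exp_pos _).le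
  have hdiv : QBaker.cNorm 4 a / (N : ℝ) ^ (ε / 2) = QBaker.cNorm 4 a * h := by
    rw [← hinv, div_div_eq_mul_div, div_one]
  rw [hdiv]
  have hEm := mul_le_mul_of_nonneg_left hE hKA
  have hAh : 0 ≤ QBaker.cNorm 4 a * h := by positivity
  have hKS : 0 ≤ (461760 * K ^ 2 + 1) * (QBaker.supNorm a * (N : ℝ) ^ (3 / 2 : ℝ)
      * Real.exp (-(Real.pi * (N : ℝ) ^ (ε / 2)))) := mul_nonneg (by positivity) hS
  rw [mul_add]
  calc _ ≤ 461760 * (K ^ 2 * QBaker.cNorm 4 a * h) := by linarith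
    _ ≤ (461760 * K ^ 2 + 1) * (QBaker.cNorm 4 a * h) := by nlinarith
    _ ≤ _ := by linarith
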